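/- Let $k$ be a field of characteristic different from $2$ and let $\mathcal O$ be a cyclic operad in $k$-vector spaces; for a finite set $X$ write $\mathcal O((X))$ for the space of operations whose inputs and root are together labelled by $X$. Consider finite graphs (loops and multiple edges allowed) all of whose vertices have valence $\ge 3$. An orientation is an ordering of the vertices and a direction of each edge, modulo even changes; an $\mathcal O$-labelling assigns to each vertex $x$, with set of half-edges $H(x)$, an element of $\mathcal O((H(x)))$. Let $\mathcal G^{\mathcal O}$ be the $k$-space spanned by isomorphism classes of $\mathcal O$-labelled oriented graphs, modulo $(G,or)=-(G,-or)$ and multilinearity in the labels, graded by the number of vertices. Let $P\mathcal G^{\mathcal O}\subset\mathcal G^{\mathcal O}$ be spanned by the connected graphs, let $S(P\mathcal G^{\mathcal O})=\bigoplus_i S^i(P\mathcal G^{\mathcal O})$ be its graded symmetric algebra, let $\pi_i$ be the projection onto $S^i(P\mathcal G^{\mathcal O})$, and let $S:\mathcal G^{\mathcal O}\to S(P\mathcal G^{\mathcal O})$ be the map that sends a graph to the (signed) product of its connected components. For $i\ge 1$ and a labelled oriented graph $G$, let $\partial_i G$ be the sum, over all $i$-tuples $(e_1,\dots,e_i)$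 of directed edges of $G$ lying on $i$ different edges, of the following graphs. Choose the representative of the orientation of $G$ in which each $e_m$ is directed as in the tuple, with $e_m$ running from the half-edge $a_m$ to the half-edge $b_m$; delete the edges $e_1,\dots,e_i$ and join $b_m$ to $a_{m+1}$ (indices modulo $i$) by a new edge directed from $a_{m+1}$ to $b_m$, i.e. glue a $2i$-gon along $e_1,\dots,e_i$; finally contract the new edge joining $b_1$ to $a_2$ (for $i=1$, joining $b_1$ to $a_1$), composing the labels of its endpoints in $\mathcal O$. The contraction of a loop is $0$. If an edge is directed from the first to the second vertex, its contraction makes the merged vertex the first one and keeps the order of the others. (1) For every $i\ge 1$ there is a unique odd derivation $\theta_i$ of the graded algebra $S(P\mathcal G^{\mathcal O})$ with $\theta_i(G)=\tfrac12\,\pi_i\bigl(S(\partial_i G)\bigr)$ for all connected labelled oriented graphs $G$. For each $s\in S(P\mathcal G^{\mathcal O})$ only finitely many $\theta_i(s)$ are nonzero. (2) For every subset $I$, finite or infinite, of $\mathbb N=\{1,2,3,\dots\}$, the operator $\theta_I=\sum_{i\in I}\theta_i$ satisfies $\theta_I^2=0$. Moreover $\theta_I$ is a co-$Lie_\infty$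 structure on $P\mathcal G^{\mathcal O}$, that is, a derivation of $S(P\mathcal G^{\mathcal O})$ of degree $-1$ and of square zero such that $\theta_I(P\mathcal G^{\mathcal O})$ has no component in $S^0(P\mathcal G^{\mathcal O})$. (3) Two subsets $I,J\subseteq\mathbb N$ satisfy $\theta_I=\theta_J$ if and only if they contain the same indices $i$ with $\theta_i\ne 0$. The set of co-$Lie_\infty$ structures $\{\theta_I : I\subseteq\mathbb N\}$ is uncountable if and only if $\theta_i\neq 0$ for infinitely many $i$. -/

import Mathlib

open scoped Classical

universe u v

noncomputable section

namespace FissionOperad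

/-! ## Cyclic operads -/

/-- The bijection between the two ways of writing the free labels of a three-fold composite
`a ∘ b ∘ c`, where `x` is glued to `y` and `y'` is glued to `z`. -/
def assocEquiv {X Y Z : Type} (x : X) (y y' : Y) (z : Z) (h : y' ≠ y) :
    {p : {a : X // a ≠ x} ⊕ {b : Y // b ≠ y} // p ≠ Sum.inr ⟨y', h⟩} ⊕ {c : Z // c ≠ z} ≃
      {a : X // a ≠ x} ⊕
        {q : {b : Y // b ≠ y'} ⊕ {c : Z // c ≠ z} // q ≠ Sum.inl ⟨y, h.symm⟩} where
  toFun
    | Sum.inl ⟨Sum.inl a, _⟩ => Sum.inl a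
    | Sum.inl ⟨Sum.inr b, hb⟩ =>
        Sum.inr ⟨Sum.inl ⟨b.1, fun e => hb (congrArg Sum.inr (Subtype.ext e))⟩,
          fun e => b.2 (congrArg Subtype.val (Sum.inl.inj e))⟩
    | Sum.inr c => Sum.inr ⟨Sum.inr c, Sum.inr_ne_inl⟩
  invFun
    | Sum.inl a => Sum.inl ⟨Sum.inl a, Sum.inl_ne_inr⟩
    | Sum.inr ⟨Sum.inl b, hb⟩ =>
        Sum.inl ⟨Sum.inr ⟨b.1, fun e => hb (congrArg Sum.inl (Subtype.ext e))⟩,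
          fun e => b.2 (congrArg Subtype.val (Sum.inr.inj e))⟩
    | Sum.inr ⟨Sum.inr c, _⟩ => Sum.inr c
  left_inv := by rintro (⟨a | b, h⟩ | c) <;> rfl
  right_inv := by rintro (a | ⟨b | c, h⟩) <;> rfl

/-- The bijection `(X ∖ x) ⊔ ({false, true} ∖ false) ≃ X` sending `true` to `x`. -/
def unitEquiv {X : Type} (x : X) : {a : X // a ≠ x} ⊕ {b : Bool // b ≠ false} ≃ X where
  toFun := Sum.elim (fun a => a.1) (fun _ => x)
  invFun a := if h : a = x then Sum.inr ⟨true, by simp⟩ else Sum.inl ⟨a, h⟩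
  left_inv := by
    rintro (⟨a, h⟩ | ⟨b, h⟩)
    · simp [h]
    · cases b
      · exact absurd rfl h
      · simp
  right_inv a := by by_cases h : a = x <;> simp [h]

/-- A cyclic operad in the category of `k`-vector spaces, in its coordinate-free form.
For a finite set `X`, `obj X` is the space `𝒪((X))` of operations whose inputs and root are
together labelled by `X` (so `obj (Fin (n + 1))` is `𝒪(n)` with its action of `S_{n+1}`), and
`comp x y a b` composes `a` and `b` by grafting the leaf `x` of `a` to the leaf `y` of `b`. -/
structure CyclicOperad (k : Type v) [Field k] where
  obj (X : Type) [Finite X] : Type u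
  [addCommGroup (X : Type) [Finite X] : AddCommGroup (obj X)]
  [module (X : Type) [Finite X] : Module k (obj X)]
  /-- relabelling along a bijection -/
  map {X Y : Type} [Finite X] [Finite Y] (σ : X ≃ Y) : obj X →ₗ[k] obj Y
  map_refl {X : Type} [Finite X] (a : obj X) : map (Equiv.refl X) a = a
  map_trans {X Y Z : Type} [Finite X] [Finite Y] [Finite Z] (σ : X ≃ Y) (τ : Y ≃ Z) (a : obj X) :
    map (σ.trans τ) a = map τ (map σ a)
  /-- grafting -/
  comp {X Y : Type} [Finite X] [Finite Y] (x : X) (y : Y) :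
    obj X →ₗ[k] obj Y →ₗ[k] obj ({a : X // a ≠ x} ⊕ {b : Y // b ≠ y})
  comp_map {X Y X' Y' : Type} [Finite X] [Finite Y] [Finite X'] [Finite Y']
    (σ : X ≃ X') (τ : Y ≃ Y') (x : X) (y : Y) (a : obj X) (b : obj Y) :
    comp (σ x) (τ y) (map σ a) (map τ b) =
      map (Equiv.sumCongr
        (σ.subtypeEquiv (p := fun a => a ≠ x) (q := fun a => a ≠ σ x) fun _ => by simp)
        (τ.subtypeEquiv (p := fun b => b ≠ y) (q := fun b => b ≠ τ y) fun _ => by simp))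
        (comp x y a b)
  comp_comm {X Y : Type} [Finite X] [Finite Y] (x : X) (y : Y) (a : obj X) (b : obj Y) :
    comp y x b a = map (Equiv.sumComm _ _) (comp x y a b)
  comp_assoc {X Y Z : Type} [Finite X] [Finite Y] [Finite Z] (x : X) (y y' : Y) (z : Z)
    (h : y' ≠ y) (a : obj X) (b : obj Y) (c : obj Z) :
    comp x (Sum.inl ⟨y, h.symm⟩) a (comp y' z b c) =
      map (assocEquiv x y y' z h) (comp (Sum.inr ⟨y', h⟩) z (comp x y a b) c)
  /-- the unit `1 ∈ 𝒪(1)` -/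
  one : obj Bool
  map_one (σ : Bool ≃ Bool) : map σ one = one
  comp_one {X : Type} [Finite X] (x : X) (a : obj X) :
    map (unitEquiv x) (comp x false a one) = a

attribute [instance] CyclicOperad.addCommGroup CyclicOperad.module

/-! ## Oriented graphs -/

/-- A finite graph with all vertices of valence at least three (loops and multiple edges are
allowed, the graph need not be connected and may be empty), together with a representative of an
orientation: an ordering of the vertices and a direction of every edge.  `H` is the set of
half-edges, `root h` the vertex at which `h` is attached, the edges are the orbits `{h, inv h}`
of the fixed-point free involution `inv`, and an edge is directed from its half-edge with
`tail h = true` to the other one. -/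
structure OGraph where
  V : Type
  H : Type
  [fintypeV : Fintype V]
  [orderV : LinearOrder V]
  [fintypeH : Fintype H]
  root : H → V
  inv : Equiv.Perm H
  inv_inv (h : H) : inv (inv h) = h
  inv_ne (h : H) : inv h ≠ h
  tail : H → Bool
  tail_inv (h : H) : tail (inv h) = !tail h
  valence (x : V) : 3 ≤ Nat.card {h : H // root h = x}

attribute [instance] OGraph.fintypeV OGraph.orderV OGraph.fintypeH

namespace OGraph

/-- The set `H(x)` of half-edges incident to the vertex `x`. -/
abbrev Flags (Γ : OGraph) (x : Γ.V) : Type := {h : Γ.H // Γ.root h = x}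

/-- The underlying simple graph; it is only used to speak of connectedness and of connected
components. -/
def simple (Γ : OGraph) : SimpleGraph Γ.V where
  Adj x y := x ≠ y ∧ ∃ h, Γ.root h = x ∧ Γ.root (Γ.inv h) = y
  symm := ⟨by
    rintro x y ⟨hne, h, hx, hy⟩
    exact ⟨hne.symm, Γ.inv h, hy, by rw [Γ.inv_inv, hx]⟩⟩
  loopless := ⟨fun _ h => h.1 rfl⟩

/-- The set of connected components. -/
abbrev Comp (Γ : OGraph) : Type := Γ.simple.ConnectedComponent

/-- The connected component of a vertex. -/
abbrev compOf (Γ : OGraph) (x : Γ.V) : Γ.Comp := Γ.simple.connectedComponentMk x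

/-- A graph is connected if it is nonempty and any two vertices are joined by a path. -/
def IsConnected (Γ : OGraph) : Prop := Γ.simple.Connected

/-- An isomorphism of the underlying (unoriented) graphs. -/
structure Iso (Γ Δ : OGraph) where
  v : Γ.V ≃ Δ.V
  h : Γ.H ≃ Δ.H
  root_h (a : Γ.H) : Δ.root (h a) = v (Γ.root a)
  inv_h (a : Γ.H) : Δ.inv (h a) = h (Γ.inv a)

namespace Iso

variable {Γ Δ : OGraph}

/-- The bijection of half-edges at a vertex. -/
def flags (φ : Iso Γ Δ) (x : Γ.V) : Γ.Flags x ≃ Δ.Flags (φ.v x) :=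
  φ.h.subtypeEquiv fun a => by rw [φ.root_h, φ.v.apply_eq_iff_eq]

/-- The number of transpositions and of edge reversals relating the two orientations: inversions
of the vertex ordering plus edges whose direction is not preserved. -/
def parity (φ : Iso Γ Δ) : ℕ :=
  Nat.card {p : Γ.V × Γ.V // p.1 < p.2 ∧ φ.v p.2 < φ.v p.1} +
    Nat.card {a : Γ.H // Γ.tail a = true ∧ Δ.tail (φ.h a) = false}

end Iso

/-! ### Connected components as graphs -/

theorem compOf_inv (Γ : OGraph) (h : Γ.H) :
    Γ.compOf (Γ.root (Γ.inv h)) = Γ.compOf (Γ.root h) := by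
  by_cases e : Γ.root (Γ.inv h) = Γ.root h
  · rw [e]
  · exact SimpleGraph.ConnectedComponent.connectedComponentMk_eq_of_adj
      ⟨e, Γ.inv h, rfl, by rw [Γ.inv_inv]⟩

/-- The half-edges at a vertex of a component are those of the whole graph. -/
def componentFlags (Γ : OGraph) (C : Γ.Comp) (x : {x : Γ.V // x ∈ C.supp}) :
    Γ.Flags x.1 ≃ {h : {h : Γ.H // Γ.root h ∈ C.supp} //
      (⟨Γ.root h.1, h.2⟩ : {x : Γ.V // x ∈ C.supp}) = x} where
  toFun h := ⟨⟨h.1, by rw [h.2]; exact x.2⟩, Subtype.ext h.2⟩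
  invFun h := ⟨h.1.1, congrArg Subtype.val h.2⟩
  left_inv _ := rfl
  right_inv _ := rfl

/-- A connected component with the restricted vertex ordering and edge directions. -/
def component (Γ : OGraph) (C : Γ.Comp) : OGraph where
  V := {x : Γ.V // x ∈ C.supp}
  H := {h : Γ.H // Γ.root h ∈ C.supp}
  root h := ⟨Γ.root h.1, h.2⟩
  inv := Γ.inv.subtypeEquiv fun h => by
    change Γ.compOf (Γ.root h) = C ↔ Γ.compOf (Γ.root (Γ.inv h)) = C
    rw [Γ.compOf_inv h]
  inv_inv h := Subtype.ext (Γ.inv_inv h.1)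
  inv_ne h e := Γ.inv_ne h.1 (congrArg Subtype.val e)
  tail h := Γ.tail h.1
  tail_inv h := Γ.tail_inv h.1
  valence x := by
    rw [← Nat.card_congr (Γ.componentFlags C x)]
    exact Γ.valence x.1

theorem component_isConnected (Γ : OGraph) (C : Γ.Comp) : (Γ.component C).IsConnected := by
  have key : (Γ.component C).simple = C.toSimpleGraph := by
    ext x y
    constructor
    · rintro ⟨hne, h, hx, hy⟩
      exact ⟨fun e => hne (Subtype.ext e), h.1, congrArg Subtype.val hx, congrArg Subtype.val hy⟩
    · rintro ⟨hne, h, hx, hy⟩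
      refine ⟨fun e => hne (congrArg Subtype.val e), ⟨h, ?_⟩, Subtype.ext hx, Subtype.ext hy⟩
      rw [hx]; exact x.2
  unfold IsConnected
  rw [key]
  exact C.connected_toSimpleGraph

/-! ### Gluing a polygon -/

/-- `n` directed edges lying on `n` different edges of the graph; a directed edge is given by the
half-edge at which it starts, so that the `m`-th one runs from `d m` to `inv (d m)`. -/
abbrev EdgeTuple (Γ : OGraph) (n : ℕ) : Type :=
  {d : Fin n ↪ Γ.H // ∀ i j, d i ≠ Γ.inv (d j)}

namespace EdgeTuple

variable {Γ : OGraph} {n : ℕ}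

/-- The cyclic permutation `d 0 ↦ d 1 ↦ ⋯ ↦ d (n-1) ↦ d 0` of the starting half-edges. -/
def cycle (d : Γ.EdgeTuple n) : Equiv.Perm Γ.H := (finRotate n).viaFintypeEmbedding d.1

theorem cycle_apply (d : Γ.EdgeTuple n) (m : Fin n) :
    d.cycle (d.1 m) = d.1 (finRotate n m) :=
  Equiv.Perm.viaFintypeEmbedding_apply_image _ _ _

theorem cycle_apply_of_notMem (d : Γ.EdgeTuple n) {h : Γ.H} (hh : ∀ m, d.1 m ≠ h) :
    d.cycle h = h :=
  Equiv.Perm.viaFintypeEmbedding_apply_notMem_range _ _ (by rintro ⟨m, hm⟩; exact hh m hm)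

/-- The edge directions after all `n` edges have been redirected along `d`. -/
def tail (d : Γ.EdgeTuple n) (h : Γ.H) : Bool :=
  if ∃ m, d.1 m = h then true else if ∃ m, Γ.inv (d.1 m) = h then false else Γ.tail h

theorem tail_inv (d : Γ.EdgeTuple n) (h : Γ.H) : d.tail (Γ.inv h) = !d.tail h := by
  have e1 : (∃ m, Γ.inv (d.1 m) = Γ.inv h) ↔ ∃ m, d.1 m = h := by simp
  have e2 : (∃ m, d.1 m = Γ.inv h) ↔ ∃ m, Γ.inv (d.1 m) = h := by
    refine exists_congr fun m => ⟨fun e => by rw [e, Γ.inv_inv], fun e => by rw [← e, Γ.inv_inv]⟩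
  have e3 : ¬ ((∃ m, d.1 m = h) ∧ ∃ m, Γ.inv (d.1 m) = h) := by
    rintro ⟨⟨m, hm⟩, m', hm'⟩
    exact d.2 m m' (hm.trans hm'.symm)
  unfold tail
  by_cases a : ∃ m, d.1 m = h <;> by_cases b : ∃ m, Γ.inv (d.1 m) = h
  · exact absurd ⟨a, b⟩ e3
  all_goals simp only [e1, e2, a, b, Γ.tail_inv, if_true, if_false, Bool.not_true, Bool.not_false]

theorem tail_cycle (d : Γ.EdgeTuple n) (h : Γ.H) : d.tail (d.cycle h) = d.tail h := by
  by_cases a : ∃ m, d.1 m = h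
  · obtain ⟨m, rfl⟩ := a
    rw [cycle_apply]
    simp [tail]
  · rw [cycle_apply_of_notMem d fun m e => a ⟨m, e⟩]

/-- The number of edges whose direction has to be reversed to agree with `d`. -/
def flips (d : Γ.EdgeTuple n) : ℕ := Nat.card {m : Fin n // Γ.tail (d.1 m) = false}

end EdgeTuple

/-- The graph `Γ⟨e₁, …, eₙ⟩` obtained by gluing a `2n`-gon along the directed edges `d` and deleting
those edges.  The end of the `m`-th edge gets joined to the start of the `(m+1)`-st (cyclically),
that is, `inv' (inv (d m)) = d (m+1)`, and the new edge is directed from `d (m+1)` to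
`inv (d m)`, against the direction in which the boundary of the polygon runs.  This is relative to
the orientation of `Γ` in which the old edges are directed along `d`. -/
def glue (Γ : OGraph) {n : ℕ} (d : Γ.EdgeTuple n) : OGraph where
  V := Γ.V
  H := Γ.H
  root := Γ.root
  inv := (d.cycle.symm.trans Γ.inv).trans d.cycle
  inv_inv h := by simp [Γ.inv_inv]
  inv_ne h e := Γ.inv_ne (d.cycle.symm h) (by
    apply d.cycle.injective
    simpa using e)
  tail := d.tail
  tail_inv h := by
    have := d.tail_cycle (d.cycle.symm h)
    rw [Equiv.apply_symm_apply] at this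
    simp only [Equiv.trans_apply]
    rw [d.tail_cycle, d.tail_inv, this]
  valence := Γ.valence

/-! ### Contracting an edge -/

/-- The half-edges at a vertex not on the contracted edge. -/
def contractFlagsOther (Γ : OGraph) (t : Γ.H) (ht : Γ.root t ≠ Γ.root (Γ.inv t))
    (x : {x : Γ.V // x ≠ Γ.root (Γ.inv t)}) (hx : x.1 ≠ Γ.root t) :
    Γ.Flags x.1 ≃ {h : {h : Γ.H // h ≠ t ∧ h ≠ Γ.inv t} //
      (if e : Γ.root h.1 = Γ.root (Γ.inv t) then ⟨Γ.root t, ht⟩ else ⟨Γ.root h.1, e⟩ :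
        {x : Γ.V // x ≠ Γ.root (Γ.inv t)}) = x} where
  toFun h := ⟨⟨h.1, fun e => hx (by rw [← h.2, e]), fun e => x.2 (by rw [← h.2, e])⟩, by
    have : Γ.root h.1 ≠ Γ.root (Γ.inv t) := by rw [h.2]; exact x.2
    simp only [this, dite_false]
    exact Subtype.ext h.2⟩
  invFun h := ⟨h.1.1, by
    have h2 := h.2
    split_ifs at h2 with e
    · exact absurd (congrArg Subtype.val h2).symm hx
    · exact congrArg Subtype.val h2⟩
  left_inv _ := rfl
  right_inv _ := rfl

/-- The half-edges at the vertex arising from the two endpoints of the contracted edge. -/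
def contractFlagsMerged (Γ : OGraph) (t : Γ.H) (ht : Γ.root t ≠ Γ.root (Γ.inv t)) :
    {h : Γ.Flags (Γ.root t) // h ≠ ⟨t, rfl⟩} ⊕
        {h : Γ.Flags (Γ.root (Γ.inv t)) // h ≠ ⟨Γ.inv t, rfl⟩} ≃
      {h : {h : Γ.H // h ≠ t ∧ h ≠ Γ.inv t} //
        (if e : Γ.root h.1 = Γ.root (Γ.inv t) then ⟨Γ.root t, ht⟩ else ⟨Γ.root h.1, e⟩ :
          {x : Γ.V // x ≠ Γ.root (Γ.inv t)}) = ⟨Γ.root t, ht⟩} where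
  toFun
    | Sum.inl h => ⟨⟨h.1.1, fun e => h.2 (Subtype.ext e), fun e => ht (by rw [← h.1.2, e])⟩, by
        have : Γ.root h.1.1 ≠ Γ.root (Γ.inv t) := by rw [h.1.2]; exact ht
        simp only [this, dite_false]
        exact Subtype.ext h.1.2⟩
    | Sum.inr h => ⟨⟨h.1.1, fun e => ht (by rw [← h.1.2, e]), fun e => h.2 (Subtype.ext e)⟩, by
        simp only [h.1.2, dite_true]⟩
  invFun h :=
    if e : Γ.root h.1.1 = Γ.root (Γ.inv t) then
      Sum.inr ⟨⟨h.1.1, e⟩, fun e' => h.1.2.2 (congrArg Subtype.val e')⟩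
    else
      Sum.inl ⟨⟨h.1.1, by
        have h2 := h.2
        simp only [e, dite_false] at h2
        exact congrArg Subtype.val h2⟩, fun e' => h.1.2.1 (congrArg Subtype.val e')⟩
  left_inv := by
    rintro (h | h)
    · have : Γ.root h.1.1 ≠ Γ.root (Γ.inv t) := by rw [h.1.2]; exact ht
      simp only [this, dite_false]
    · have : Γ.root h.1.1 = Γ.root (Γ.inv t) := h.1.2
      simp only [this, dite_true]
  right_inv h := by
    by_cases e : Γ.root h.1.1 = Γ.root (Γ.inv t)
    · simp only [e, dite_true]
    · simp only [e, dite_false]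

/-- The contraction of the edge `{t, inv t}`, which is not a loop: the vertex `root (inv t)` is
removed and its remaining half-edges are moved to the vertex `root t`. -/
def contract (Γ : OGraph) (t : Γ.H) (ht : Γ.root t ≠ Γ.root (Γ.inv t)) : OGraph where
  V := {x : Γ.V // x ≠ Γ.root (Γ.inv t)}
  H := {h : Γ.H // h ≠ t ∧ h ≠ Γ.inv t}
  root h := if e : Γ.root h.1 = Γ.root (Γ.inv t) then ⟨Γ.root t, ht⟩ else ⟨Γ.root h.1, e⟩
  inv := Γ.inv.subtypeEquiv fun h => by
    constructor
    · rintro ⟨a, b⟩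
      exact ⟨fun e => b (by rw [← e, Γ.inv_inv]), fun e => a (Γ.inv.injective e)⟩
    · rintro ⟨a, b⟩
      exact ⟨fun e => b (by rw [e]), fun e => a (by rw [e, Γ.inv_inv])⟩
  inv_inv h := Subtype.ext (Γ.inv_inv h.1)
  inv_ne h e := Γ.inv_ne h.1 (congrArg Subtype.val e)
  tail h := Γ.tail h.1
  tail_inv h := Γ.tail_inv h.1
  valence x := by
    by_cases hx : x.1 = Γ.root t
    · obtain rfl : x = ⟨Γ.root t, ht⟩ := Subtype.ext hx
      rw [← Nat.card_congr (Γ.contractFlagsMerged t ht), Nat.card_sum]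
      have h1 : 3 ≤ Nat.card (Γ.Flags (Γ.root t)) := Γ.valence _
      have h2 : 3 ≤ Nat.card (Γ.Flags (Γ.root (Γ.inv t))) := Γ.valence _
      have key (x : Γ.V) (a : Γ.Flags x) :
          Nat.card {h : Γ.Flags x // h ≠ a} = Nat.card (Γ.Flags x) - 1 := by
        rw [Nat.card_eq_fintype_card, Nat.card_eq_fintype_card]
        exact Set.card_ne_eq a
      rw [key, key]
      omega
    · rw [← Nat.card_congr (Γ.contractFlagsOther t ht x hx)]
      exact Γ.valence x.1

/-- The sign (as an exponent of `-1`) of the contraction of an edge directed from `t` to `inv t`.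
If its endpoints are the first and the second vertex, the exponent is `0` and the new vertex becomes
the first one.  In general one first permutes the vertices into that position, and finally moves the
new vertex back to the place of `root t`; the sign of these permutations is `(-1)^(q-1)`, where `q`
is the number of vertices before `root (inv t)`. -/
def contractParity (Γ : OGraph) (t : Γ.H) : ℕ :=
  Nat.card {x : Γ.V // x < Γ.root (Γ.inv t)} + 1

end OGraph

/-! ## The graph complex as a vector space -/

variable {k : Type v} [Field k] (O : CyclicOperad.{u} k)

/-- An `𝒪`-labelled oriented graph: every vertex `x` carries an element of `𝒪((H(x)))`. -/
def LGraph : Type (max 1 u) := Σ Γ : OGraph, (x : Γ.V) → O.obj (Γ.Flags x)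

variable {O}

/-- The number of vertices. -/
def LGraph.nverts (g : LGraph O) : ℕ := Nat.card g.1.V

/-- A single labelled oriented graph in the free vector space on all of them. -/
def LGraph.free (g : LGraph O) : LGraph O →₀ k := Finsupp.single g 1

variable (O)

/-- The relations: isomorphic labelled graphs are identified, where a change of orientation
changes the sign, and the labels are multilinear. -/
inductive Rel : (LGraph O →₀ k) → Prop
  | iso {Γ Δ : OGraph} (φ : OGraph.Iso Γ Δ) (o : (x : Γ.V) → O.obj (Γ.Flags x))
      (o' : (x : Δ.V) → O.obj (Δ.Flags x)) (h : ∀ x, o' (φ.v x) = O.map (φ.flags x) (o x)) :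
      Rel (LGraph.free ⟨Γ, o⟩ - (-1 : k) ^ φ.parity • LGraph.free ⟨Δ, o'⟩)
  | add (Γ : OGraph) (o : (x : Γ.V) → O.obj (Γ.Flags x)) (x : Γ.V) (a b : O.obj (Γ.Flags x)) :
      Rel (LGraph.free ⟨Γ, Function.update o x (a + b)⟩ -
        (LGraph.free ⟨Γ, Function.update o x a⟩ + LGraph.free ⟨Γ, Function.update o x b⟩))
  | smul (Γ : OGraph) (o : (x : Γ.V) → O.obj (Γ.Flags x)) (x : Γ.V) (c : k)
      (a : O.obj (Γ.Flags x)) :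
      Rel (LGraph.free ⟨Γ, Function.update o x (c • a)⟩ -
        c • LGraph.free ⟨Γ, Function.update o x a⟩)

/-- The space `𝒢^𝒪` spanned by `𝒪`-labelled oriented graphs. -/
abbrev GraphSpace : Type (max 1 u v) := (LGraph O →₀ k) ⧸ Submodule.span k {r | Rel O r}

variable {O}

/-- The class of a labelled oriented graph. -/
def LGraph.cls (g : LGraph O) : GraphSpace O :=
  (Submodule.span k {r | Rel O r}).mkQ g.free

variable (O)

/-- The subspace `P𝒢^𝒪` spanned by connected graphs. -/
def prim : Submodule k (GraphSpace O) :=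
  Submodule.span k {y | ∃ g : LGraph O, g.1.IsConnected ∧ y = g.cls}

/-- The part of `P𝒢^𝒪` spanned by connected graphs with `n` vertices. -/
def primDeg (n : ℕ) : Submodule k (prim O) :=
  Submodule.span k {y | ∃ g : LGraph O, g.1.IsConnected ∧ g.nverts = n ∧ y.1 = g.cls}

/-! ## The graded symmetric algebra `S(P𝒢^𝒪)` -/

/-- Graded commutativity. -/
inductive SymRel : TensorAlgebra k (prim O) → TensorAlgebra k (prim O) → Prop
  | comm {m n : ℕ} {x y : prim O} (hx : x ∈ primDeg O m) (hy : y ∈ primDeg O n) :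
      SymRel (TensorAlgebra.ι k x * TensorAlgebra.ι k y)
        ((-1 : k) ^ (m * n) • (TensorAlgebra.ι k y * TensorAlgebra.ι k x))

/-- The graded symmetric algebra `S(P𝒢^𝒪)`, where graphs are graded by their number of
vertices. -/
abbrev SymPrim : Type (max 1 u v) := RingQuot (SymRel O)

/-- The inclusion of `P𝒢^𝒪` in `S(P𝒢^𝒪)`. -/
def incl : prim O →ₗ[k] SymPrim O :=
  (RingQuot.mkAlgHom k (SymRel O)).toLinearMap ∘ₗ TensorAlgebra.ι k

variable {O}

/-- A connected labelled graph as an element of `S(P𝒢^𝒪)`. -/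
def LGraph.gen (g : LGraph O) (hg : g.1.IsConnected) : SymPrim O :=
  incl O ⟨g.cls, Submodule.subset_span ⟨g, hg, rfl⟩⟩

variable (O)

theorem incl_comm {m n : ℕ} {x y : prim O} (hx : x ∈ primDeg O m) (hy : y ∈ primDeg O n) :
    incl O x * incl O y = (-1 : k) ^ (m * n) • (incl O y * incl O x) := by
  have := RingQuot.mkAlgHom_rel k (SymRel.comm hx hy)
  rw [map_smul, map_mul, map_mul] at this
  exact this

/-- The algebra homomorphism `S(P𝒢^𝒪) → S(P𝒢^𝒪)[X]` that multiplies an element of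
`S^i(P𝒢^𝒪)` by `X^i`. -/
def wordLength : SymPrim O →ₐ[k] Polynomial (SymPrim O) :=
  RingQuot.liftAlgHom k ⟨TensorAlgebra.lift k
    (((Polynomial.monomial 1 : SymPrim O →ₗ[SymPrim O] Polynomial (SymPrim O)).restrictScalars k) ∘ₗ
      incl O), by
    rintro _ _ ⟨hx, hy⟩
    simp only [map_mul, map_smul, TensorAlgebra.lift_ι_apply, LinearMap.comp_apply,
      LinearMap.restrictScalars_apply, Polynomial.monomial_mul_monomial, Polynomial.smul_monomial]
    rw [incl_comm O hx hy]⟩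

/-- The projection `π_i : S(P𝒢^𝒪) → S^i(P𝒢^𝒪)`, followed by the inclusion in `S(P𝒢^𝒪)`. -/
def symProj (i : ℕ) : SymPrim O →ₗ[k] SymPrim O :=
  ((Polynomial.lcoeff (SymPrim O) i).restrictScalars k) ∘ₗ (wordLength O).toLinearMap

/-- The part of degree `n` of `S(P𝒢^𝒪)`, where the degree is the total number of vertices. -/
def symDeg (n : ℕ) : Submodule k (SymPrim O) :=
  Submodule.span k {s | ∃ l : List {g : LGraph O // g.1.IsConnected},
    (l.map fun g => g.1.nverts).sum = n ∧ s = (l.map fun g => g.1.gen g.2).prod}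

/-- Derivations of odd degree of the graded algebra `S(P𝒢^𝒪)`. -/
def IsOddDerivation (D : SymPrim O →ₗ[k] SymPrim O) : Prop :=
  ∀ (n : ℕ) (a b : SymPrim O), a ∈ symDeg O n →
    D (a * b) = D a * b + (-1 : k) ^ n • (a * D b)

/-- A co-`Lie_∞` structure on `P𝒢^𝒪`: a derivation of `S(P𝒢^𝒪)` of degree `-1`, without
constant term, whose square is zero. -/
structure IsCoLieInfty (D : SymPrim O →ₗ[k] SymPrim O) : Prop where
  derivation : IsOddDerivation O D
  degree_zero (s : SymPrim O) : s ∈ symDeg O 0 → D s = 0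
  degree_succ (n : ℕ) (s : SymPrim O) : s ∈ symDeg O (n + 1) → D s ∈ symDeg O n
  no_constant (x : prim O) : symProj O 0 (D (incl O x)) = 0
  square_zero : D ∘ₗ D = 0

/-! ## Fission -/

variable {O}

namespace LGraph

/-- The connected component `C` of a labelled graph. -/
def component (g : LGraph O) (C : g.1.Comp) : LGraph O :=
  ⟨g.1.component C, fun x => O.map (g.1.componentFlags C x) (g.2 x.1)⟩

/-- The isomorphism `S : 𝒢^𝒪 ≅ S(P𝒢^𝒪)` on a labelled oriented graph: the product of its connected
components, enumerated in some order, with the sign of the permutation that rearranges the vertices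
accordingly. -/
def split (g : LGraph O) : SymPrim O :=
  let e : g.1.Comp ≃ Fin (Nat.card g.1.Comp) := Finite.equivFin g.1.Comp
  (-1 : k) ^ Nat.card {p : g.1.V × g.1.V //
      p.1 < p.2 ∧ e (g.1.compOf p.2) < e (g.1.compOf p.1)} •
    (List.ofFn fun j => (g.component (e.symm j)).gen (g.1.component_isConnected (e.symm j))).prod

/-- Gluing a polygon only changes how the half-edges are joined, not the labels. -/
def glue (g : LGraph O) {n : ℕ} (d : g.1.EdgeTuple n) : LGraph O := ⟨g.1.glue d, g.2⟩

/-- The contraction of a non-loop edge: the labels of its endpoints are composed along it. -/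
def contract (g : LGraph O) (t : g.1.H) (ht : g.1.root t ≠ g.1.root (g.1.inv t)) : LGraph O :=
  ⟨g.1.contract t ht, fun x =>
    if hx : x.1 = g.1.root t then
      (Subtype.ext hx.symm : (⟨g.1.root t, ht⟩ : {x // x ≠ g.1.root (g.1.inv t)}) = x) ▸
        (show O.obj ((g.1.contract t ht).Flags ⟨g.1.root t, ht⟩) from
          O.map (g.1.contractFlagsMerged t ht)
            (O.comp ⟨t, rfl⟩ ⟨g.1.inv t, rfl⟩ (g.2 (g.1.root t)) (g.2 (g.1.root (g.1.inv t)))))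
    else O.map (g.1.contractFlagsOther t ht x hx) (g.2 x.1)⟩

/-- The contraction `(G, or)_e` of the edge `e` directed from `t` to `inv t`, as a signed labelled
oriented graph; it is zero if `e` is a loop. -/
def contractEdge (g : LGraph O) (t : g.1.H) : LGraph O →₀ k :=
  if ht : g.1.root t ≠ g.1.root (g.1.inv t) then
    (-1 : k) ^ g.1.contractParity t • (g.contract t ht).free
  else 0

/-- The operator `∂_i` on a labelled oriented graph: the sum over all ways of gluing a `2i`-gon to
`i` directed edges, followed by the contraction of the edge of the polygon between the first and
the second edge of the tuple (for `i = 1`, of the other edge of the bigon). This edge is directed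
from `d 1` to `inv (d 0)`. -/
def polygonBoundary (i : ℕ+) (g : LGraph O) : LGraph O →₀ k :=
  ∑ d : g.1.EdgeTuple i,
    (-1 : k) ^ d.flips • (g.glue d).contractEdge (d.1 (finRotate i ⟨0, i.pos⟩))

/-- `½ π_i ∘ S ∘ ∂_i` on a labelled oriented graph. -/
def fission (i : ℕ+) (g : LGraph O) : SymPrim O :=
  (1 / 2 : k) • symProj O i (Finsupp.linearCombination k split (g.polygonBoundary i))

end LGraph

variable (O)

/-- `D` is the fission operator `θ_i` on `S(P𝒢^𝒪)`: the extension of `½ π_i ∘ S ∘ ∂_i`, defined on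
connected graphs, as a derivation. -/
def IsFission (i : ℕ+) (D : SymPrim O →ₗ[k] SymPrim O) : Prop :=
  IsOddDerivation O D ∧
    ∀ (g : LGraph O) (hg : g.1.IsConnected), D (g.gen hg) = g.fission i

end FissionOperad

end

/-! Everything rests on one identity: the fission operators anticommute, `θ i ∘ θ j + θ j ∘ θ i =
0`, the case `i = j` included. As `2` is invertible, every locally finite sum of them then squares
to zero.

Existence of `θ i` is formal. The polygon boundary and the splitting into components respect
isomorphisms and multilinearity (`boundaryMap`, `splitMap`), and a map on `prim O` lowering the
degree by one extends to an odd derivation (`extendDerivation`, by means of triangular matrices).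

The anticommutator of two such derivations is determined on connected graphs. Gluing a `2n`-gon
creates at most `n - 1` new components (`OGraph.ncomp_glue_le`), so on a connected graph the
projection to word length `i` keeps exactly the gluings with as many components as possible. In such
a gluing the `n` edges come from one component and the `n` new edges lie in different components.
The first fact gives the top part of the boundary a Leibniz rule on disjoint unions, so `θ i` is
half of that top part on all graphs (`LGraph.apply_split`). Moreover, a polygon glued after a
contraction may be glued before it, provided it avoids the contracted edge. Hence a product of two
fission operators is a quarter of a sum over pairs of polygons `d`, `f`, both creating as many
components as possible, in which one new edge of each is contracted (`LGraph.apply_apply_gen`).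

In this sum, contracting two edges in the opposite order changes the sign (`LGraph.contr2_swap`). If
`f` uses no edge made by `d`, the two gluings commute, and the term cancels against the one with the
polygons exchanged. Otherwise `f` uses exactly one edge made by `d`, because those edges lie in
different components while the edges of `f` lie in a single one. The two polygons then merge into
one, on `i + j - 1` edges, and reflecting it exchanges the two contracted edges; so these terms
cancel among themselves (`Polygon.sum_adjoined_eq_zero`).

Signs are kept under control by `LGraph.edgeTerm`. A gluing conjugates the edge involution by a
permutation of the half-edges, and weighting a term by the sign of this permutation and by the
number of reversed edges makes it depend only on the new involution and the two contracted edges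
(`LGraph.edgeTerm_congr`). The cancellation thereby becomes a statement about tuples and
involutions, `Polygon.sum_pairTerm_add`.

Finally, `θ i` sends connected graphs to word length `i`. So a sum of fission operators remembers
which nonzero ones occur in it, and uncountability is Cantor's theorem. -/

noncomputable section
namespace FissionOperad

/-! ## Comparing labels -/

namespace CyclicOperad

variable {k : Type v} [Field k] (O : CyclicOperad.{u} k)

/-- Two operations whose leaves are marked by elements of `W` agree up to a relabelling that
respects the marks. -/
def Same {X Y W : Type} [Finite X] [Finite Y] (f : X → W) (g : Y → W) (a : O.obj X)
    (b : O.obj Y) : Prop :=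
  ∃ σ : X ≃ Y, (∀ x, g (σ x) = f x) ∧ O.map σ a = b

variable {O}

namespace Same

variable {X Y Z W W' : Type} [Finite X] [Finite Y] [Finite Z] {f : X → W} {g : Y → W} {h : Z → W}
  {a a' : O.obj X} {b b' : O.obj Y} {c : O.obj Z}

theorem refl (f : X → W) (a : O.obj X) : O.Same f f a a :=
  ⟨Equiv.refl X, fun _ => rfl, O.map_refl a⟩

theorem map (σ : X ≃ Y) (hσ : ∀ x, g (σ x) = f x) (a : O.obj X) : O.Same f g a (O.map σ a) :=
  ⟨σ, hσ, rfl⟩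

theorem symm (H : O.Same f g a b) : O.Same g f b a := by
  obtain ⟨σ, hσ, rfl⟩ := H
  refine ⟨σ.symm, fun y => ?_, ?_⟩
  · rw [← hσ, σ.apply_symm_apply]
  · rw [← O.map_trans, σ.self_trans_symm, O.map_refl]

theorem trans (H : O.Same f g a b) (H' : O.Same g h b c) : O.Same f h a c := by
  obtain ⟨σ, hσ, rfl⟩ := H
  obtain ⟨τ, hτ, rfl⟩ := H'
  exact ⟨σ.trans τ, fun x => by rw [Equiv.trans_apply, hτ, hσ], O.map_trans σ τ a⟩

/-- Injective marks leave no freedom in the relabelling. Marking leaves by half-edges of a fixed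
graph therefore allows labels in different types to be compared without transport. -/
theorem eq_map (H : O.Same f g a b) (hg : g.Injective) (σ : X ≃ Y) (hσ : ∀ x, g (σ x) = f x) :
    b = O.map σ a := by
  obtain ⟨τ, hτ, rfl⟩ := H
  congr 1
  exact congrArg _ (Equiv.ext fun x => hg (by rw [hτ, hσ]))

theorem postcomp (H : O.Same f g a b) (j : W → W') :
    O.Same (fun x => j (f x)) (fun y => j (g y)) a b := by
  obtain ⟨σ, hσ, e⟩ := H
  exact ⟨σ, fun x => congrArg j (hσ x), e⟩

theorem of_postcomp {j : W → W'} (hj : j.Injective)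
    (H : O.Same (fun x => j (f x)) (fun y => j (g y)) a b) : O.Same f g a b := by
  obtain ⟨σ, hσ, e⟩ := H
  exact ⟨σ, fun x => hj (hσ x), e⟩

theorem congr_fun {f' : X → W} {g' : Y → W} (H : O.Same f g a b) (hf : ∀ x, f x = f' x)
    (hg : ∀ x, g x = g' x) : O.Same f' g' a b := by
  obtain rfl : f = f' := funext hf
  obtain rfl : g = g' := funext hg
  exact H

end Same

/-- The marks of the leaves of a composite. -/
def marks {X Y W : Type} (x : X) (y : Y) (f : X → W) (g : Y → W) :
    {a : X // a ≠ x} ⊕ {b : Y // b ≠ y} → W :=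
  Sum.elim (fun a => f a.1) (fun b => g b.1)

namespace Same

variable {X Y Z X' Y' W : Type} [Finite X] [Finite Y] [Finite Z] [Finite X'] [Finite Y']

theorem comp {f : X → W} {g : Y → W} {f' : X' → W} {g' : Y' → W} {a : O.obj X} {b : O.obj Y}
    {a' : O.obj X'} {b' : O.obj Y'} (Ha : O.Same f f' a a') (Hb : O.Same g g' b b')
    (hf : f'.Injective) (hg : g'.Injective) {x : X} {y : Y} {x' : X'} {y' : Y'}
    (hx : f' x' = f x) (hy : g' y' = g y) :
    O.Same (marks x y f g) (marks x' y' f' g') (O.comp x y a b) (O.comp x' y' a' b') := by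
  obtain ⟨σ, hσ, rfl⟩ := Ha
  obtain ⟨τ, hτ, rfl⟩ := Hb
  obtain rfl : x' = σ x := hf (by rw [hx, hσ])
  obtain rfl : y' = τ y := hg (by rw [hy, hτ])
  rw [O.comp_map]
  refine Same.map _ ?_ _
  rintro (z | z)
  · exact hσ _
  · exact hτ _

theorem comp_comm (f : X → W) (g : Y → W) (x : X) (y : Y) (a : O.obj X) (b : O.obj Y) :
    O.Same (marks x y f g) (marks y x g f) (O.comp x y a b) (O.comp y x b a) := by
  rw [O.comp_comm x y]
  refine Same.map _ ?_ _
  rintro (z | z) <;> rfl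

theorem comp_assoc (f : X → W) (g : Y → W) (h : Z → W) (x : X) (y y' : Y) (z : Z) (hy : y' ≠ y)
    (a : O.obj X) (b : O.obj Y) (c : O.obj Z) :
    O.Same (marks (Sum.inr ⟨y', hy⟩) z (marks x y f g) h)
      (marks x (Sum.inl ⟨y, hy.symm⟩) f (marks y' z g h))
      (O.comp (Sum.inr ⟨y', hy⟩) z (O.comp x y a b) c)
      (O.comp x (Sum.inl ⟨y, hy.symm⟩) a (O.comp y' z b c)) := by
  rw [O.comp_assoc x y y' z hy]
  refine Same.map _ ?_ _
  rintro (⟨w | w, hw⟩ | w) <;> rfl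

end Same

end CyclicOperad

/-! ## Connected components -/

namespace OGraph

theorem eq_of_compOf_eq (Γ : OGraph) {X : Type*} (c : Γ.V → X)
    (hc : ∀ h, c (Γ.root (Γ.inv h)) = c (Γ.root h)) {x y : Γ.V} (e : Γ.compOf x = Γ.compOf y) :
    c x = c y := by
  have := SimpleGraph.ConnectedComponent.exact e
  obtain ⟨w⟩ := this
  induction w with
  | nil => rfl
  | cons hadj _ ih =>
    obtain ⟨_, h, rfl, rfl⟩ := hadj
    rw [← hc h]
    exact ih (SimpleGraph.ConnectedComponent.sound ⟨by assumption⟩)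

/-- A function on vertices that is constant along the edges descends to the components. -/
def compLift (Γ : OGraph) {X : Type*} (c : Γ.V → X)
    (hc : ∀ h, c (Γ.root (Γ.inv h)) = c (Γ.root h)) : Γ.Comp → X :=
  Quot.lift c fun _ _ e => Γ.eq_of_compOf_eq c hc (SimpleGraph.ConnectedComponent.sound e)

theorem comp_ind (Γ : OGraph) {P : Γ.Comp → Prop} (h : ∀ x, P (Γ.compOf x)) (C : Γ.Comp) : P C :=
  SimpleGraph.ConnectedComponent.ind h C

theorem isConnected_iff (Γ : OGraph) :
    Γ.IsConnected ↔ Nonempty Γ.V ∧ ∀ x y, Γ.compOf x = Γ.compOf y := by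
  unfold IsConnected
  rw [SimpleGraph.connected_iff]
  constructor
  · rintro ⟨h1, h2⟩
    exact ⟨h2, fun x y => SimpleGraph.ConnectedComponent.sound (h1 x y)⟩
  · rintro ⟨h1, h2⟩
    exact ⟨fun x y => SimpleGraph.ConnectedComponent.exact (h2 x y), h1⟩

/-- The number of connected components. -/
def ncomp (Γ : OGraph) : ℕ := Nat.card Γ.Comp

instance (Γ : OGraph) : Finite Γ.Comp :=
  Finite.of_surjective Γ.compOf fun C => Γ.comp_ind (P := fun C => ∃ x, Γ.compOf x = C)
    (fun x => ⟨x, rfl⟩) C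

end OGraph

/-! ## Embeddings of labelled graphs as unions of components -/

variable {k : Type v} [Field k] {O : CyclicOperad.{u} k}

namespace LGraph

/-- An isomorphism of a labelled graph with a union of components of another one. -/
structure Emb (g g' : LGraph O) where
  v : g.1.V → g'.1.V
  v_inj : v.Injective
  h : g.1.H → g'.1.H
  h_inj : h.Injective
  root_h (a : g.1.H) : g'.1.root (h a) = v (g.1.root a)
  inv_h (a : g.1.H) : g'.1.inv (h a) = h (g.1.inv a)
  surj (a : g'.1.H) (x : g.1.V) (e : g'.1.root a = v x) : ∃ b, h b = a
  label (x : g.1.V) : O.Same (fun a : g.1.Flags x => h a.1) (fun a : g'.1.Flags (v x) => a.1)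
    (g.2 x) (g'.2 (v x))

namespace Emb

variable {g g' g'' : LGraph O}

/-- The number of inversions of the vertex ordering. -/
def inversions (φ : Emb g g') : ℕ :=
  Nat.card {p : g.1.V × g.1.V // p.1 < p.2 ∧ φ.v p.2 < φ.v p.1}

/-- The number of edges whose direction is not preserved. -/
def reversals (φ : Emb g g') : ℕ :=
  Nat.card {a : g.1.H // g.1.tail a = true ∧ g'.1.tail (φ.h a) = false}

def parity (φ : Emb g g') : ℕ := φ.inversions + φ.reversals

theorem exists_vertex (φ : Emb g g') (a : g'.1.H) (x : g.1.V) (e : g'.1.root a = φ.v x) :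
    ∃ b, φ.h b = a ∧ g.1.root b = x := by
  obtain ⟨b, rfl⟩ := φ.surj a x e
  exact ⟨b, rfl, φ.v_inj (by rw [← φ.root_h, e])⟩

/-- The map on components. -/
def comp (φ : Emb g g') : g.1.Comp → g'.1.Comp :=
  g.1.compLift (fun x => g'.1.compOf (φ.v x)) fun h => by
    rw [← φ.root_h, ← φ.root_h, ← φ.inv_h]
    exact g'.1.compOf_inv _

/-- The component of a preimage, if there is one. -/
def compBack (φ : Emb g g') (y : g'.1.V) : Option g.1.Comp :=
  if e : ∃ x, φ.v x = y then some (g.1.compOf e.choose) else none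

theorem compBack_v (φ : Emb g g') (x : g.1.V) : φ.compBack (φ.v x) = some (g.1.compOf x) := by
  have e : ∃ x', φ.v x' = φ.v x := ⟨x, rfl⟩
  rw [compBack, dif_pos e, φ.v_inj e.choose_spec]

/-- An edge with one end in the image has both ends there, by `surj`. So `compBack` is constant
along edges and inverts the map on components, which shows that the image is a union of components.
-/
theorem compBack_inv (φ : Emb g g') (h : g'.1.H) :
    φ.compBack (g'.1.root (g'.1.inv h)) = φ.compBack (g'.1.root h) := by
  have key : ∀ a : g'.1.H, (∃ x, φ.v x = g'.1.root a) →
      φ.compBack (g'.1.root (g'.1.inv a)) = φ.compBack (g'.1.root a) := by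
    rintro a ⟨x, hx⟩
    obtain ⟨b, rfl, rfl⟩ := φ.exists_vertex a x hx.symm
    rw [φ.inv_h, φ.root_h, φ.root_h, compBack_v, compBack_v, g.1.compOf_inv]
  by_cases e : ∃ x, φ.v x = g'.1.root h
  · exact key h e
  by_cases e' : ∃ x, φ.v x = g'.1.root (g'.1.inv h)
  · have := key _ e'
    rw [g'.1.inv_inv] at this
    exact this.symm
  · rw [compBack, compBack, dif_neg e, dif_neg e']

theorem compOf_eq_iff (φ : Emb g g') (x y : g.1.V) :
    g'.1.compOf (φ.v x) = g'.1.compOf (φ.v y) ↔ g.1.compOf x = g.1.compOf y := by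
  constructor
  · intro e
    have := g'.1.eq_of_compOf_eq φ.compBack φ.compBack_inv e
    rwa [compBack_v, compBack_v, Option.some_inj] at this
  · intro e
    exact congrArg φ.comp e

theorem comp_injective (φ : Emb g g') : φ.comp.Injective := by
  intro C D
  induction C using g.1.comp_ind with | _ x
  induction D using g.1.comp_ind with | _ y
  exact (φ.compOf_eq_iff x y).1

theorem exists_of_compOf_eq (φ : Emb g g') {x : g.1.V} {y : g'.1.V}
    (e : g'.1.compOf y = g'.1.compOf (φ.v x)) : ∃ x', φ.v x' = y := by
  have := g'.1.eq_of_compOf_eq φ.compBack φ.compBack_inv e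
  rw [compBack_v, compBack] at this
  split_ifs at this with h
  exact h

theorem h_surjective (φ : Emb g g') (hv : φ.v.Surjective) : φ.h.Surjective := fun a => by
  obtain ⟨x, hx⟩ := hv (g'.1.root a)
  exact φ.surj a x hx.symm

/-- A surjective embedding is an isomorphism. -/
def toIso (φ : Emb g g') (hv : φ.v.Surjective) : OGraph.Iso g.1 g'.1 where
  v := Equiv.ofBijective φ.v ⟨φ.v_inj, hv⟩
  h := Equiv.ofBijective φ.h ⟨φ.h_inj, φ.h_surjective hv⟩
  root_h := φ.root_h
  inv_h := φ.inv_h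

/-- This is the relation `Rel.iso`; the marks by half-edges are injective, so `label` is the
equality of labels demanded there. -/
theorem cls_eq (φ : Emb g g') (hv : φ.v.Surjective) : g.cls = (-1 : k) ^ φ.parity • g'.cls := by
  have hr : Rel O (LGraph.free ⟨g.1, g.2⟩ -
      (-1 : k) ^ (φ.toIso hv).parity • LGraph.free ⟨g'.1, g'.2⟩) :=
    Rel.iso (φ.toIso hv) g.2 g'.2 fun x =>
      (φ.label x).eq_map Subtype.val_injective _ fun a => rfl
  have := (Submodule.Quotient.mk_eq_zero _).2 (Submodule.subset_span (R := k) hr)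
  rw [Submodule.Quotient.mk_sub, Submodule.Quotient.mk_smul, sub_eq_zero] at this
  exact this

/-- An isomorphism of graphs compatible with the labels as an embedding. -/
def ofIso {Γ Δ : OGraph} (φ : OGraph.Iso Γ Δ) (o : (x : Γ.V) → O.obj (Γ.Flags x))
    (o' : (x : Δ.V) → O.obj (Δ.Flags x)) (h : ∀ x, o' (φ.v x) = O.map (φ.flags x) (o x)) :
    Emb (⟨Γ, o⟩ : LGraph O) ⟨Δ, o'⟩ where
  v := φ.v
  v_inj := φ.v.injective
  h := φ.h
  h_inj := φ.h.injective
  root_h := φ.root_h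
  inv_h := φ.inv_h
  surj a _ _ := φ.h.surjective a
  label x := ⟨φ.flags x, fun _ => rfl, (h x).symm⟩

/-- Embeddings that preserve the orientation. -/
structure Strict (φ : Emb g g') : Prop where
  mono (x y : g.1.V) : x < y → φ.v x < φ.v y
  tail (a : g.1.H) : g'.1.tail (φ.h a) = g.1.tail a

theorem Strict.lt_iff {φ : Emb g g'} (hφ : φ.Strict) (x y : g.1.V) :
    φ.v x < φ.v y ↔ x < y := by
  refine ⟨fun h => ?_, hφ.mono x y⟩
  rcases lt_trichotomy x y with h' | rfl | h'
  · exact h'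
  · exact absurd h (lt_irrefl _)
  · exact absurd (hφ.mono _ _ h') h.asymm

theorem Strict.inversions_eq {φ : Emb g g'} (hφ : φ.Strict) : φ.inversions = 0 := by
  have : IsEmpty {p : g.1.V × g.1.V // p.1 < p.2 ∧ φ.v p.2 < φ.v p.1} :=
    ⟨fun p => (hφ.mono _ _ p.2.1).asymm p.2.2⟩
  exact Nat.card_of_isEmpty

theorem Strict.reversals_eq {φ : Emb g g'} (hφ : φ.Strict) : φ.reversals = 0 := by
  have : IsEmpty {a : g.1.H // g.1.tail a = true ∧ g'.1.tail (φ.h a) = false} :=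
    ⟨fun a => by have := a.2.2; rw [hφ.tail, a.2.1] at this; exact absurd this (by simp)⟩
  exact Nat.card_of_isEmpty

theorem Strict.parity_eq {φ : Emb g g'} (hφ : φ.Strict) : φ.parity = 0 := by
  rw [parity, hφ.inversions_eq, hφ.reversals_eq]

theorem Strict.cls_eq {φ : Emb g g'} (hφ : φ.Strict) (hv : φ.v.Surjective) : g.cls = g'.cls := by
  rw [φ.cls_eq hv, hφ.parity_eq, pow_zero, one_smul]

/-- The inclusion of a component. -/
def ofComponent (g : LGraph O) (C : g.1.Comp) : Emb (g.component C) g where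
  v x := x.1
  v_inj := Subtype.val_injective
  h a := a.1
  h_inj := Subtype.val_injective
  root_h _ := rfl
  inv_h _ := rfl
  surj a x e := ⟨⟨a, by rw [e]; exact x.2⟩, rfl⟩
  label x := (CyclicOperad.Same.map (g.1.componentFlags C x) (fun _ => rfl) (g.2 x.1)).symm

theorem ofComponent_strict (g : LGraph O) (C : g.1.Comp) : (ofComponent g C).Strict :=
  ⟨fun _ _ h => h, fun _ => rfl⟩

end Emb

end LGraph

/-! ## Signed products over lists -/

section SignedProduct

theorem neg_one_pow_congr {R : Type*} [Ring R] {a b : ℕ} (h : a % 2 = b % 2) :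
    (-1 : R) ^ a = (-1 : R) ^ b := by
  rw [neg_one_pow_eq_pow_mod_two, h, ← neg_one_pow_eq_pow_mod_two]

variable {k : Type*} [Field k] {ι ι' A : Type*} [Ring A] [Algebra k A]

/-- The sum of `N a b` over all pairs in a list with `a` before `b`. -/
def pairSum (N : ι → ι → ℕ) : List ι → ℕ
  | [] => 0
  | C :: L => (L.map (N C)).sum + pairSum N L

/-- The product of the `a C` over a list, with the sign prescribed by `N`. -/
def signedProd (k : Type*) [Field k] {A : Type*} [Ring A] [Algebra k A] (N : ι → ι → ℕ) (a : ι → A)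
    (L : List ι) : A := (-1 : k) ^ pairSum N L • (L.map a).prod

theorem signedProd_cons (N : ι → ι → ℕ) (a : ι → A) (C : ι) (L : List ι) :
    signedProd k N a (C :: L) = (-1 : k) ^ (L.map (N C)).sum • (a C * signedProd k N a L) := by
  simp only [signedProd, pairSum, pow_add, List.map_cons, List.prod_cons, mul_smul_comm, mul_smul]

/-- Exchanging the neighbours `D`, `C` replaces `N D C` by `N C D` in the exponent, while commuting
the factors contributes the sum of both, so the total change is even. -/
theorem signedProd_perm (N : ι → ι → ℕ) (a : ι → A)
    (hc : ∀ C D, C ≠ D → a C * a D = (-1 : k) ^ (N C D + N D C) • (a D * a C))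
    {L L' : List ι} (h : L.Perm L') (hL : L.Nodup) :
    signedProd k N a L = signedProd k N a L' := by
  induction h with
  | nil => rfl
  | cons C hp ih =>
    rw [signedProd_cons, signedProd_cons, ih (List.nodup_cons.1 hL).2, (hp.map _).sum_eq]
  | swap C D L =>
    simp only [signedProd_cons, List.map_cons, List.sum_cons, mul_smul_comm, smul_smul, ← mul_assoc,
      ← pow_add]
    have hne : D ≠ C := fun e => (List.nodup_cons.1 hL).1 (by simp [e])
    rw [hc D C hne, smul_mul_assoc, smul_smul, ← pow_add]
    congr 1
    exact neg_one_pow_congr (by omega)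
  | trans h1 _ ih1 ih2 => rw [ih1 hL, ih2 (h1.nodup_iff.1 hL)]

theorem pairSum_append (N : ι → ι → ℕ) (L L' : List ι) :
    pairSum N (L ++ L') =
      pairSum N L + pairSum N L' + (L.map fun C => (L'.map (N C)).sum).sum := by
  induction L with
  | nil => simp [pairSum]
  | cons C L ih => simp only [List.cons_append, pairSum, ih, List.map_append, List.sum_append,
      List.map_cons, List.sum_cons]; omega

theorem signedProd_append (N : ι → ι → ℕ) (a : ι → A) (L L' : List ι) :
    signedProd k N a (L ++ L') = (-1 : k) ^ (L.map fun C => (L'.map (N C)).sum).sum •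
      (signedProd k N a L * signedProd k N a L') := by
  simp only [signedProd, pairSum_append, List.map_append, List.prod_append, smul_mul_smul_comm,
    smul_smul, pow_add]
  congr 1
  ring

theorem pairSum_map (N : ι' → ι' → ℕ) (f : ι → ι') (L : List ι) :
    pairSum N (L.map f) = pairSum (fun a b => N (f a) (f b)) L := by
  induction L with
  | nil => rfl
  | cons C L ih => simp only [List.map_cons, pairSum, ih, List.map_map]; rfl

theorem pairSum_mod_two (N N' : ι → ι → ℕ) (L : List ι)
    (h : L.Pairwise fun a b => N a b % 2 = N' a b % 2) : pairSum N L % 2 = pairSum N' L % 2 := by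
  induction L with
  | nil => rfl
  | cons C L ih =>
    rw [List.pairwise_cons] at h
    have h1 := ih h.2
    have h2 : (L.map (N C)).sum % 2 = (L.map (N' C)).sum % 2 := by
      have h3 := h.1
      clear ih h h1
      induction L with
      | nil => rfl
      | cons D L ih =>
        have := ih fun x hx => h3 x (by simp [hx])
        have := h3 D (by simp)
        simp only [List.map_cons, List.sum_cons]
        omega
    simp only [pairSum]
    omega

theorem pairSum_add (N N' : ι → ι → ℕ) (L : List ι) :
    pairSum (fun a b => N a b + N' a b) L = pairSum N L + pairSum N' L := by
  induction L with
  | nil => rfl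
  | cons C L ih => simp only [pairSum, ih, List.sum_map_add]; omega

theorem sum_sum_eq_pairSum (F : ι → ι → ℕ) (L : List ι) :
    (L.map fun a => (L.map (F a)).sum).sum =
      (L.map fun a => F a a).sum + pairSum (fun a b => F a b + F b a) L := by
  induction L with
  | nil => rfl
  | cons C L ih =>
    simp only [List.map_cons, List.sum_cons, pairSum, List.sum_map_add, ih]
    omega

theorem natCard_subtype_eq_sum {X : Type*} [Fintype X] (p : X → Prop) :
    Nat.card {x // p x} = ∑ x, if p x then 1 else 0 := by
  rw [Nat.card_eq_fintype_card, Fintype.card_subtype, Finset.card_filter]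

theorem sum_eq_list_sum_fiber {X : Type*} [Fintype X] (c : X → ι) (L : List ι) (hL : L.Nodup)
    (hc : ∀ x, c x ∈ L) (f : X → ℕ) :
    ∑ x, f x = (L.map fun C => ∑ x, if c x = C then f x else 0).sum := by
  rw [← List.sum_toFinset _ hL, Finset.sum_comm]
  refine Finset.sum_congr rfl fun x _ => ?_
  rw [Finset.sum_ite_eq, if_pos (List.mem_toFinset.2 (hc x))]

end SignedProduct

/-! ## The splitting of a graph into its components -/

namespace LGraph

theorem gen_congr {g g' : LGraph O} (hg : g.1.IsConnected) (hg' : g'.1.IsConnected) (c : k)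
    (h : g.cls = c • g'.cls) : g.gen hg = c • g'.gen hg' := by
  unfold gen
  rw [← map_smul]
  congr 1
  exact Subtype.ext h

theorem gen_mem_primDeg {g : LGraph O} (hg : g.1.IsConnected) :
    (⟨g.cls, Submodule.subset_span ⟨g, hg, rfl⟩⟩ : prim O) ∈ primDeg O g.nverts :=
  Submodule.subset_span ⟨g, hg, rfl, rfl⟩

theorem gen_comm {g g' : LGraph O} (hg : g.1.IsConnected) (hg' : g'.1.IsConnected) :
    g.gen hg * g'.gen hg' = (-1 : k) ^ (g.nverts * g'.nverts) • (g'.gen hg' * g.gen hg) :=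
  incl_comm O (gen_mem_primDeg hg) (gen_mem_primDeg hg')

/-- The number of pairs of vertices `x < y` with `y` in `C` and `x` in `D`. -/
def compInv (g : LGraph O) (C D : g.1.Comp) : ℕ :=
  Nat.card {p : g.1.V × g.1.V // g.1.compOf p.1 = C ∧ g.1.compOf p.2 = D ∧ p.2 < p.1}

/-- A component as an element of the symmetric algebra. -/
def compGen (g : LGraph O) (C : g.1.Comp) : SymPrim O :=
  (g.component C).gen (g.1.component_isConnected C)

/-- The signed product of some components. -/
def splitList (g : LGraph O) (L : List g.1.Comp) : SymPrim O :=
  signedProd k g.compInv g.compGen L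

/-- Each pair of a vertex of `C` and a vertex of `D` is counted by exactly one of the two terms.
This matches the sign of graded commutativity with the hypothesis of `signedProd_perm`. -/
theorem compInv_add_compInv (g : LGraph O) {C D : g.1.Comp} (h : C ≠ D) :
    g.compInv C D + g.compInv D C = (g.component C).nverts * (g.component D).nverts := by
  have e1 : (g.component C).nverts * (g.component D).nverts =
      Nat.card {p : g.1.V × g.1.V // g.1.compOf p.1 = C ∧ g.1.compOf p.2 = D} := by
    unfold nverts
    rw [← Nat.card_prod]
    refine Nat.card_congr ⟨fun p => ⟨(p.1.1, p.2.1), p.1.2, p.2.2⟩,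
      fun p => (⟨p.1.1, p.2.1⟩, ⟨p.1.2, p.2.2⟩), fun _ => rfl, fun _ => rfl⟩
  have e2 : g.compInv D C =
      Nat.card {p : g.1.V × g.1.V // g.1.compOf p.1 = C ∧ g.1.compOf p.2 = D ∧ p.1 < p.2} := by
    refine Nat.card_congr ⟨fun p => ⟨(p.1.2, p.1.1), p.2.2.1, p.2.1, p.2.2.2⟩,
      fun p => ⟨(p.1.2, p.1.1), p.2.2.1, p.2.1, p.2.2.2⟩, fun _ => rfl, fun _ => rfl⟩
  rw [e1, e2, compInv]
  simp only [natCard_subtype_eq_sum]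
  rw [← Finset.sum_add_distrib]
  refine Finset.sum_congr rfl fun p _ => ?_
  by_cases h1 : g.1.compOf p.1 = C <;> by_cases h2 : g.1.compOf p.2 = D <;> simp only [h1, h2,
    true_and, false_and, if_false, if_true, add_zero]
  have hne : p.1 ≠ p.2 := by
    rintro e
    rw [e] at h1
    exact h (h1.symm.trans h2)
  rcases lt_or_gt_of_ne hne with h3 | h3
  · simp [h3, h3.asymm]
  · simp [h3, h3.asymm]

theorem splitList_perm (g : LGraph O) {L L' : List g.1.Comp} (h : L.Perm L') (hL : L.Nodup) :
    g.splitList L = g.splitList L' :=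
  signedProd_perm _ _ (fun C D hCD => by
    rw [compInv_add_compInv g hCD]
    exact gen_comm _ _) h hL

theorem splitList_nil (g : LGraph O) : g.splitList [] = 1 := by
  simp [splitList, signedProd, pairSum]

theorem splitList_cons (g : LGraph O) (C : g.1.Comp) (L : List g.1.Comp) :
    g.splitList (C :: L) =
      (-1 : k) ^ (L.map (g.compInv C)).sum • (g.compGen C * g.splitList L) :=
  signedProd_cons _ _ _ _

/-- The components in some order. -/
def comps (g : LGraph O) : List g.1.Comp := List.ofFn (Finite.equivFin g.1.Comp).symm

theorem comps_nodup (g : LGraph O) : g.comps.Nodup := by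
  rw [comps, List.nodup_ofFn]
  exact (Finite.equivFin g.1.Comp).symm.injective

theorem mem_comps (g : LGraph O) (C : g.1.Comp) : C ∈ g.comps := by
  rw [comps, List.mem_ofFn]
  exact ⟨Finite.equivFin g.1.Comp C, by simp⟩

/-- Sorting the out-of-order pairs of vertices by their components identifies the sign in the
definition of `split` with that of a signed product. -/
theorem pairSum_comps (g : LGraph O) : pairSum g.compInv g.comps =
    Nat.card {p : g.1.V × g.1.V // p.1 < p.2 ∧
      Finite.equivFin g.1.Comp (g.1.compOf p.2) < Finite.equivFin g.1.Comp (g.1.compOf p.1)} := by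
  have hp : g.comps.Pairwise fun C D =>
      Finite.equivFin g.1.Comp C < Finite.equivFin g.1.Comp D := by
    rw [comps, List.pairwise_ofFn]
    intro i j hij
    simpa using hij
  -- Of the two conditional terms only the first is nonzero along the increasing list. Symmetrized
  -- in this way, the sum over pairs becomes a double sum over all components.
  have h1 : pairSum g.compInv g.comps = pairSum (fun C D =>
      (if Finite.equivFin g.1.Comp C < Finite.equivFin g.1.Comp D then g.compInv C D else 0) +
      (if Finite.equivFin g.1.Comp D < Finite.equivFin g.1.Comp C then g.compInv D C else 0))
      g.comps := by
    generalize g.comps = L at hp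
    induction L with
    | nil => rfl
    | cons C L ih =>
      rw [List.pairwise_cons] at hp
      simp only [pairSum]
      rw [ih hp.2]
      congr 2
      refine List.map_congr_left fun D hD => ?_
      have := hp.1 D hD
      simp [this, this.le]
  have h2 := sum_sum_eq_pairSum (fun C D =>
      (if Finite.equivFin g.1.Comp C < Finite.equivFin g.1.Comp D then g.compInv C D else 0))
      g.comps
  simp only [lt_irrefl, if_false, List.map_const', List.sum_replicate, smul_zero, zero_add] at h2
  symm
  rw [h1, ← h2, natCard_subtype_eq_sum, Fintype.sum_prod_type,
    Finset.sum_comm, sum_eq_list_sum_fiber g.1.compOf g.comps g.comps_nodup (fun x => g.mem_comps _)]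
  congr 1
  refine List.map_congr_left fun C _ => ?_
  rw [Finset.sum_congr rfl (g := fun y => (g.comps.map fun D => ∑ x,
    if g.1.compOf y = C then (if g.1.compOf x = D then (if x < y ∧ Finite.equivFin g.1.Comp
      (g.1.compOf y) < Finite.equivFin g.1.Comp (g.1.compOf x) then 1 else 0) else 0) else 0).sum)]
  · rw [← List.sum_toFinset _ g.comps_nodup]
    simp_rw [← List.sum_toFinset _ g.comps_nodup]
    rw [Finset.sum_comm]
    refine Finset.sum_congr rfl fun D _ => ?_
    unfold compInv
    rw [natCard_subtype_eq_sum, Fintype.sum_prod_type]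
    split_ifs with h
    · refine Finset.sum_congr rfl fun y _ => Finset.sum_congr rfl fun x _ => ?_
      by_cases h1 : g.1.compOf y = C <;> by_cases h2 : g.1.compOf x = D <;> simp [h1, h2, h]
    · refine Finset.sum_eq_zero fun y _ => Finset.sum_eq_zero fun x _ => ?_
      by_cases h1 : g.1.compOf y = C <;> by_cases h2 : g.1.compOf x = D <;> simp [h1, h2] 
      intro _
      exact not_lt.1 h
  · intro y _
    by_cases h1 : g.1.compOf y = C
    · simp only [h1, if_true]
      rw [sum_eq_list_sum_fiber g.1.compOf g.comps g.comps_nodup (fun x => g.mem_comps _)]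
    · simp [h1]

theorem split_eq_splitList_comps (g : LGraph O) : g.split = g.splitList g.comps := by
  have hmap : g.comps.map g.compGen = List.ofFn fun j =>
      (g.component ((Finite.equivFin g.1.Comp).symm j)).gen
        (g.1.component_isConnected ((Finite.equivFin g.1.Comp).symm j)) := by
    rw [comps, List.map_ofFn]
    rfl
  rw [splitList, signedProd, hmap, pairSum_comps]
  rfl

/-- This frees `split` from the chosen enumeration, so that the order can be adapted to each
situation. -/
theorem split_eq_splitList (g : LGraph O) {L : List g.1.Comp} (hL : L.Nodup) (h : ∀ C, C ∈ L) :
    g.split = g.splitList L := by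
  rw [split_eq_splitList_comps]
  exact splitList_perm _ ((List.perm_ext_iff_of_nodup g.comps_nodup hL).2
    fun C => ⟨fun _ => h C, fun _ => g.mem_comps C⟩) g.comps_nodup

end LGraph
-- Splitting under isomorphisms and disjoint unions
theorem list_prod_map_smul {ι A : Type*} [Ring A] [Algebra k A] (e : ι → ℕ) (a : ι → A)
    (L : List ι) : (L.map fun C => (-1 : k) ^ e C • a C).prod =
      (-1 : k) ^ (L.map e).sum • (L.map a).prod := by
  induction L with
  | nil => simp
  | cons C L ih =>
    simp only [List.map_cons, List.prod_cons, List.sum_cons, ih, smul_mul_smul_comm, pow_add]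

theorem natCard_eq_list_sum_fiber {ι X : Type*} [Fintype X] (c : X → ι) (L : List ι) (hL : L.Nodup)
    (hc : ∀ x, c x ∈ L) (p : X → Prop) :
    Nat.card {x // p x} = (L.map fun C => Nat.card {x // c x = C ∧ p x}).sum := by
  rw [natCard_subtype_eq_sum, sum_eq_list_sum_fiber c L hL hc]
  congr 1
  refine List.map_congr_left fun C _ => ?_
  rw [natCard_subtype_eq_sum]
  refine Finset.sum_congr rfl fun x _ => ?_
  by_cases h1 : c x = C <;> by_cases h2 : p x <;> simp [h1, h2]

namespace LGraph

namespace Emb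

variable {g g' g₁ g₂ : LGraph O}

theorem compInv_comp (φ : Emb g₁ g') (ψ : Emb g₂ g') (C : g₁.1.Comp) (D : g₂.1.Comp) :
    g'.compInv (φ.comp C) (ψ.comp D) = Nat.card {p : g₁.1.V × g₂.1.V //
      g₁.1.compOf p.1 = C ∧ g₂.1.compOf p.2 = D ∧ ψ.v p.2 < φ.v p.1} := by
  symm
  refine Nat.card_congr (Equiv.ofBijective (fun p => ⟨(φ.v p.1.1, ψ.v p.1.2),
    congrArg φ.comp p.2.1, congrArg ψ.comp p.2.2.1, p.2.2.2⟩) ⟨?_, ?_⟩)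
  · rintro ⟨⟨x, y⟩, h⟩ ⟨⟨x', y'⟩, h'⟩ e
    have e1 := congrArg (fun z => z.1.1) e
    have e2 := congrArg (fun z => z.1.2) e
    obtain rfl := φ.v_inj e1
    obtain rfl := ψ.v_inj e2
    rfl
  · rintro ⟨⟨x, y⟩, hx, hy, h⟩
    obtain ⟨x₀, rfl⟩ := g₁.1.comp_ind (P := fun C => ∃ x, g₁.1.compOf x = C) (fun x => ⟨x, rfl⟩) C
    obtain ⟨y₀, rfl⟩ := g₂.1.comp_ind (P := fun C => ∃ x, g₂.1.compOf x = C) (fun x => ⟨x, rfl⟩) D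
    obtain ⟨x, rfl⟩ := φ.exists_of_compOf_eq hx
    obtain ⟨y, rfl⟩ := ψ.exists_of_compOf_eq hy
    exact ⟨⟨(x, y), (φ.compOf_eq_iff _ _).1 hx, (ψ.compOf_eq_iff _ _).1 hy, h⟩, rfl⟩

/-- The restriction to a component. -/
def onComp (φ : Emb g g') (C : g.1.Comp) : Emb (g.component C) (g'.component (φ.comp C)) where
  v x := ⟨φ.v x.1, congrArg φ.comp x.2⟩
  v_inj x y e := Subtype.ext (φ.v_inj (congrArg Subtype.val e))
  h a := ⟨φ.h a.1, by rw [φ.root_h]; exact congrArg φ.comp a.2⟩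
  h_inj x y e := Subtype.ext (φ.h_inj (congrArg Subtype.val e))
  root_h a := Subtype.ext (φ.root_h a.1)
  inv_h a := Subtype.ext (φ.inv_h a.1)
  surj a x e := by
    obtain ⟨b, hb, hb'⟩ := φ.exists_vertex a.1 x.1 (congrArg Subtype.val e)
    exact ⟨⟨b, by rw [hb']; exact x.2⟩, Subtype.ext hb⟩
  label x := by
    have h1 := (((ofComponent g C).label x).postcomp φ.h).trans (φ.label x.1)
    have h2 := h1.trans ((ofComponent g' (φ.comp C)).label ⟨φ.v x.1, congrArg φ.comp x.2⟩).symm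
    exact CyclicOperad.Same.of_postcomp Subtype.val_injective h2

theorem onComp_surjective (φ : Emb g g') (C : g.1.Comp) : (φ.onComp C).v.Surjective := by
  rintro ⟨y, hy⟩
  obtain ⟨x₀, rfl⟩ := g.1.comp_ind (P := fun C => ∃ x, g.1.compOf x = C) (fun x => ⟨x, rfl⟩) C
  obtain ⟨x, rfl⟩ := φ.exists_of_compOf_eq (x := x₀) hy
  exact ⟨⟨x, (φ.compOf_eq_iff _ _).1 hy⟩, rfl⟩

theorem compGen_eq (φ : Emb g g') (C : g.1.Comp) :
    g.compGen C = (-1 : k) ^ (φ.onComp C).parity • g'.compGen (φ.comp C) :=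
  gen_congr _ _ _ ((φ.onComp C).cls_eq (φ.onComp_surjective C))

/-- The number of inversions between two components. -/
def crossInv (φ : Emb g g') (C D : g.1.Comp) : ℕ :=
  Nat.card {p : g.1.V × g.1.V //
    g.1.compOf p.1 = C ∧ g.1.compOf p.2 = D ∧ p.1 < p.2 ∧ φ.v p.2 < φ.v p.1}

theorem crossInv_self (φ : Emb g g') (C : g.1.Comp) :
    φ.crossInv C C = (φ.onComp C).inversions := by
  refine Nat.card_congr ⟨fun p => ⟨(⟨p.1.1, p.2.1⟩, ⟨p.1.2, p.2.2.1⟩), p.2.2.2⟩,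
    fun p => ⟨(p.1.1.1, p.1.2.1), p.1.1.2, p.1.2.2, p.2⟩, fun _ => rfl, fun _ => rfl⟩

/-- Whether a pair is out of order in the source and whether its image is out of order in the target
differ exactly when `φ` inverts the pair. -/
theorem crossInv_add (φ : Emb g g') {C D : g.1.Comp} (h : C ≠ D) :
    (φ.crossInv C D + φ.crossInv D C + g'.compInv (φ.comp C) (φ.comp D)) % 2 =
      g.compInv C D % 2 := by
  have e2 : φ.crossInv D C = Nat.card {p : g.1.V × g.1.V //
      g.1.compOf p.1 = C ∧ g.1.compOf p.2 = D ∧ p.2 < p.1 ∧ φ.v p.1 < φ.v p.2} := by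
    refine Nat.card_congr ⟨fun p => ⟨(p.1.2, p.1.1), p.2.2.1, p.2.1, p.2.2.2⟩,
      fun p => ⟨(p.1.2, p.1.1), p.2.2.1, p.2.1, p.2.2.2⟩, fun _ => rfl, fun _ => rfl⟩
  have key : φ.crossInv C D + φ.crossInv D C + g'.compInv (φ.comp C) (φ.comp D) =
      g.compInv C D + 2 * φ.crossInv C D := by
    rw [compInv_comp, e2, crossInv, compInv]
    simp only [natCard_subtype_eq_sum]
    rw [Finset.mul_sum, ← Finset.sum_add_distrib, ← Finset.sum_add_distrib,
      ← Finset.sum_add_distrib]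
    refine Finset.sum_congr rfl fun p _ => ?_
    by_cases h1 : g.1.compOf p.1 = C <;> by_cases h2 : g.1.compOf p.2 = D <;> simp only [h1, h2,
      true_and, false_and, if_false, mul_zero, add_zero]
    have hne : p.1 ≠ p.2 := by
      rintro e
      rw [e] at h1
      exact h (h1.symm.trans h2)
    have hne' : φ.v p.1 ≠ φ.v p.2 := fun e => hne (φ.v_inj e)
    rcases lt_or_gt_of_ne hne with h3 | h3 <;> rcases lt_or_gt_of_ne hne' with h4 | h4 <;>
      simp [h3, h3.asymm, h4, h4.asymm]
  rw [key]
  omega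

theorem parity_eq (φ : Emb g g') {L : List g.1.Comp} (hL : L.Nodup) (h : ∀ C, C ∈ L) :
    φ.parity = (L.map fun C => (φ.onComp C).parity).sum +
      pairSum (fun C D => φ.crossInv C D + φ.crossInv D C) L := by
  have h1 : φ.inversions = (L.map fun C => (L.map (φ.crossInv C)).sum).sum := by
    unfold inversions
    rw [natCard_eq_list_sum_fiber (fun p => g.1.compOf p.1) L hL fun x => h _]
    congr 1
    refine List.map_congr_left fun C _ => ?_
    rw [natCard_eq_list_sum_fiber (fun p => g.1.compOf p.2) L hL fun x => h _]
    congr 1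
    refine List.map_congr_left fun D _ => ?_
    refine Nat.card_congr (Equiv.subtypeEquivRight fun p => ?_)
    tauto
  have h2 : φ.reversals = (L.map fun C => (φ.onComp C).reversals).sum := by
    unfold reversals
    rw [natCard_eq_list_sum_fiber (fun p => g.1.compOf (g.1.root p)) L hL fun x => h _]
    congr 1
    refine List.map_congr_left fun C _ => ?_
    exact Nat.card_congr ⟨fun p => ⟨⟨p.1, p.2.1⟩, p.2.2⟩, fun p => ⟨p.1.1, p.1.2, p.2⟩,
      fun _ => rfl, fun _ => rfl⟩
  rw [parity, h1, sum_sum_eq_pairSum, h2]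
  simp only [parity, List.sum_map_add, crossInv_self]
  omega

/-- The parity of `φ` is divided up: what happens inside a component is absorbed by its generator,
and the inversions between components are absorbed by the sign of the signed product. -/
theorem splitList_comps (φ : Emb g g') {L : List g.1.Comp} (hL : L.Nodup) (h : ∀ C, C ∈ L) :
    g.splitList L = (-1 : k) ^ φ.parity • g'.splitList (L.map φ.comp) := by
  have h1 : L.map g.compGen =
      L.map fun C => (-1 : k) ^ (φ.onComp C).parity • g'.compGen (φ.comp C) :=
    List.map_congr_left fun C _ => φ.compGen_eq C
  have h2 : L.map (fun C => g'.compGen (φ.comp C)) = (L.map φ.comp).map g'.compGen := by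
    rw [List.map_map]; rfl
  rw [splitList, splitList, signedProd, signedProd, h1, list_prod_map_smul (k := k)
    (fun C => (φ.onComp C).parity) (fun C => g'.compGen (φ.comp C)), smul_smul, ← pow_add,
    smul_smul, ← pow_add, h2]
  congr 1
  refine neg_one_pow_congr ?_
  rw [φ.parity_eq hL h, pairSum_map]
  have h3 := pairSum_mod_two (fun C D => (φ.crossInv C D + φ.crossInv D C) +
    g'.compInv (φ.comp C) (φ.comp D)) g.compInv L
    (hL.imp fun hCD => φ.crossInv_add hCD)
  rw [pairSum_add] at h3
  omega

theorem split_eq (φ : Emb g g') (hv : φ.v.Surjective) :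
    g.split = (-1 : k) ^ φ.parity • g'.split := by
  rw [split_eq_splitList g g.comps_nodup g.mem_comps, φ.splitList_comps g.comps_nodup g.mem_comps,
    split_eq_splitList g' (L := g.comps.map φ.comp) (g.comps_nodup.map φ.comp_injective)]
  intro D
  rw [List.mem_map]
  induction D using g'.1.comp_ind with | _ y
  obtain ⟨x, rfl⟩ := hv y
  exact ⟨g.1.compOf x, g.mem_comps _, rfl⟩

/-- Two embeddings that exhibit a graph as a disjoint union. -/
structure IsSum (φ : Emb g₁ g') (ψ : Emb g₂ g') : Prop where
  disjoint (x : g₁.1.V) (y : g₂.1.V) : φ.v x ≠ ψ.v y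
  cover (z : g'.1.V) : (∃ x, φ.v x = z) ∨ ∃ y, ψ.v y = z

/-- The number of pairs of vertices in the wrong order. -/
def crossing (φ : Emb g₁ g') (ψ : Emb g₂ g') : ℕ :=
  Nat.card {p : g₁.1.V × g₂.1.V // ψ.v p.2 < φ.v p.1}

namespace IsSum

variable {φ : Emb g₁ g'} {ψ : Emb g₂ g'}

theorem comp_ne (H : IsSum φ ψ) (C : g₁.1.Comp) (D : g₂.1.Comp) : φ.comp C ≠ ψ.comp D := by
  induction C using g₁.1.comp_ind with | _ x
  induction D using g₂.1.comp_ind with | _ y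
  intro e
  obtain ⟨x', hx'⟩ := φ.exists_of_compOf_eq (x := x) (y := ψ.v y) e.symm
  exact H.disjoint _ _ hx'

theorem nodup (H : IsSum φ ψ) : (g₁.comps.map φ.comp ++ g₂.comps.map ψ.comp).Nodup := by
  refine List.Nodup.append (g₁.comps_nodup.map φ.comp_injective)
    (g₂.comps_nodup.map ψ.comp_injective) ?_
  intro C hC hD
  obtain ⟨C, _, rfl⟩ := List.mem_map.1 hC
  obtain ⟨D, _, e⟩ := List.mem_map.1 hD
  exact H.comp_ne C D e.symm

theorem mem (H : IsSum φ ψ) (C : g'.1.Comp) :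
    C ∈ g₁.comps.map φ.comp ++ g₂.comps.map ψ.comp := by
  induction C using g'.1.comp_ind with | _ z
  rw [List.mem_append, List.mem_map, List.mem_map]
  rcases H.cover z with ⟨x, rfl⟩ | ⟨y, rfl⟩
  · exact Or.inl ⟨g₁.1.compOf x, g₁.mem_comps _, rfl⟩
  · exact Or.inr ⟨g₂.1.compOf y, g₂.mem_comps _, rfl⟩

/-- With the components of `g₁` listed before those of `g₂`, the only new sign comes from pairs of
vertices in different summands, which `crossing` counts. -/
theorem split_eq (H : IsSum φ ψ) (hφ : φ.Strict) (hψ : ψ.Strict) :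
    g'.split = (-1 : k) ^ φ.crossing ψ • (g₁.split * g₂.split) := by
  rw [split_eq_splitList g' H.nodup H.mem, splitList, signedProd_append,
    split_eq_splitList g₁ g₁.comps_nodup g₁.mem_comps,
    split_eq_splitList g₂ g₂.comps_nodup g₂.mem_comps,
    φ.splitList_comps g₁.comps_nodup g₁.mem_comps, ψ.splitList_comps g₂.comps_nodup g₂.mem_comps,
    hφ.parity_eq, hψ.parity_eq, pow_zero, one_smul, one_smul]
  unfold splitList
  congr 2
  simp only [List.map_map]
  unfold crossing
  rw [natCard_eq_list_sum_fiber (fun p => g₁.1.compOf p.1) g₁.comps g₁.comps_nodup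
    fun _ => g₁.mem_comps _]
  congr 1
  refine List.map_congr_left fun C _ => ?_
  rw [natCard_eq_list_sum_fiber (fun p => g₂.1.compOf p.2) g₂.comps g₂.comps_nodup
    fun _ => g₂.mem_comps _]
  simp only [Function.comp_apply]
  congr 1
  refine List.map_congr_left fun D _ => ?_
  simp only [Function.comp_apply]
  rw [compInv_comp]
  refine Nat.card_congr (Equiv.subtypeEquivRight fun p => ?_)
  tauto

theorem ncomp_eq (H : IsSum φ ψ) : g'.1.ncomp = g₁.1.ncomp + g₂.1.ncomp := by
  have key (g : LGraph O) (L : List g.1.Comp) (hL : L.Nodup) (h : ∀ C, C ∈ L) :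
      g.1.ncomp = L.length := by
    have : L.toFinset = @Finset.univ _ (Fintype.ofFinite _) := by
      ext C
      simp [h]
    rw [← List.toFinset_card_of_nodup hL, this, OGraph.ncomp,
      @Nat.card_eq_fintype_card _ (Fintype.ofFinite _)]
    rfl
  rw [key g' _ H.nodup H.mem, key g₁ _ g₁.comps_nodup g₁.mem_comps,
    key g₂ _ g₂.comps_nodup g₂.mem_comps]
  simp

end IsSum

end Emb

theorem ncomp_eq_one {g : LGraph O} (hg : g.1.IsConnected) : g.1.ncomp = 1 := by
  obtain ⟨⟨x⟩, h⟩ := g.1.isConnected_iff.1 hg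
  rw [OGraph.ncomp, Nat.card_eq_one_iff_unique]
  refine ⟨⟨fun C D => ?_⟩, ⟨g.1.compOf x⟩⟩
  induction C using g.1.comp_ind with | _ x
  induction D using g.1.comp_ind with | _ y
  exact h x y

theorem split_of_isConnected {g : LGraph O} (hg : g.1.IsConnected) : g.split = g.gen hg := by
  obtain ⟨⟨x⟩, h⟩ := g.1.isConnected_iff.1 hg
  have hC : ∀ C : g.1.Comp, C = g.1.compOf x := fun C => by
    induction C using g.1.comp_ind with | _ y
    exact h y x
  rw [split_eq_splitList g (L := [g.1.compOf x]) (List.nodup_singleton _) fun C => by simp [hC C],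
    splitList_cons, splitList_nil]
  simp only [List.map_nil, List.sum_nil, pow_zero, one_smul, mul_one]
  have := gen_congr (g := g.component (g.1.compOf x)) (g' := g) (g.1.component_isConnected (g.1.compOf x)) hg 1 (by
    rw [one_smul]
    exact (Emb.ofComponent_strict g (g.1.compOf x)).cls_eq fun y => ⟨⟨y, h y x⟩, rfl⟩)
  rw [one_smul] at this
  exact this

theorem split_of_isEmpty (g : LGraph O) [IsEmpty g.1.V] : g.split = 1 := by
  rw [split_eq_splitList g (L := []) List.nodup_nil fun C => ?_, splitList_nil]
  induction C using g.1.comp_ind with | _ y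
  exact isEmptyElim y

end LGraph

/-! ## Edge directions -/

/-- The number of edges on which two choices of directions differ. -/
def tailDiff {H : Type} (t t' : H → Bool) : ℕ := Nat.card {a // t a = true ∧ t' a = false}

/-- The two sides differ by the half-edges at which `t₀` and `t₂` agree but `t₁` does not. The
involution pairs those with `t₁` true with those with `t₁` false, so their number is even. -/
theorem tailDiff_cocycle {H : Type} [Fintype H] (inv : Equiv.Perm H) {t₀ t₁ t₂ : H → Bool}
    (h₀ : ∀ a, t₀ (inv a) = !t₀ a) (h₁ : ∀ a, t₁ (inv a) = !t₁ a) (h₂ : ∀ a, t₂ (inv a) = !t₂ a) :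
    (tailDiff t₀ t₁ + tailDiff t₁ t₂) % 2 = tailDiff t₀ t₂ % 2 := by
  have e : ∑ a, (if t₀ a = true ∧ t₁ a = false ∧ t₂ a = true then 1 else 0) =
      ∑ a, if t₀ a = false ∧ t₁ a = true ∧ t₂ a = false then 1 else 0 := by
    rw [← Equiv.sum_comp inv]
    refine Finset.sum_congr rfl fun a _ => ?_
    rw [h₀, h₁, h₂]
    cases t₀ a <;> cases t₁ a <;> cases t₂ a <;> rfl
  have key : tailDiff t₀ t₁ + tailDiff t₁ t₂ = tailDiff t₀ t₂ +
      ∑ a, (if t₀ a = true ∧ t₁ a = false ∧ t₂ a = true then 1 else 0) +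
      ∑ a, if t₀ a = false ∧ t₁ a = true ∧ t₂ a = false then 1 else 0 := by
    simp only [tailDiff, natCard_subtype_eq_sum, ← Finset.sum_add_distrib]
    refine Finset.sum_congr rfl fun a _ => ?_
    cases t₀ a <;> cases t₁ a <;> cases t₂ a <;> simp
  rw [key, e]
  omega

theorem tailDiff_self {H : Type} (t : H → Bool) : tailDiff t t = 0 := by
  have : IsEmpty {a // t a = true ∧ t a = false} := ⟨fun a => by
    have := a.2.1.symm.trans a.2.2; exact absurd this (by simp)⟩
  exact Nat.card_of_isEmpty

namespace OGraph.EdgeTuple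

variable {Γ : OGraph} {n : ℕ}

theorem tail_apply (d : Γ.EdgeTuple n) (m : Fin n) : d.tail (d.1 m) = true := by
  simp [tail]

theorem tail_inv_apply (d : Γ.EdgeTuple n) (m : Fin n) : d.tail (Γ.inv (d.1 m)) = false := by
  rw [d.tail_inv, d.tail_apply, Bool.not_true]

theorem tail_of_notMem (d : Γ.EdgeTuple n) {h : Γ.H} (h1 : ∀ m, d.1 m ≠ h)
    (h2 : ∀ m, Γ.inv (d.1 m) ≠ h) : d.tail h = Γ.tail h := by
  unfold tail
  rw [if_neg (by simpa using h1), if_neg (by simpa using h2)]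

/-- An edge of the tuple that pointed the wrong way had its tail at `Γ.inv (d.1 m)`, the half-edge
at which `tailDiff` counts it. -/
theorem flips_eq_tailDiff (d : Γ.EdgeTuple n) : d.flips = tailDiff Γ.tail d.tail := by
  refine Nat.card_congr (Equiv.ofBijective (fun m => ⟨Γ.inv (d.1 m.1), ?_, d.tail_inv_apply _⟩)
    ⟨?_, ?_⟩)
  · rw [Γ.tail_inv, m.2]; rfl
  · intro m m' e
    exact Subtype.ext (d.1.injective (Γ.inv.injective (congrArg Subtype.val e)))
  · rintro ⟨a, h1, h2⟩
    by_cases h3 : ∃ m, d.1 m = a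
    · obtain ⟨m, rfl⟩ := h3
      rw [d.tail_apply] at h2
      exact absurd h2 (by simp)
    by_cases h4 : ∃ m, Γ.inv (d.1 m) = a
    · obtain ⟨m, rfl⟩ := h4
      refine ⟨⟨m, ?_⟩, rfl⟩
      rw [Γ.tail_inv] at h1
      simpa using h1
    · rw [d.tail_of_notMem (by simpa using h3) (by simpa using h4), h1] at h2
      exact absurd h2 (by simp)

theorem cycle_symm_apply (d : Γ.EdgeTuple n) (m : Fin n) :
    d.cycle.symm (d.1 (finRotate n m)) = d.1 m := by
  rw [Equiv.symm_apply_eq, cycle_apply]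

theorem cycle_symm_of_notMem (d : Γ.EdgeTuple n) {h : Γ.H} (hh : ∀ m, d.1 m ≠ h) :
    d.cycle.symm h = h := by
  rw [Equiv.symm_apply_eq, d.cycle_apply_of_notMem hh]

theorem glue_inv (d : Γ.EdgeTuple n) (h : Γ.H) :
    (Γ.glue d).inv h = d.cycle (Γ.inv (d.cycle.symm h)) := rfl

theorem glue_inv_apply (d : Γ.EdgeTuple n) (m : Fin n) :
    (Γ.glue d).inv (d.1 (finRotate n m)) = Γ.inv (d.1 m) := by
  rw [glue_inv, cycle_symm_apply, d.cycle_apply_of_notMem fun m' => d.2 m' m]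

theorem glue_inv_of_notMem (d : Γ.EdgeTuple n) {h : Γ.H} (h1 : ∀ m, d.1 m ≠ h)
    (h2 : ∀ m, Γ.inv (d.1 m) ≠ h) : (Γ.glue d).inv h = Γ.inv h := by
  rw [glue_inv, d.cycle_symm_of_notMem h1, d.cycle_apply_of_notMem]
  intro m e
  exact h2 m (by rw [e, Γ.inv_inv])

end OGraph.EdgeTuple

namespace LGraph

/-! ## Gluing and embeddings -/

namespace Emb

variable {g g' g'' : LGraph O} {n : ℕ}

/-- The image of a tuple of edges. -/
def mapTuple (φ : Emb g g') (d : g.1.EdgeTuple n) : g'.1.EdgeTuple n :=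
  ⟨d.1.trans ⟨φ.h, φ.h_inj⟩, fun i j e => d.2 i j (φ.h_inj (e.trans (φ.inv_h _)))⟩

@[simp] theorem mapTuple_apply (φ : Emb g g') (d : g.1.EdgeTuple n) (m : Fin n) :
    (φ.mapTuple d).1 m = φ.h (d.1 m) := rfl

theorem cycle_mapTuple (φ : Emb g g') (d : g.1.EdgeTuple n) (a : g.1.H) :
    (φ.mapTuple d).cycle (φ.h a) = φ.h (d.cycle a) := by
  by_cases e : ∃ m, d.1 m = a
  · obtain ⟨m, rfl⟩ := e
    rw [d.cycle_apply]
    exact (φ.mapTuple d).cycle_apply m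
  · rw [d.cycle_apply_of_notMem (fun m hm => e ⟨m, hm⟩),
      (φ.mapTuple d).cycle_apply_of_notMem (fun m hm => e ⟨m, φ.h_inj hm⟩)]

theorem cycle_symm_mapTuple (φ : Emb g g') (d : g.1.EdgeTuple n) (a : g.1.H) :
    (φ.mapTuple d).cycle.symm (φ.h a) = φ.h (d.cycle.symm a) := by
  rw [Equiv.symm_apply_eq, cycle_mapTuple, Equiv.apply_symm_apply]

theorem tail_mapTuple (φ : Emb g g') (d : g.1.EdgeTuple n) (a : g.1.H) :
    (φ.mapTuple d).tail (φ.h a) = if ∃ m, d.1 m = a then true else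
      if ∃ m, g.1.inv (d.1 m) = a then false else g'.1.tail (φ.h a) := by
  unfold OGraph.EdgeTuple.tail
  have e1 : (∃ m, (φ.mapTuple d).1 m = φ.h a) ↔ ∃ m, d.1 m = a :=
    exists_congr fun m => φ.h_inj.eq_iff
  have e2 : (∃ m, g'.1.inv ((φ.mapTuple d).1 m) = φ.h a) ↔ ∃ m, g.1.inv (d.1 m) = a :=
    exists_congr fun m => by rw [mapTuple_apply, φ.inv_h]; exact φ.h_inj.eq_iff
  simp only [e1, e2]

/-- Gluing is functorial. -/
def glue (φ : Emb g g') (d : g.1.EdgeTuple n) : Emb (g.glue d) (g'.glue (φ.mapTuple d)) where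
  v := φ.v
  v_inj := φ.v_inj
  h := φ.h
  h_inj := φ.h_inj
  root_h := φ.root_h
  inv_h := fun (a : g.1.H) => by
    change (φ.mapTuple d).cycle (g'.1.inv ((φ.mapTuple d).cycle.symm (φ.h a))) =
      φ.h (d.cycle (g.1.inv (d.cycle.symm a)))
    rw [cycle_symm_mapTuple, φ.inv_h, cycle_mapTuple]
  surj := φ.surj
  label := φ.label

theorem Strict.glue {φ : Emb g g'} (hφ : φ.Strict) (d : g.1.EdgeTuple n) : (φ.glue d).Strict where
  mono := hφ.mono
  tail := fun (a : g.1.H) => by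
    change (φ.mapTuple d).tail (φ.h a) = d.tail a
    rw [tail_mapTuple, hφ.tail]
    rfl

theorem Strict.flips_mapTuple {φ : Emb g g'} (hφ : φ.Strict) (d : g.1.EdgeTuple n) :
    (φ.mapTuple d).flips = d.flips := by
  unfold OGraph.EdgeTuple.flips
  simp only [mapTuple_apply, hφ.tail]

/-- Both sides compare the directions in `g` with those in the glued target, once by way of the
glued source and once by way of `g'`; the cocycle rule for `tailDiff` identifies them. -/
theorem flips_add_reversals (φ : Emb g g') (d : g.1.EdgeTuple n) :
    (d.flips + (φ.glue d).reversals) % 2 = (φ.reversals + (φ.mapTuple d).flips) % 2 := by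
  have h0 := g.1.tail_inv
  have h1 := d.tail_inv
  have h3 : ∀ a, g'.1.tail (φ.h (g.1.inv a)) = !g'.1.tail (φ.h a) := fun a => by
    rw [← φ.inv_h, g'.1.tail_inv]
  have h2 : ∀ a, (φ.mapTuple d).tail (φ.h (g.1.inv a)) = !(φ.mapTuple d).tail (φ.h a) := fun a => by
    rw [← φ.inv_h, (φ.mapTuple d).tail_inv]
  have e1 := tailDiff_cocycle (t₂ := fun a => (φ.mapTuple d).tail (φ.h a)) g.1.inv h0 h1 h2
  have e2 := tailDiff_cocycle (t₁ := fun a => g'.1.tail (φ.h a))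
    (t₂ := fun a => (φ.mapTuple d).tail (φ.h a)) g.1.inv h0 h3 h2
  have e3 : (φ.mapTuple d).flips =
      tailDiff (fun a => g'.1.tail (φ.h a)) (fun a => (φ.mapTuple d).tail (φ.h a)) := by
    rw [OGraph.EdgeTuple.flips_eq_tailDiff]
    symm
    refine Nat.card_congr (Equiv.ofBijective (fun a => ⟨φ.h a.1, a.2⟩) ⟨?_, ?_⟩)
    · intro a b e
      exact Subtype.ext (φ.h_inj (congrArg Subtype.val e))
    · rintro ⟨a, ha1, ha2⟩
      by_cases h5 : ∃ m, g'.1.inv ((φ.mapTuple d).1 m) = a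
      · obtain ⟨m, rfl⟩ := h5
        rw [mapTuple_apply, φ.inv_h] at ha1 ha2
        exact ⟨⟨g.1.inv (d.1 m), ha1, ha2⟩, Subtype.ext (φ.inv_h (d.1 m)).symm⟩
      · exfalso
        by_cases h4 : ∃ m, (φ.mapTuple d).1 m = a
        · obtain ⟨m, rfl⟩ := h4
          rw [OGraph.EdgeTuple.tail_apply] at ha2
          exact absurd ha2 (by simp)
        · rw [OGraph.EdgeTuple.tail_of_notMem _ (by simpa using h4) (by simpa using h5), ha1] at ha2
          exact absurd ha2 (by simp)
  rw [e3, OGraph.EdgeTuple.flips_eq_tailDiff]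
  exact e1.trans e2.symm

/-- Gluing away from the image of an embedding. -/
def glueAway (φ : Emb g g') (d : g'.1.EdgeTuple n) (hd : ∀ m a, d.1 m ≠ φ.h a) :
    Emb g (g'.glue d) where
  v := φ.v
  v_inj := φ.v_inj
  h := φ.h
  h_inj := φ.h_inj
  root_h := φ.root_h
  inv_h a := by
    change (g'.1.glue d).inv (φ.h a) = _
    rw [d.glue_inv_of_notMem (fun m => hd m a), φ.inv_h]
    intro m e
    refine hd m (g.1.inv a) ?_
    rw [← φ.inv_h, ← e, g'.1.inv_inv]
  surj := φ.surj
  label := φ.label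

theorem Strict.glueAway {φ : Emb g g'} (hφ : φ.Strict) (d : g'.1.EdgeTuple n)
    (hd : ∀ m a, d.1 m ≠ φ.h a) : (φ.glueAway d hd).Strict where
  mono := hφ.mono
  tail a := by
    change d.tail (φ.h a) = _
    rw [d.tail_of_notMem (fun m => hd m a), hφ.tail]
    intro m e
    refine hd m (g.1.inv a) ?_
    rw [← φ.inv_h, ← e, g'.1.inv_inv]

end Emb

/-! ## Contracting edges -/

section Contract

variable (g : LGraph O) (t : g.1.H) (ht : g.1.root t ≠ g.1.root (g.1.inv t))

theorem contract_label_other (z : (g.contract t ht).1.V) (hz : z.1 ≠ g.1.root t) :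
    O.Same (fun a : g.1.Flags z.1 => a.1)
      (fun a : (g.contract t ht).1.Flags z => a.1.1) (g.2 z.1) ((g.contract t ht).2 z) := by
  have : (g.contract t ht).2 z = O.map (g.1.contractFlagsOther t ht z hz) (g.2 z.1) :=
    dif_neg hz
  exact ⟨g.1.contractFlagsOther t ht z hz, fun _ => rfl, this.symm⟩

theorem contract_label_merged (z : (g.contract t ht).1.V) (hz : z.1 = g.1.root t) {x y : g.1.V}
    (hx : g.1.root t = x) (hy : g.1.root (g.1.inv t) = y) :
    O.Same (CyclicOperad.marks ⟨t, hx⟩ ⟨g.1.inv t, hy⟩ (fun a : g.1.Flags x => a.1)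
        (fun a : g.1.Flags y => a.1))
      (fun a : (g.contract t ht).1.Flags z => a.1.1)
      (O.comp ⟨t, hx⟩ ⟨g.1.inv t, hy⟩ (g.2 x) (g.2 y)) ((g.contract t ht).2 z) := by
  subst hx hy
  obtain rfl : z = ⟨g.1.root t, ht⟩ := Subtype.ext hz
  have : (g.contract t ht).2 ⟨g.1.root t, ht⟩ = O.map (g.1.contractFlagsMerged t ht)
      (O.comp ⟨t, rfl⟩ ⟨g.1.inv t, rfl⟩ (g.2 (g.1.root t)) (g.2 (g.1.root (g.1.inv t)))) :=
    dif_pos rfl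
  refine ⟨g.1.contractFlagsMerged t ht, ?_, this.symm⟩
  rintro (a | a) <;> rfl

/-- The image of a vertex under the contraction. -/
def contractVertex (x : g.1.V) : (g.contract t ht).1.V :=
  if e : x = g.1.root (g.1.inv t) then ⟨g.1.root t, ht⟩ else ⟨x, e⟩

theorem contractVertex_of_ne {x : g.1.V} (e : x ≠ g.1.root (g.1.inv t)) :
    g.contractVertex t ht x = ⟨x, e⟩ := dif_neg e

theorem contractVertex_of_eq {x : g.1.V} (e : x = g.1.root (g.1.inv t)) :
    g.contractVertex t ht x = ⟨g.1.root t, ht⟩ := dif_pos e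

theorem contractVertex_inv : g.contractVertex t ht (g.1.root (g.1.inv t)) = ⟨g.1.root t, ht⟩ :=
  dif_pos rfl

theorem contractVertex_root : g.contractVertex t ht (g.1.root t) = ⟨g.1.root t, ht⟩ :=
  dif_neg ht

theorem contractVertex_val (x : (g.contract t ht).1.V) : g.contractVertex t ht x.1 = x :=
  dif_neg x.2

theorem contract_root (a : (g.contract t ht).1.H) :
    (g.contract t ht).1.root a = g.contractVertex t ht (g.1.root a.1) := rfl

theorem contractVertex_eq_iff {x y : g.1.V} : g.contractVertex t ht x = g.contractVertex t ht y ↔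
    x = y ∨ (x = g.1.root t ∧ y = g.1.root (g.1.inv t)) ∨
      (x = g.1.root (g.1.inv t) ∧ y = g.1.root t) := by
  by_cases h1 : x = g.1.root (g.1.inv t) <;> by_cases h2 : y = g.1.root (g.1.inv t)
  · simp [h1, h2]
  · rw [g.contractVertex_of_eq t ht h1, g.contractVertex_of_ne t ht h2]
    refine Subtype.mk.injEq .. |>.to_iff.trans ?_
    constructor
    · rintro rfl
      exact Or.inr (Or.inr ⟨h1, rfl⟩)
    · rintro (rfl | ⟨rfl, h⟩ | ⟨_, rfl⟩)
      · exact absurd h1 h2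
      · exact absurd h h2
      · rfl
  · rw [g.contractVertex_of_ne t ht h1, g.contractVertex_of_eq t ht h2]
    refine Subtype.mk.injEq .. |>.to_iff.trans ?_
    constructor
    · rintro rfl
      exact Or.inr (Or.inl ⟨rfl, h2⟩)
    · rintro (rfl | ⟨rfl, h⟩ | ⟨h, rfl⟩)
      · exact absurd h2 h1
      · rfl
      · exact absurd h h1
  · rw [g.contractVertex_of_ne t ht h1, g.contractVertex_of_ne t ht h2]
    refine Subtype.mk.injEq .. |>.to_iff.trans ?_
    constructor
    · exact Or.inl
    · rintro (rfl | ⟨rfl, h⟩ | ⟨h, rfl⟩)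
      · rfl
      · exact absurd h h2
      · exact absurd h h1

/-- To embed a contracted graph, give maps on the original graph. -/
def contractLift {g'' : LGraph O} {W : Type} (j : g''.1.H → W) (hj : j.Injective)
    (v : g.1.V → g''.1.V) (hv : v (g.1.root (g.1.inv t)) = v (g.1.root t))
    (v_inj : ∀ x x', x ≠ g.1.root (g.1.inv t) → x' ≠ g.1.root (g.1.inv t) → v x = v x' → x = x')
    (h : (g.contract t ht).1.H → g''.1.H) (h_inj : h.Injective)
    (w : g.1.H → W) (hw : ∀ a, j (h a) = w a.1)
    (root_h : ∀ a, g''.1.root (h a) = v (g.1.root a.1))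
    (inv_h : ∀ a, g''.1.inv (h a) = h ((g.contract t ht).1.inv a))
    (surj : ∀ a x, g''.1.root a = v x → ∃ b, h b = a)
    (label_other : ∀ x, x ≠ g.1.root t → x ≠ g.1.root (g.1.inv t) →
      O.Same (fun a : g.1.Flags x => w a.1) (fun a : g''.1.Flags (v x) => j a.1) (g.2 x)
        (g''.2 (v x)))
    {x y : g.1.V} (hx : g.1.root t = x) (hy : g.1.root (g.1.inv t) = y)
    (label_merged : O.Same (CyclicOperad.marks ⟨t, hx⟩ ⟨g.1.inv t, hy⟩
        (fun a : g.1.Flags x => w a.1) (fun a : g.1.Flags y => w a.1))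
      (fun a : g''.1.Flags (v x) => j a.1)
      (O.comp ⟨t, hx⟩ ⟨g.1.inv t, hy⟩ (g.2 x) (g.2 y)) (g''.2 (v x))) : Emb (g.contract t ht) g'' where
  v x := v x.1
  v_inj x y e := Subtype.ext (v_inj _ _ x.2 y.2 e)
  h := h
  h_inj := h_inj
  root_h a := by
    rw [root_h, contract_root]
    by_cases e : g.1.root a.1 = g.1.root (g.1.inv t)
    · rw [g.contractVertex_of_eq t ht e, e, hv]
    · rw [g.contractVertex_of_ne t ht e]
  inv_h := inv_h
  surj a x e := surj a x.1 e
  label z := by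
    refine CyclicOperad.Same.of_postcomp hj ?_
    by_cases hz : z.1 = g.1.root t
    · subst hx hy
      obtain rfl : z = ⟨g.1.root t, ht⟩ := Subtype.ext hz
      have h1 := ((g.contract_label_merged t ht _ hz rfl rfl).postcomp w).symm
      refine (h1.congr_fun (fun a => (hw _).symm) fun a => ?_).trans label_merged
      rcases a with a | a <;> rfl
    · have h1 := ((g.contract_label_other t ht z hz).postcomp w).symm
      exact (h1.congr_fun (fun a => (hw _).symm) fun a => rfl).trans (label_other _ hz z.2)

end Contract

namespace Emb

variable {g g' : LGraph O}

theorem root_ne (φ : Emb g g') {t : g.1.H} (ht : g.1.root t ≠ g.1.root (g.1.inv t)) :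
    g'.1.root (φ.h t) ≠ g'.1.root (g'.1.inv (φ.h t)) := by
  rw [φ.inv_h, φ.root_h, φ.root_h]
  exact fun e => ht (φ.v_inj e)

/-- Contraction is functorial. -/
def contract (φ : Emb g g') (t : g.1.H) (ht : g.1.root t ≠ g.1.root (g.1.inv t)) :
    Emb (g.contract t ht) (g'.contract (φ.h t) (φ.root_ne ht)) :=
  g.contractLift t ht (W := g'.1.H) (fun a => a.1) Subtype.val_injective
    (fun x => g'.contractVertex (φ.h t) (φ.root_ne ht) (φ.v x))
    (by
      rw [contractVertex_eq_iff, φ.root_h, φ.inv_h, φ.root_h]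
      exact Or.inr (Or.inr ⟨rfl, rfl⟩))
    (by
      intro x x' hx hx' e
      rw [contractVertex_eq_iff, φ.root_h, φ.inv_h, φ.root_h] at e
      rcases e with e | ⟨_, e⟩ | ⟨e, _⟩
      · exact φ.v_inj e
      · exact absurd (φ.v_inj e) hx'
      · exact absurd (φ.v_inj e) hx)
    (fun a => ⟨φ.h a.1, fun e => a.2.1 (φ.h_inj e), fun e => a.2.2 (φ.h_inj (by
      rw [e, φ.inv_h]))⟩)
    (fun a b e => Subtype.ext (φ.h_inj (congrArg Subtype.val e)))
    φ.h (fun _ => rfl)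
    (fun a => congrArg (g'.contractVertex (φ.h t) (φ.root_ne ht)) (φ.root_h _))
    (fun a => Subtype.ext (φ.inv_h a.1))
    (by
      intro a x e
      rw [contract_root, contractVertex_eq_iff] at e
      have h1 : ∃ b, φ.h b = a.1 := by
        rcases e with e | ⟨e, _⟩ | ⟨e, _⟩
        · exact φ.surj _ _ e
        · exact φ.surj _ _ (e.trans (φ.root_h _))
        · refine φ.surj _ (g.1.root (g.1.inv t)) (e.trans ?_)
          rw [φ.inv_h, φ.root_h]
      obtain ⟨b, hb⟩ := h1
      refine ⟨⟨b, fun e' => a.2.1 (by rw [← hb, e']), fun e' => a.2.2 (by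
        rw [← hb, e', φ.inv_h])⟩, Subtype.ext hb⟩)
    (by
      intro x hx hx'
      have h1 : φ.v x ≠ g'.1.root (g'.1.inv (φ.h t)) := by
        rw [φ.inv_h, φ.root_h]; exact fun e => hx' (φ.v_inj e)
      have h2 : φ.v x ≠ g'.1.root (φ.h t) := by
        rw [φ.root_h]; exact fun e => hx (φ.v_inj e)
      rw [contractVertex_of_ne _ _ _ h1]
      exact (φ.label x).trans (g'.contract_label_other _ _ ⟨φ.v x, h1⟩ h2))
    rfl rfl
    (by
      have h1 : φ.v (g.1.root t) ≠ g'.1.root (g'.1.inv (φ.h t)) := by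
        rw [φ.inv_h, φ.root_h]; exact fun e => ht (φ.v_inj e)
      rw [contractVertex_of_ne _ _ _ h1]
      refine CyclicOperad.Same.trans ?_ (g'.contract_label_merged _ _ ⟨φ.v (g.1.root t), h1⟩
        (φ.root_h t).symm (φ.root_h t) (y := φ.v (g.1.root (g.1.inv t)))
        (by rw [φ.inv_h, φ.root_h]))
      exact CyclicOperad.Same.comp (φ.label _) (φ.label _) Subtype.val_injective
        Subtype.val_injective rfl (φ.inv_h t))

theorem contract_v (φ : Emb g g') (t : g.1.H) (ht : g.1.root t ≠ g.1.root (g.1.inv t))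
    (x : (g.contract t ht).1.V) : ((φ.contract t ht).v x).1 = φ.v x.1 := by
  have h1 : φ.v x.1 ≠ g'.1.root (g'.1.inv (φ.h t)) := by
    rw [φ.inv_h, φ.root_h]; exact fun e => x.2 (φ.v_inj e)
  exact congrArg Subtype.val (g'.contractVertex_of_ne _ (φ.root_ne ht) h1)

theorem Strict.contract {φ : Emb g g'} (hφ : φ.Strict) (t : g.1.H)
    (ht : g.1.root t ≠ g.1.root (g.1.inv t)) : (φ.contract t ht).Strict where
  mono x y h := by
    change ((φ.contract t ht).v x).1 < ((φ.contract t ht).v y).1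
    rw [contract_v, contract_v]
    exact hφ.mono _ _ h
  tail a := hφ.tail a.1

theorem contract_surjective (φ : Emb g g') (hv : φ.v.Surjective) (t : g.1.H)
    (ht : g.1.root t ≠ g.1.root (g.1.inv t)) : (φ.contract t ht).v.Surjective := by
  rintro ⟨y, hy⟩
  obtain ⟨x, rfl⟩ := hv y
  refine ⟨⟨x, fun e => hy ?_⟩, Subtype.ext (φ.contract_v _ _ _)⟩
  rw [e, φ.inv_h, φ.root_h]

/-- Contracting away from the image of an embedding. -/
def contractAway (φ : Emb g g') (t : g'.1.H) (ht : g'.1.root t ≠ g'.1.root (g'.1.inv t))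
    (h1 : ∀ x, φ.v x ≠ g'.1.root t) (h2 : ∀ x, φ.v x ≠ g'.1.root (g'.1.inv t)) :
    Emb g (g'.contract t ht) where
  v x := ⟨φ.v x, h2 x⟩
  v_inj x y e := φ.v_inj (congrArg Subtype.val e)
  h a := ⟨φ.h a, fun e => h1 (g.1.root a) (by rw [← φ.root_h, e]),
    fun e => h2 (g.1.root a) (by rw [← φ.root_h, e])⟩
  h_inj x y e := φ.h_inj (congrArg Subtype.val e)
  root_h a := by
    refine (g'.contractVertex_of_ne t ht ?_).trans (Subtype.ext (φ.root_h a))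
    rw [φ.root_h]
    exact h2 _
  inv_h a := Subtype.ext (φ.inv_h a)
  surj a x e := by
    have h3 : g'.1.root a.1 = φ.v x := by
      rw [contract_root] at e
      by_cases h4 : g'.1.root a.1 = g'.1.root (g'.1.inv t)
      · rw [h4, contractVertex_inv] at e
        exact absurd (congrArg Subtype.val e).symm (h1 x)
      · rw [contractVertex_of_ne _ _ _ h4] at e
        exact congrArg Subtype.val e
    obtain ⟨b, hb⟩ := φ.surj _ _ h3
    exact ⟨b, Subtype.ext hb⟩
  label x := by
    refine CyclicOperad.Same.of_postcomp Subtype.val_injective ?_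
    exact (φ.label x).trans (g'.contract_label_other _ _ ⟨φ.v x, h2 x⟩ (h1 x))

theorem Strict.contractAway {φ : Emb g g'} (hφ : φ.Strict) (t : g'.1.H)
    (ht : g'.1.root t ≠ g'.1.root (g'.1.inv t))
    (h1 : ∀ x, φ.v x ≠ g'.1.root t) (h2 : ∀ x, φ.v x ≠ g'.1.root (g'.1.inv t)) :
    (φ.contractAway t ht h1 h2).Strict where
  mono x y h := hφ.mono x y h
  tail a := hφ.tail a

end Emb

end LGraph

/-! ### Classes of contracted graphs and their signs -/

namespace LGraph

/-- The contraction of an edge as an element of the graph space. -/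
def contrCls (g : LGraph O) (t : g.1.H) : GraphSpace O :=
  (Submodule.span k {r | Rel O r}).mkQ (g.contractEdge t)

theorem contrCls_of_ne (g : LGraph O) (t : g.1.H) (ht : g.1.root t ≠ g.1.root (g.1.inv t)) :
    g.contrCls t = (-1 : k) ^ g.1.contractParity t • (g.contract t ht).cls := by
  unfold contrCls contractEdge
  rw [dif_pos ht, map_smul]
  rfl

theorem contrCls_of_eq (g : LGraph O) (t : g.1.H) (ht : g.1.root t = g.1.root (g.1.inv t)) :
    g.contrCls t = 0 := by
  unfold contrCls contractEdge
  rw [dif_neg (not_not.2 ht), map_zero]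

namespace Emb

variable {g g' : LGraph O}

theorem reversals_contract (φ : Emb g g') (t : g.1.H) (ht : g.1.root t ≠ g.1.root (g.1.inv t))
    (h : g'.1.tail (φ.h t) = g.1.tail t) : (φ.contract t ht).reversals = φ.reversals := by
  have h' : g'.1.tail (φ.h (g.1.inv t)) = g.1.tail (g.1.inv t) := by
    rw [← φ.inv_h, g'.1.tail_inv, g.1.tail_inv, h]
  refine Nat.card_congr ⟨fun a => ⟨a.1.1, a.2⟩, fun a => ⟨⟨a.1, ?_, ?_⟩, a.2⟩, fun _ => rfl,
    fun _ => rfl⟩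
  · intro e
    have h1 := a.2.1
    have h2 := a.2.2
    rw [e] at h1 h2
    rw [h, h1] at h2
    exact absurd h2 (by simp)
  · intro e
    have h1 := a.2.1
    have h2 := a.2.2
    rw [e] at h1 h2
    rw [h', h1] at h2
    exact absurd h2 (by simp)

/-- The inversions lost by contracting are those involving the removed vertex `y`. A vertex is
inverted with `y` exactly when it lies before `y` in just one of the two orderings, so modulo 2
their number is the sum of the two positions of `y`. -/
theorem inversions_contract (φ : Emb g g') (hv : φ.v.Surjective) (t : g.1.H)
    (ht : g.1.root t ≠ g.1.root (g.1.inv t)) :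
    (g.1.contractParity t + (φ.contract t ht).inversions) % 2 =
      (φ.inversions + g'.1.contractParity (φ.h t)) % 2 := by
  set y := g.1.root (g.1.inv t) with hy
  have e1 : g'.1.contractParity (φ.h t) = Nat.card {x : g.1.V // φ.v x < φ.v y} + 1 := by
    unfold OGraph.contractParity
    congr 1
    symm
    refine Nat.card_congr (Equiv.ofBijective (fun x => ⟨φ.v x.1, ?_⟩) ⟨?_, ?_⟩)
    · rw [φ.inv_h, φ.root_h]; exact x.2
    · exact fun a b e => Subtype.ext (φ.v_inj (congrArg Subtype.val e))
    · rintro ⟨x, hx⟩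
      obtain ⟨x, rfl⟩ := hv x
      rw [φ.inv_h, φ.root_h] at hx
      exact ⟨⟨x, hx⟩, rfl⟩
  have e2 : (φ.contract t ht).inversions = Nat.card {p : g.1.V × g.1.V //
      (p.1 ≠ y ∧ p.2 ≠ y) ∧ p.1 < p.2 ∧ φ.v p.2 < φ.v p.1} := by
    refine Nat.card_congr ⟨fun p => ⟨(p.1.1.1, p.1.2.1), ⟨p.1.1.2, p.1.2.2⟩, p.2.1, ?_⟩,
      fun p => ⟨(⟨p.1.1, p.2.1.1⟩, ⟨p.1.2, p.2.1.2⟩), p.2.2.1, ?_⟩, fun _ => rfl, fun _ => rfl⟩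
    · have := p.2.2
      change ((φ.contract t ht).v _).1 < ((φ.contract t ht).v _).1 at this
      rwa [contract_v, contract_v] at this
    · change ((φ.contract t ht).v _).1 < ((φ.contract t ht).v _).1
      rw [contract_v, contract_v]
      exact p.2.2.2
  have e3 : φ.inversions = Nat.card {p : g.1.V × g.1.V //
      (p.1 ≠ y ∧ p.2 ≠ y) ∧ p.1 < p.2 ∧ φ.v p.2 < φ.v p.1} +
      Nat.card {x : g.1.V // x < y ∧ φ.v y < φ.v x} +
      Nat.card {x : g.1.V // y < x ∧ φ.v x < φ.v y} := by
    have h1 : Nat.card {x : g.1.V // x < y ∧ φ.v y < φ.v x} =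
        Nat.card {p : g.1.V × g.1.V // p.2 = y ∧ p.1 < p.2 ∧ φ.v p.2 < φ.v p.1} :=
      Nat.card_congr ⟨fun x => ⟨(x.1, y), rfl, x.2⟩, fun p => ⟨p.1.1, by have h := p.2.2; rwa [p.2.1] at h⟩,
        fun _ => rfl, fun p => Subtype.ext (Prod.ext rfl p.2.1.symm)⟩
    have h2 : Nat.card {x : g.1.V // y < x ∧ φ.v x < φ.v y} =
        Nat.card {p : g.1.V × g.1.V // p.1 = y ∧ p.1 < p.2 ∧ φ.v p.2 < φ.v p.1} :=
      Nat.card_congr ⟨fun x => ⟨(y, x.1), rfl, x.2⟩, fun p => ⟨p.1.2, by have h := p.2.2; rwa [p.2.1] at h⟩,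
        fun _ => rfl, fun p => Subtype.ext (Prod.ext p.2.1.symm rfl)⟩
    rw [h1, h2, inversions]
    simp only [natCard_subtype_eq_sum]
    rw [← Finset.sum_add_distrib, ← Finset.sum_add_distrib]
    refine Finset.sum_congr rfl fun p _ => ?_
    by_cases h3 : p.1 = y <;> by_cases h4 : p.2 = y <;> simp [h3, h4]
  have e4 : Nat.card {x : g.1.V // x < y} + Nat.card {x : g.1.V // φ.v x < φ.v y} =
      Nat.card {x : g.1.V // x < y ∧ φ.v y < φ.v x} +
      Nat.card {x : g.1.V // y < x ∧ φ.v x < φ.v y} +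
      2 * Nat.card {x : g.1.V // x < y ∧ φ.v x < φ.v y} := by
    simp only [natCard_subtype_eq_sum]
    rw [Finset.mul_sum, ← Finset.sum_add_distrib, ← Finset.sum_add_distrib,
      ← Finset.sum_add_distrib]
    refine Finset.sum_congr rfl fun x _ => ?_
    by_cases hxy : x = y
    · subst hxy
      simp
    have hne' : φ.v x ≠ φ.v y := fun e => hxy (φ.v_inj e)
    rcases lt_or_gt_of_ne hxy with h3 | h3 <;> rcases lt_or_gt_of_ne hne' with h4 | h4 <;>
      simp [h3, h3.asymm, h4, h4.asymm]
  have e5 : g.1.contractParity t = Nat.card {x : g.1.V // x < y} + 1 := rfl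
  rw [e1, e2, e3, e5]
  omega

theorem contrCls_eq (φ : Emb g g') (hv : φ.v.Surjective) (t : g.1.H)
    (h : g'.1.tail (φ.h t) = g.1.tail t) :
    g.contrCls t = (-1 : k) ^ φ.parity • g'.contrCls (φ.h t) := by
  by_cases ht : g.1.root t = g.1.root (g.1.inv t)
  · rw [contrCls_of_eq g t ht, contrCls_of_eq g', smul_zero]
    rw [φ.inv_h, φ.root_h, φ.root_h, ht]
  · rw [contrCls_of_ne g t ht, contrCls_of_ne g' _ (φ.root_ne ht),
      (φ.contract t ht).cls_eq (φ.contract_surjective hv t ht), smul_smul, smul_smul, ← pow_add,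
      ← pow_add]
    congr 1
    refine neg_one_pow_congr ?_
    have h1 := φ.inversions_contract hv t ht
    rw [parity, φ.reversals_contract t ht h, parity]
    omega

end Emb

/-! ### Reversing the contracted edge -/

theorem root_inv_ne (g : LGraph O) (t : g.1.H) (ht : g.1.root t ≠ g.1.root (g.1.inv t)) :
    g.1.root (g.1.inv t) ≠ g.1.root (g.1.inv (g.1.inv t)) := by
  rw [g.1.inv_inv]
  exact ht.symm

section Reverse

variable (g : LGraph O) (t : g.1.H) (ht : g.1.root t ≠ g.1.root (g.1.inv t))

/-- Contracting an edge in either direction gives the same graph, up to the vertex ordering. -/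
def contractReverse :
    Emb (g.contract t ht) (g.contract (g.1.inv t) (g.root_inv_ne t ht)) :=
  g.contractLift t ht (W := g.1.H) (fun a => a.1) Subtype.val_injective
    (fun x => g.contractVertex (g.1.inv t) (g.root_inv_ne t ht) x)
    (by
      rw [contractVertex_eq_iff, g.1.inv_inv]
      exact Or.inr (Or.inl ⟨rfl, rfl⟩))
    (by
      intro x x' hx hx' e
      rw [contractVertex_eq_iff, g.1.inv_inv] at e
      rcases e with e | ⟨e, _⟩ | ⟨_, e⟩
      · exact e
      · exact absurd e hx
      · exact absurd e hx')
    (fun a => ⟨a.1, a.2.2, by rw [g.1.inv_inv]; exact a.2.1⟩)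
    (fun a b e => by
      have h : a.1 = b.1 := congrArg (fun c => c.1) e
      exact Subtype.ext h)
    id (fun _ => rfl) (fun _ => rfl) (fun _ => rfl)
    (fun a _ _ => ⟨⟨a.1, fun e => a.2.2 (by rw [e, g.1.inv_inv]), a.2.1⟩, rfl⟩)
    (by
      intro x hx hx'
      have h1 : x ≠ g.1.root (g.1.inv (g.1.inv t)) := by rw [g.1.inv_inv]; exact hx
      rw [contractVertex_of_ne _ _ _ h1]
      exact g.contract_label_other _ _ ⟨x, h1⟩ hx')
    rfl rfl
    (by
      have h1 : g.1.root t = g.1.root (g.1.inv (g.1.inv t)) := by rw [g.1.inv_inv]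
      rw [contractVertex_of_eq _ _ _ h1]
      refine (CyclicOperad.Same.comp_comm _ _ _ _ _ _).trans ?_
      have h2 := g.contract_label_merged (g.1.inv t) (g.root_inv_ne t ht)
        ⟨g.1.root (g.1.inv t), g.root_inv_ne t ht⟩ rfl rfl (y := g.1.root t)
        (by rw [g.1.inv_inv])
      have h3 : ∀ (s : g.1.H) (hs : s = t) (hs' : g.1.root s = g.1.root t),
          (⟨s, hs'⟩ : g.1.Flags (g.1.root t)) = ⟨t, rfl⟩ := fun s hs _ => Subtype.ext hs
      rw [h3 _ (g.1.inv_inv t)] at h2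
      exact h2)

theorem contractReverse_v (x : (g.contract t ht).1.V) : ((g.contractReverse t ht).v x).1 =
    if x.1 = g.1.root t then g.1.root (g.1.inv t) else x.1 := by
  change (g.contractVertex (g.1.inv t) (g.root_inv_ne t ht) x.1).1 = _
  split_ifs with h
  · rw [contractVertex_of_eq _ _ _ (by rw [g.1.inv_inv]; exact h)]
  · rw [contractVertex_of_ne _ _ _ (by rw [g.1.inv_inv]; exact h)]

theorem contractReverse_surjective : (g.contractReverse t ht).v.Surjective := by
  intro y
  by_cases h : y.1 = g.1.root (g.1.inv t)
  · refine ⟨⟨g.1.root t, ht⟩, Subtype.ext ?_⟩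
    exact (contractReverse_v g t ht ⟨g.1.root t, ht⟩).trans ((if_pos rfl).trans h.symm)
  · refine ⟨⟨y.1, h⟩, Subtype.ext ?_⟩
    refine (contractReverse_v g t ht ⟨y.1, h⟩).trans (if_neg ?_)
    intro e
    exact y.2 (e.trans (congrArg g.1.root (g.1.inv_inv t)).symm)

theorem contractReverse_reversals : (g.contractReverse t ht).reversals = 0 := by
  exact tailDiff_self (g.contract t ht).1.tail

/-- The merged vertex moves from the place of one end of the edge to that of the other, past the
vertices strictly between them. The positions of the two ends differ by one more than that, which is
the extra sign. -/
theorem contractReverse_parity :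
    (g.1.contractParity t + (g.contractReverse t ht).parity) % 2 =
      (g.1.contractParity (g.1.inv t) + 1) % 2 := by
  rw [Emb.parity, contractReverse_reversals, add_zero]
  set x := g.1.root t with hx
  set y := g.1.root (g.1.inv t) with hy
  have e0 : g.1.contractParity (g.1.inv t) = Nat.card {z : g.1.V // z < x} + 1 := by
    unfold OGraph.contractParity
    rw [g.1.inv_inv]
  have e1 : (g.contractReverse t ht).inversions =
      Nat.card {z : g.1.V // x < z ∧ z < y} + Nat.card {z : g.1.V // y < z ∧ z < x} := by
    have h1 : Nat.card {z : g.1.V // x < z ∧ z < y} = Nat.card {p : (g.contract t ht).1.V ×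
        (g.contract t ht).1.V // p.1.1 = x ∧ p.2.1 ≠ x ∧ p.1.1 < p.2.1 ∧ p.2.1 < y} :=
      Nat.card_congr ⟨fun z => ⟨(⟨x, ht⟩, ⟨z.1, z.2.2.ne⟩), rfl, z.2.1.ne', z.2⟩,
        fun p => ⟨p.1.2.1, by have h := p.2.2.2; rwa [p.2.1] at h⟩, fun _ => rfl,
        fun p => Subtype.ext (Prod.ext (Subtype.ext p.2.1.symm) rfl)⟩
    have h2 : Nat.card {z : g.1.V // y < z ∧ z < x} = Nat.card {p : (g.contract t ht).1.V ×
        (g.contract t ht).1.V // p.2.1 = x ∧ p.1.1 ≠ x ∧ p.1.1 < p.2.1 ∧ y < p.1.1} :=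
      Nat.card_congr ⟨fun z => ⟨(⟨z.1, z.2.1.ne'⟩, ⟨x, ht⟩), rfl, z.2.2.ne, z.2.2, z.2.1⟩,
        fun p => ⟨p.1.1.1, p.2.2.2.2, by have h := p.2.2.2.1; rwa [p.2.1] at h⟩, fun _ => rfl,
        fun p => Subtype.ext (Prod.ext rfl (Subtype.ext p.2.1.symm))⟩
    have h3 : (g.contractReverse t ht).inversions = Nat.card {p : (g.contract t ht).1.V ×
        (g.contract t ht).1.V // p.1.1 < p.2.1 ∧
          (if p.2.1 = x then y else p.2.1) < if p.1.1 = x then y else p.1.1} := by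
      refine Nat.card_congr (Equiv.subtypeEquivRight fun p => ?_)
      rw [hx, hy, ← contractReverse_v g t ht, ← contractReverse_v g t ht]
      exact Iff.rfl
    rw [h1, h2, h3]
    simp only [natCard_subtype_eq_sum]
    rw [← Finset.sum_add_distrib]
    refine Finset.sum_congr rfl fun p _ => ?_
    by_cases h3 : p.1.1 = x <;> by_cases h4 : p.2.1 = x
    · simp [h3, h4]
    · simp [h3, h4]
    · simp [h3, h4]
    · simp only [h3, h4, if_false, false_and, add_zero]
      rw [if_neg]
      exact fun h => h.1.asymm h.2
  have e2 : Nat.card {z : g.1.V // z < x} + Nat.card {z : g.1.V // z < y} =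
      Nat.card {z : g.1.V // x < z ∧ z < y} + Nat.card {z : g.1.V // y < z ∧ z < x} + 1 +
        2 * Nat.card {z : g.1.V // z < x ∧ z < y} := by
    -- The summand `1` is the smaller end of the edge, which precedes the other end only.
    have h1 : 1 = ∑ z : g.1.V, if z = (if x < y then x else y) then 1 else 0 := by
      simp
    rw [h1]
    simp only [natCard_subtype_eq_sum]
    rw [Finset.mul_sum, ← Finset.sum_add_distrib, ← Finset.sum_add_distrib,
      ← Finset.sum_add_distrib, ← Finset.sum_add_distrib]
    refine Finset.sum_congr rfl fun z _ => ?_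
    rcases lt_or_gt_of_ne ht with h3 | h3
    · rcases lt_trichotomy z x with h4 | h4 | h4
      · simp [h3, h4, h4.ne, h4.asymm, h4.trans h3, (h4.trans h3).asymm]
      · subst h4; simp [h3, h3.asymm]
      · by_cases h5 : z < y <;> simp [h3, h4, h4.ne', h4.asymm, h5]
    · rcases lt_trichotomy z y with h4 | h4 | h4
      · simp [h3, h3.asymm, h4, h4.ne, h4.asymm, h4.trans h3, (h4.trans h3).asymm]
      · subst h4; simp [h3, h3.asymm]
      · by_cases h5 : z < x <;> simp [h3, h3.asymm, h4, h4.ne', h4.asymm, h5]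
  have e3 : g.1.contractParity t = Nat.card {z : g.1.V // z < y} + 1 := rfl
  rw [e0, e1, e3]
  omega

end Reverse

/-- This sign makes contraction compatible with orientations, in which reversing an edge counts as a
sign change. -/
theorem contrCls_inv (g : LGraph O) (t : g.1.H) : g.contrCls (g.1.inv t) = -g.contrCls t := by
  by_cases ht : g.1.root t = g.1.root (g.1.inv t)
  · rw [contrCls_of_eq g t ht, contrCls_of_eq g, neg_zero]
    rw [g.1.inv_inv, ht]
  · rw [contrCls_of_ne g t ht, contrCls_of_ne g _ (g.root_inv_ne t ht),
      (g.contractReverse t ht).cls_eq (g.contractReverse_surjective t ht), smul_smul, ← pow_add,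
      neg_one_pow_congr (g.contractReverse_parity t ht), pow_succ, mul_neg_one, neg_smul, neg_neg]

end LGraph

namespace LGraph

/-! ### Contracting two edges -/

/-- The contraction of `p` followed by that of `q`. -/
def contr2 (g : LGraph O) (p q : g.1.H) : GraphSpace O :=
  if h : g.1.root p ≠ g.1.root (g.1.inv p) ∧ q ≠ p ∧ q ≠ g.1.inv p then
    (-1 : k) ^ g.1.contractParity p • (g.contract p h.1).contrCls ⟨q, h.2⟩
  else 0

theorem contr2_of_ne (g : LGraph O) (p q : g.1.H) (h1 : g.1.root p ≠ g.1.root (g.1.inv p))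
    (h2 : q ≠ p ∧ q ≠ g.1.inv p) : g.contr2 p q =
      (-1 : k) ^ g.1.contractParity p • (g.contract p h1).contrCls ⟨q, h2⟩ :=
  dif_pos ⟨h1, h2⟩

theorem contr2_eq_zero_of_loop (g : LGraph O) (p q : g.1.H)
    (h : g.1.root p = g.1.root (g.1.inv p)) : g.contr2 p q = 0 :=
  dif_neg fun h' => h'.1 h

theorem contr2_eq_zero_of_eq (g : LGraph O) (p q : g.1.H)
    (h : ¬(q ≠ p ∧ q ≠ g.1.inv p)) : g.contr2 p q = 0 :=
  dif_neg fun h' => h h'.2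

theorem contr2_eq_zero_of_loop' (g : LGraph O) (p q : g.1.H)
    (h : ∀ hp : g.1.root p ≠ g.1.root (g.1.inv p),
      g.contractVertex p hp (g.1.root q) = g.contractVertex p hp (g.1.root (g.1.inv q))) :
    g.contr2 p q = 0 := by
  by_cases h1 : g.1.root p = g.1.root (g.1.inv p)
  · exact g.contr2_eq_zero_of_loop p q h1
  by_cases h2 : q ≠ p ∧ q ≠ g.1.inv p
  · have h3 : (g.contract p h1).contrCls ⟨q, h2⟩ = 0 :=
      contrCls_of_eq (g.contract p h1) ⟨q, h2⟩ (h h1)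
    rw [g.contr2_of_ne p q h1 h2, h3, smul_zero]
  · exact g.contr2_eq_zero_of_eq p q h2

theorem contr2_inv_right (g : LGraph O) (p q : g.1.H) :
    g.contr2 p (g.1.inv q) = -g.contr2 p q := by
  by_cases h1 : g.1.root p = g.1.root (g.1.inv p)
  · rw [g.contr2_eq_zero_of_loop p _ h1, g.contr2_eq_zero_of_loop p _ h1, neg_zero]
  have h3 : (g.1.inv q ≠ p ∧ g.1.inv q ≠ g.1.inv p) ↔ (q ≠ p ∧ q ≠ g.1.inv p) := by
    rw [g.1.inv.injective.ne_iff, and_comm]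
    refine and_congr Iff.rfl (not_congr ⟨?_, ?_⟩)
    · rintro rfl; rw [g.1.inv_inv]
    · rintro rfl; rw [g.1.inv_inv]
  by_cases h2 : q ≠ p ∧ q ≠ g.1.inv p
  · rw [g.contr2_of_ne p q h1 h2, g.contr2_of_ne p _ h1 (h3.2 h2), ← smul_neg]
    exact congrArg _ (contrCls_inv (g.contract p h1) ⟨q, h2⟩)
  · rw [g.contr2_eq_zero_of_eq p _ h2, g.contr2_eq_zero_of_eq p _ (fun h => h2 (h3.1 h)), neg_zero]

theorem contr2_inv_left (g : LGraph O) (p q : g.1.H) :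
    g.contr2 (g.1.inv p) q = -g.contr2 p q := by
  by_cases h1 : g.1.root p = g.1.root (g.1.inv p)
  · rw [g.contr2_eq_zero_of_loop p _ h1, g.contr2_eq_zero_of_loop, neg_zero]
    rw [g.1.inv_inv, h1]
  by_cases h2 : q ≠ p ∧ q ≠ g.1.inv p
  · rw [g.contr2_of_ne p q h1 h2, g.contr2_of_ne _ q (g.root_inv_ne p h1)
      ⟨h2.2, by rw [g.1.inv_inv]; exact h2.1⟩]
    rw [(g.contractReverse p h1).contrCls_eq (g.contractReverse_surjective p h1) ⟨q, h2⟩ rfl,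
      smul_smul, ← pow_add, neg_one_pow_congr (g.contractReverse_parity p h1), pow_succ,
      mul_neg_one, neg_smul, neg_neg]
    rfl
  · rw [g.contr2_eq_zero_of_eq p _ h2, g.contr2_eq_zero_of_eq, neg_zero]
    rw [g.1.inv_inv]
    exact fun h => h2 h.symm

section Swap

variable (g : LGraph O) (p q : g.1.H) (hp : g.1.root p ≠ g.1.root (g.1.inv p))
  (hpq : q ≠ p ∧ q ≠ g.1.inv p)

theorem contract_root_of_ne (a : (g.contract p hp).1.H)
    (h : g.1.root a.1 ≠ g.1.root (g.1.inv p)) :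
    ((g.contract p hp).1.root a).1 = g.1.root a.1 :=
  congrArg Subtype.val (g.contractVertex_of_ne p hp h)

theorem contract_root_of_eq (a : (g.contract p hp).1.H)
    (h : g.1.root a.1 = g.1.root (g.1.inv p)) :
    ((g.contract p hp).1.root a).1 = g.1.root p :=
  congrArg Subtype.val (g.contractVertex_of_eq p hp h)

/-- The second contraction. -/
abbrev contractPair (hq' : (g.contract p hp).1.root ⟨q, hpq⟩ ≠
    (g.contract p hp).1.root ((g.contract p hp).1.inv ⟨q, hpq⟩)) : LGraph O :=
  (g.contract p hp).contract ⟨q, hpq⟩ hq'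

theorem contractPair_label_disjoint (hq' : (g.contract p hp).1.root ⟨q, hpq⟩ ≠
    (g.contract p hp).1.root ((g.contract p hp).1.inv ⟨q, hpq⟩))
    (z : (g.contractPair p q hp hpq hq').1.V) (hz : z.1.1 ≠ g.1.root p)
    (hz' : z.1 ≠ (g.contract p hp).1.root ⟨q, hpq⟩) :
    O.Same (fun a : g.1.Flags z.1.1 => a.1)
      (fun a : (g.contractPair p q hp hpq hq').1.Flags z => a.1.1.1) (g.2 z.1.1)
      ((g.contractPair p q hp hpq hq').2 z) :=
  (g.contract_label_other p hp z.1 hz).trans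
    (((g.contract p hp).contract_label_other ⟨q, hpq⟩ hq' z hz').postcomp Subtype.val)

theorem contractPair_label_first (hq' : (g.contract p hp).1.root ⟨q, hpq⟩ ≠
    (g.contract p hp).1.root ((g.contract p hp).1.inv ⟨q, hpq⟩))
    (z : (g.contractPair p q hp hpq hq').1.V) (hz : z.1.1 = g.1.root p)
    (hz' : z.1 ≠ (g.contract p hp).1.root ⟨q, hpq⟩) {x y : g.1.V} (hx : g.1.root p = x)
    (hy : g.1.root (g.1.inv p) = y) :
    O.Same (CyclicOperad.marks ⟨p, hx⟩ ⟨g.1.inv p, hy⟩ (fun a : g.1.Flags x => a.1)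
        (fun a : g.1.Flags y => a.1))
      (fun a : (g.contractPair p q hp hpq hq').1.Flags z => a.1.1.1)
      (O.comp ⟨p, hx⟩ ⟨g.1.inv p, hy⟩ (g.2 x) (g.2 y))
      ((g.contractPair p q hp hpq hq').2 z) :=
  (g.contract_label_merged p hp z.1 hz hx hy).trans
    (((g.contract p hp).contract_label_other ⟨q, hpq⟩ hq' z hz').postcomp Subtype.val)

theorem contractPair_label_second (hq' : (g.contract p hp).1.root ⟨q, hpq⟩ ≠
    (g.contract p hp).1.root ((g.contract p hp).1.inv ⟨q, hpq⟩))
    (z : (g.contractPair p q hp hpq hq').1.V)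
    (hz : z.1 = (g.contract p hp).1.root ⟨q, hpq⟩) {x y : (g.contract p hp).1.V}
    (hx : (g.contract p hp).1.root ⟨q, hpq⟩ = x)
    (hy : (g.contract p hp).1.root ((g.contract p hp).1.inv ⟨q, hpq⟩) = y) :
    O.Same (CyclicOperad.marks ⟨⟨q, hpq⟩, hx⟩ ⟨(g.contract p hp).1.inv ⟨q, hpq⟩, hy⟩
        (fun a : (g.contract p hp).1.Flags x => a.1.1)
        (fun a : (g.contract p hp).1.Flags y => a.1.1))
      (fun a : (g.contractPair p q hp hpq hq').1.Flags z => a.1.1.1)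
      (O.comp ⟨⟨q, hpq⟩, hx⟩ ⟨(g.contract p hp).1.inv ⟨q, hpq⟩, hy⟩
        ((g.contract p hp).2 x) ((g.contract p hp).2 y))
      ((g.contractPair p q hp hpq hq').2 z) := by
  refine (((g.contract p hp).contract_label_merged ⟨q, hpq⟩ hq' z hz hx hy).postcomp
    Subtype.val).congr_fun ?_ fun _ => rfl
  rintro (a | a) <;> rfl

end Swap

/-- Two edges that are neither loops nor parallel, directed such that `q` does not end at `p` and
starts at most at the end of `p`. -/
structure Swappable (g : LGraph O) (p q : g.1.H) : Prop where
  hp : g.1.root p ≠ g.1.root (g.1.inv p)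
  hq : g.1.root q ≠ g.1.root (g.1.inv q)
  hpq : q ≠ p ∧ q ≠ g.1.inv p
  hqp : p ≠ q ∧ p ≠ g.1.inv q
  h1 : g.1.root (g.1.inv q) ≠ g.1.root p
  h2 : g.1.root (g.1.inv q) ≠ g.1.root (g.1.inv p)
  h3 : g.1.root q = g.1.root (g.1.inv p) ∨
    (g.1.root q ≠ g.1.root p ∧ g.1.root q ≠ g.1.root (g.1.inv p))

namespace Swappable

variable {g : LGraph O} {p q : g.1.H}

theorem ne_left (S : g.Swappable p q) : (g.contract p S.hp).1.root ⟨q, S.hpq⟩ ≠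
    (g.contract p S.hp).1.root ((g.contract p S.hp).1.inv ⟨q, S.hpq⟩) := by
  intro e
  have e' := (g.contractVertex_eq_iff p S.hp).1 e
  rcases e' with e' | ⟨_, e'⟩ | ⟨_, e'⟩
  · exact S.hq e'
  · exact S.h2 e'
  · exact S.h1 e'

theorem ne_right (S : g.Swappable p q) : (g.contract q S.hq).1.root ⟨p, S.hqp⟩ ≠
    (g.contract q S.hq).1.root ((g.contract q S.hq).1.inv ⟨p, S.hqp⟩) := by
  intro e
  have e' := (g.contractVertex_eq_iff q S.hq).1 e
  rcases e' with e' | ⟨_, e'⟩ | ⟨e', _⟩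
  · exact S.hp e'
  · exact S.h2 e'.symm
  · exact S.h1 e'.symm

theorem root_left_end (S : g.Swappable p q) :
    ((g.contract p S.hp).1.root ((g.contract p S.hp).1.inv ⟨q, S.hpq⟩)).1 =
      g.1.root (g.1.inv q) :=
  g.contract_root_of_ne p S.hp _ S.h2

theorem root_right_start (S : g.Swappable p q) :
    ((g.contract q S.hq).1.root ⟨p, S.hqp⟩).1 = g.1.root p :=
  g.contract_root_of_ne q S.hq ⟨p, S.hqp⟩ S.h1.symm

theorem root_right_end (S : g.Swappable p q) :
    ((g.contract q S.hq).1.root ((g.contract q S.hq).1.inv ⟨p, S.hqp⟩)).1 =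
      g.1.root (g.1.inv p) :=
  g.contract_root_of_ne q S.hq _ S.h2.symm

/-- The image of a vertex under both contractions. -/
def vertex (S : g.Swappable p q) (x : g.1.V) : (g.contractPair q p S.hq S.hqp S.ne_right).1.V :=
  (g.contract q S.hq).contractVertex ⟨p, S.hqp⟩ S.ne_right (g.contractVertex q S.hq x)

theorem vertex_left (S : g.Swappable p q) (x : g.1.V) :
    S.vertex (g.contractVertex p S.hp x).1 = S.vertex x := by
  by_cases h : x = g.1.root (g.1.inv p)
  · rw [g.contractVertex_of_eq p S.hp h, h]
    exact ((g.contract q S.hq).contractVertex_eq_iff ⟨p, S.hqp⟩ S.ne_right).2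
      (Or.inr (Or.inl ⟨rfl, rfl⟩))
  · rw [g.contractVertex_of_ne p S.hp h]

theorem vertex_val (S : g.Swappable p q) (x : (g.contract p S.hp).1.V)
    (h : x.1 ≠ g.1.root (g.1.inv q)) : (S.vertex x.1).1.1 = x.1 := by
  unfold vertex
  rw [g.contractVertex_of_ne q S.hq h]
  refine congrArg (fun z => z.1.1)
    ((g.contract q S.hq).contractVertex_of_ne ⟨p, S.hqp⟩ S.ne_right (x := ⟨x.1, h⟩) ?_)
  intro e
  exact x.2 ((congrArg Subtype.val e).trans S.root_right_end)

/-- If `q` starts where `p` ends, the vertex merged by `p` is an end of `q` and `hx` excludes it. So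
a vertex merged by `p` occurs here only when the two edges are disjoint. -/
theorem label_other (S : g.Swappable p q) (x : (g.contract p S.hp).1.V)
    (hx : x ≠ (g.contract p S.hp).1.root ⟨q, S.hpq⟩)
    (hx' : x ≠ (g.contract p S.hp).1.root ((g.contract p S.hp).1.inv ⟨q, S.hpq⟩)) :
    O.Same (fun a : (g.contract p S.hp).1.Flags x => a.1.1)
      (fun a : (g.contractPair q p S.hq S.hqp S.ne_right).1.Flags (S.vertex x.1) => a.1.1.1)
      ((g.contract p S.hp).2 x)
      ((g.contractPair q p S.hq S.hqp S.ne_right).2 (S.vertex x.1)) := by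
  have h1 : x.1 ≠ g.1.root (g.1.inv q) := fun e => hx' (Subtype.ext (e.trans S.root_left_end.symm))
  have h2 := S.vertex_val x h1
  by_cases hxp : x.1 = g.1.root p
  · have h3 : g.1.root q ≠ g.1.root p := by
      rcases S.h3 with h | h
      · exact fun _ => hx (Subtype.ext (hxp.trans (g.contract_root_of_eq p S.hp ⟨q, S.hpq⟩ h).symm))
      · exact h.1
    have h4 : g.1.root q ≠ g.1.root (g.1.inv p) := by
      rcases S.h3 with h | h
      · exact fun _ => hx (Subtype.ext (hxp.trans (g.contract_root_of_eq p S.hp ⟨q, S.hpq⟩ h).symm))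
      · exact h.2
    refine (g.contract_label_merged p S.hp x hxp S.root_right_start.symm
      S.root_right_end.symm).symm.trans ?_
    refine CyclicOperad.Same.trans ?_ (g.contractPair_label_second q p S.hq S.hqp S.ne_right
      (S.vertex x.1) (Subtype.ext ?_) rfl rfl)
    · refine CyclicOperad.Same.comp (g.contract_label_other q S.hq _ ?_)
        (g.contract_label_other q S.hq _ ?_)
        (Subtype.val_injective.comp Subtype.val_injective)
        (Subtype.val_injective.comp Subtype.val_injective) rfl rfl
      · rw [S.root_right_start]; exact h3.symm
      · rw [S.root_right_end]; exact h4.symm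
    · rw [h2, S.root_right_start, hxp]
  · refine (g.contract_label_other p S.hp x hxp).symm.trans ?_
    have h5 : x.1 ≠ g.1.root q := by
      intro e
      rcases S.h3 with h | h
      · exact x.2 (e.trans h)
      · exact hx (Subtype.ext (e.trans (g.contract_root_of_ne p S.hp ⟨q, S.hpq⟩ h.2).symm))
    have h6 := g.contractPair_label_disjoint q p S.hq S.hqp S.ne_right (S.vertex x.1)
      (by rw [h2]; exact h5)
      (fun e => hxp (by rw [← h2, e, S.root_right_start]))
    rw [h2] at h6
    exact h6

/-- If the edges form a path, the two orders of contraction are the two bracketings of a threefold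
composite, and `comp_assoc` applies. If they are disjoint, the contractions do not interact. -/
theorem label_merged (S : g.Swappable p q) :
    O.Same (CyclicOperad.marks ⟨⟨q, S.hpq⟩, rfl⟩ ⟨(g.contract p S.hp).1.inv ⟨q, S.hpq⟩, rfl⟩
        (fun a : (g.contract p S.hp).1.Flags ((g.contract p S.hp).1.root ⟨q, S.hpq⟩) => a.1.1)
        (fun a : (g.contract p S.hp).1.Flags ((g.contract p S.hp).1.root
          ((g.contract p S.hp).1.inv ⟨q, S.hpq⟩)) => a.1.1))
      (fun a : (g.contractPair q p S.hq S.hqp S.ne_right).1.Flags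
        (S.vertex ((g.contract p S.hp).1.root ⟨q, S.hpq⟩).1) => a.1.1.1)
      (O.comp ⟨⟨q, S.hpq⟩, rfl⟩ ⟨(g.contract p S.hp).1.inv ⟨q, S.hpq⟩, rfl⟩
        ((g.contract p S.hp).2 ((g.contract p S.hp).1.root ⟨q, S.hpq⟩))
        ((g.contract p S.hp).2 ((g.contract p S.hp).1.root
          ((g.contract p S.hp).1.inv ⟨q, S.hpq⟩))))
      ((g.contractPair q p S.hq S.hqp S.ne_right).2
        (S.vertex ((g.contract p S.hp).1.root ⟨q, S.hpq⟩).1)) := by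
  have hinj {g : LGraph O} {p : g.1.H} (hp : g.1.root p ≠ g.1.root (g.1.inv p))
      (x : (g.contract p hp).1.V) :
      Function.Injective fun a : (g.contract p hp).1.Flags x => a.1.1 :=
    Subtype.val_injective.comp Subtype.val_injective
  have hend : ((g.contract p S.hp).1.root ((g.contract p S.hp).1.inv ⟨q, S.hpq⟩)).1 ≠
      g.1.root p := by
    rw [S.root_left_end]; exact S.h1
  rcases S.h3 with h | ⟨h, h'⟩
  · have e1 := g.contract_root_of_eq p S.hp ⟨q, S.hpq⟩ h
    have e2 : g.1.root p ≠ g.1.root (g.1.inv q) := S.h1.symm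
    have e3 := S.vertex_val ((g.contract p S.hp).1.root ⟨q, S.hpq⟩) (by rw [e1]; exact e2)
    have hne : (⟨q, h⟩ : g.1.Flags (g.1.root (g.1.inv p))) ≠ ⟨g.1.inv p, rfl⟩ :=
      fun e => S.hpq.2 (congrArg Subtype.val e)
    have H1 := CyclicOperad.Same.comp
      (g.contract_label_merged p S.hp _ e1 S.root_right_start.symm rfl)
      (g.contract_label_other p S.hp _ hend) (hinj S.hp _) (hinj S.hp _)
      (x := Sum.inr ⟨⟨q, h⟩, hne⟩) (y := ⟨g.1.inv q, S.root_left_end.symm⟩)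
      (x' := ⟨⟨q, S.hpq⟩, rfl⟩) (y' := ⟨(g.contract p S.hp).1.inv ⟨q, S.hpq⟩, rfl⟩) rfl rfl
    have H2 := CyclicOperad.Same.comp
      (g.contract_label_other q S.hq ((g.contract q S.hq).1.root ⟨p, S.hqp⟩) (by
        rw [S.root_right_start, h]; exact S.hp))
      (g.contract_label_merged q S.hq
        ((g.contract q S.hq).1.root ((g.contract q S.hq).1.inv ⟨p, S.hqp⟩))
        (by rw [S.root_right_end, h]) h S.root_left_end.symm) (hinj S.hq _) (hinj S.hq _)
      (x := ⟨p, S.root_right_start.symm⟩) (y := Sum.inl ⟨⟨g.1.inv p, rfl⟩, hne.symm⟩)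
      (x' := ⟨⟨p, S.hqp⟩, rfl⟩) (y' := ⟨(g.contract q S.hq).1.inv ⟨p, S.hqp⟩, rfl⟩) rfl rfl
    refine H1.symm.trans ((CyclicOperad.Same.comp_assoc _ _ _ _ _ _ _ hne _ _ _).trans
      (H2.trans ?_))
    refine g.contractPair_label_second q p S.hq S.hqp S.ne_right _ (Subtype.ext ?_) rfl rfl
    rw [e3, e1, S.root_right_start]
  · have e1 := g.contract_root_of_ne p S.hp ⟨q, S.hpq⟩ h'
    have e3 := S.vertex_val ((g.contract p S.hp).1.root ⟨q, S.hpq⟩) (by rw [e1]; exact S.hq)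
    have H1 := CyclicOperad.Same.comp
      (g.contract_label_other p S.hp ((g.contract p S.hp).1.root ⟨q, S.hpq⟩) (by rw [e1]; exact h))
      (g.contract_label_other p S.hp _ hend) (hinj S.hp _) (hinj S.hp _)
      (x := ⟨q, e1.symm⟩) (y := ⟨g.1.inv q, S.root_left_end.symm⟩)
      (x' := ⟨⟨q, S.hpq⟩, rfl⟩) (y' := ⟨(g.contract p S.hp).1.inv ⟨q, S.hpq⟩, rfl⟩) rfl rfl
    refine H1.symm.trans (g.contractPair_label_first q p S.hq S.hqp S.ne_right _ ?_ ?_ _ _)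
    · rw [e3, e1]
    · intro e
      have e4 := congrArg Subtype.val e
      rw [e3, e1, S.root_right_start] at e4
      exact h e4

/-- The two orders of contracting two edges give the same graph. -/
def swap (S : g.Swappable p q) : Emb (g.contractPair p q S.hp S.hpq S.ne_left)
    (g.contractPair q p S.hq S.hqp S.ne_right) :=
  (g.contract p S.hp).contractLift ⟨q, S.hpq⟩ S.ne_left (W := g.1.H) (fun a => a.1.1)
    (Subtype.val_injective.comp Subtype.val_injective) (fun x => S.vertex x.1)
    (by
      refine (S.vertex_left _).trans (Eq.trans ?_ (S.vertex_left _).symm)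
      exact congrArg ((g.contract q S.hq).contractVertex ⟨p, S.hqp⟩ S.ne_right)
        ((g.contractVertex_eq_iff q S.hq).2 (Or.inr (Or.inr ⟨rfl, rfl⟩))))
    (by
      intro x x' hx hx' e
      have h {x : (g.contract p S.hp).1.V}
          (hx : x ≠ (g.contract p S.hp).1.root ((g.contract p S.hp).1.inv ⟨q, S.hpq⟩)) :
          x.1 ≠ g.1.root (g.1.inv q) :=
        fun e => hx (Subtype.ext (e.trans S.root_left_end.symm))
      have e' := congrArg (fun z => z.1.1) e
      have e'' : x.1 = x'.1 := (S.vertex_val x (h hx)).symm.trans (e'.trans (S.vertex_val x' (h hx')))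
      exact Subtype.ext e'')
    (fun a => ⟨⟨a.1.1, fun e => a.2.1 (Subtype.ext e), fun e => a.2.2 (Subtype.ext e)⟩,
      fun e => a.1.2.1 (congrArg Subtype.val e), fun e => a.1.2.2 (congrArg Subtype.val e)⟩)
    (fun a b e => by
      have h : a.1.1 = b.1.1 := congrArg (fun c => c.1.1) e
      exact Subtype.ext (Subtype.ext h))
    (fun a => a.1) (fun _ => rfl)
    (fun a => (S.vertex_left (g.1.root a.1.1)).symm) (fun _ => rfl)
    (fun a _ _ => ⟨⟨⟨a.1.1, fun e => a.2.1 (Subtype.ext e), fun e => a.2.2 (Subtype.ext e)⟩,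
      fun e => a.1.2.1 (congrArg Subtype.val e), fun e => a.1.2.2 (congrArg Subtype.val e)⟩, rfl⟩)
    S.label_other rfl rfl S.label_merged

theorem swap_v (S : g.Swappable p q) (x : (g.contractPair p q S.hp S.hpq S.ne_left).1.V) :
    (S.swap.v x).1.1 = x.1.1 :=
  S.vertex_val x.1 fun e => x.2 (Subtype.ext (e.trans S.root_left_end.symm))

theorem swap_strict (S : g.Swappable p q) : S.swap.Strict where
  mono x y h := by
    change (S.swap.v x).1.1 < (S.swap.v y).1.1
    rw [swap_v, swap_v]
    exact h
  tail _ := rfl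

theorem swap_surjective (S : g.Swappable p q) : S.swap.v.Surjective := by
  intro z
  have h1 : z.1.1 ≠ g.1.root (g.1.inv p) := fun e =>
    z.2 (Subtype.ext (e.trans S.root_right_end.symm))
  refine ⟨⟨⟨z.1.1, h1⟩, fun e => z.1.2 ((congrArg Subtype.val e).trans S.root_left_end)⟩,
    Subtype.ext (Subtype.ext ?_)⟩
  exact S.swap_v _

end Swappable

/-- Contracting `p` removes the vertex at its end, which shifts the position of the end of `q`
precisely when it lies before it. -/
theorem contractParity_contract (g : LGraph O) (p q : g.1.H)
    (hp : g.1.root p ≠ g.1.root (g.1.inv p)) (hpq : q ≠ p ∧ q ≠ g.1.inv p)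
    (h : g.1.root (g.1.inv q) ≠ g.1.root (g.1.inv p)) :
    (g.contract p hp).1.contractParity ⟨q, hpq⟩ +
      (if g.1.root (g.1.inv p) < g.1.root (g.1.inv q) then 1 else 0) = g.1.contractParity q := by
  have e : ((g.contract p hp).1.root ((g.contract p hp).1.inv ⟨q, hpq⟩)).1 =
    g.1.root (g.1.inv q) := g.contract_root_of_ne p hp _ h
  have e1 : (g.contract p hp).1.contractParity ⟨q, hpq⟩ =
      Nat.card {x : g.1.V // x ≠ g.1.root (g.1.inv p) ∧ x < g.1.root (g.1.inv q)} + 1 := by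
    unfold OGraph.contractParity
    congr 1
    refine Nat.card_congr ⟨fun x => ⟨x.1.1, x.1.2, ?_⟩, fun x => ⟨⟨x.1, x.2.1⟩, ?_⟩,
      fun _ => rfl, fun _ => rfl⟩
    · rw [← e]; exact x.2
    · change x.1 < _
      rw [e]; exact x.2.2
  rw [e1]
  unfold OGraph.contractParity
  rw [add_right_comm]
  congr 1
  have h1 : (if g.1.root (g.1.inv p) < g.1.root (g.1.inv q) then 1 else 0) =
      ∑ x : g.1.V, if x = g.1.root (g.1.inv p) then
        (if g.1.root (g.1.inv p) < g.1.root (g.1.inv q) then 1 else 0) else 0 := by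
    simp
  rw [h1]
  simp only [natCard_subtype_eq_sum]
  rw [← Finset.sum_add_distrib]
  refine Finset.sum_congr rfl fun x _ => ?_
  by_cases hx : x = g.1.root (g.1.inv p)
  · subst hx; simp
  · simp [hx]

/-- Of the two removed vertices exactly one precedes the other, so exactly one of the two orders of
contraction has its exponent lowered by one. -/
theorem Swappable.contr2_eq {g : LGraph O} {p q : g.1.H} (S : g.Swappable p q) :
    g.contr2 p q = -g.contr2 q p := by
  rw [g.contr2_of_ne p q S.hp S.hpq, g.contr2_of_ne q p S.hq S.hqp,
    contrCls_of_ne (g.contract p S.hp) ⟨q, S.hpq⟩ S.ne_left,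
    contrCls_of_ne (g.contract q S.hq) ⟨p, S.hqp⟩ S.ne_right, smul_smul, smul_smul, ← pow_add,
    ← pow_add, S.swap_strict.cls_eq S.swap_surjective, ← neg_smul]
  have h0 (n : ℕ) : -(-1 : k) ^ n = (-1) ^ (n + 1) := by rw [pow_succ, mul_neg_one]
  rw [h0]
  congr 1
  refine neg_one_pow_congr ?_
  have e1 := g.contractParity_contract p q S.hp S.hpq S.h2
  have e2 := g.contractParity_contract q p S.hq S.hqp S.h2.symm
  rcases lt_or_gt_of_ne S.h2 with h | h
  · rw [if_neg h.asymm] at e1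
    rw [if_pos h] at e2
    omega
  · rw [if_pos h] at e1
    rw [if_neg h.asymm] at e2
    omega

/-- Contracting two edges in the opposite order changes the sign. -/
theorem contr2_swap (g : LGraph O) (p q : g.1.H) : g.contr2 p q = -g.contr2 q p := by
  by_cases hpq : q ≠ p ∧ q ≠ g.1.inv p
  swap
  · rw [contr2_eq_zero_of_eq g p q hpq, contr2_eq_zero_of_eq g q p, neg_zero]
    rintro ⟨h1, h2⟩
    exact hpq ⟨h1.symm, fun e => h2 (by rw [e, g.1.inv_inv])⟩
  by_cases hp : g.1.root p = g.1.root (g.1.inv p)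
  · rw [contr2_eq_zero_of_loop g p q hp, contr2_eq_zero_of_loop' g q p fun hq => by rw [hp], neg_zero]
  by_cases hq : g.1.root q = g.1.root (g.1.inv q)
  · rw [contr2_eq_zero_of_loop g q p hq, contr2_eq_zero_of_loop' g p q fun hq' => by rw [hq], neg_zero]
  -- Reversing an edge negates both sides, so directions may be chosen. Here the end of `q` is off
  -- `p`; if both edges start at the same vertex, reversing `p` turns them into a path.
  have main (p q : g.1.H) (hpq : q ≠ p ∧ q ≠ g.1.inv p)
      (hp : g.1.root p ≠ g.1.root (g.1.inv p)) (hq : g.1.root q ≠ g.1.root (g.1.inv q))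
      (h1 : g.1.root (g.1.inv q) ≠ g.1.root p) (h2 : g.1.root (g.1.inv q) ≠ g.1.root (g.1.inv p)) :
      g.contr2 p q = -g.contr2 q p := by
    have hqp : p ≠ q ∧ p ≠ g.1.inv q :=
      ⟨hpq.1.symm, fun e => hpq.2 (by rw [e, g.1.inv_inv])⟩
    by_cases h3 : g.1.root q = g.1.root p
    · have := (⟨g.root_inv_ne p hp, hq, ⟨hpq.2, by rw [g.1.inv_inv]; exact hpq.1⟩,
        ⟨hpq.2.symm, fun e => hpq.1 (g.1.inv.injective e.symm)⟩, h2,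
        by rw [g.1.inv_inv]; exact h1, Or.inl (by rw [g.1.inv_inv]; exact h3)⟩ :
        g.Swappable (g.1.inv p) q).contr2_eq
      rw [contr2_inv_left, contr2_inv_right, neg_inj] at this
      exact this
    · refine (⟨hp, hq, hpq, hqp, h1, h2, ?_⟩ : g.Swappable p q).contr2_eq
      by_cases h4 : g.1.root q = g.1.root (g.1.inv p)
      · exact Or.inl h4
      · exact Or.inr ⟨h3, h4⟩
  by_cases h1 : g.1.root (g.1.inv q) = g.1.root p ∨ g.1.root (g.1.inv q) = g.1.root (g.1.inv p)
  swap
  · rw [not_or] at h1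
    exact main p q hpq hp hq h1.1 h1.2
  by_cases h2 : g.1.root q = g.1.root p ∨ g.1.root q = g.1.root (g.1.inv p)
  -- Parallel edges: contracting either one turns the other into a loop, so both sides vanish.
  · have hz {p q : g.1.H} (hq : g.1.root q ≠ g.1.root (g.1.inv q))
        (h1 : g.1.root (g.1.inv q) = g.1.root p ∨ g.1.root (g.1.inv q) = g.1.root (g.1.inv p))
        (h2 : g.1.root q = g.1.root p ∨ g.1.root q = g.1.root (g.1.inv p)) : g.contr2 p q = 0 := by
      refine contr2_eq_zero_of_loop' g p q fun hp => ?_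
      rw [contractVertex_eq_iff]
      rcases h1 with h1 | h1 <;> rcases h2 with h2 | h2
      · exact absurd (h2.trans h1.symm) hq
      · exact Or.inr (Or.inr ⟨h2, h1⟩)
      · exact Or.inr (Or.inl ⟨h2, h1⟩)
      · exact absurd (h2.trans h1.symm) hq
    rw [hz hq h1 h2, hz hp, neg_zero]
    · rcases h1 with h1 | h1 <;> rcases h2 with h2 | h2
      · exact absurd (h2.trans h1.symm) hq
      · exact Or.inl h2.symm
      · exact Or.inr h1.symm
      · exact absurd (h2.trans h1.symm) hq
    · rcases h1 with h1 | h1 <;> rcases h2 with h2 | h2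
      · exact absurd (h2.trans h1.symm) hq
      · exact Or.inr h1.symm
      · exact Or.inl h2.symm
      · exact absurd (h2.trans h1.symm) hq
  · rw [not_or] at h2
    have := main p (g.1.inv q) ⟨fun e => hpq.2 (by rw [← e, g.1.inv_inv]),
      fun e => hpq.1 (g.1.inv.injective e)⟩ hp (g.root_inv_ne q hq)
      (by rw [g.1.inv_inv]; exact h2.1) (by rw [g.1.inv_inv]; exact h2.2)
    rw [contr2_inv_left, contr2_inv_right, neg_inj] at this
    exact this

end LGraph

/-! ## Changing the edges of a graph -/

/-- A fixed-point free involution with a direction of each of its orbits. -/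
structure Wiring (H : Type) where
  inv : Equiv.Perm H
  inv_inv (h : H) : inv (inv h) = h
  inv_ne (h : H) : inv h ≠ h
  tail : H → Bool
  tail_inv (h : H) : tail (inv h) = !tail h

namespace OGraph

/-- The graph with the same vertices and half-edges but other edges. -/
def rewire (Γ : OGraph) (w : Wiring Γ.H) : OGraph where
  V := Γ.V
  H := Γ.H
  root := Γ.root
  inv := w.inv
  inv_inv := w.inv_inv
  inv_ne := w.inv_ne
  tail := w.tail
  tail_inv := w.tail_inv
  valence := Γ.valence

/-- The edges of the glued graph. -/
def EdgeTuple.wiring {Γ : OGraph} {n : ℕ} (d : Γ.EdgeTuple n) : Wiring Γ.H :=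
  ⟨(Γ.glue d).inv, (Γ.glue d).inv_inv, (Γ.glue d).inv_ne, (Γ.glue d).tail, (Γ.glue d).tail_inv⟩

namespace EdgeTuple

variable {Γ Γ' : OGraph} {n : ℕ} (ι : Γ'.H → Γ.H) (hι : ι.Injective)
  (hinv : ∀ a, Γ.inv (ι a) = ι (Γ'.inv a)) (d : Γ.EdgeTuple n) (d' : Γ'.EdgeTuple n)
  (hd : ∀ m, d.1 m = ι (d'.1 m))

theorem cycle_comm (hι : ι.Injective) (hd : ∀ m, d.1 m = ι (d'.1 m)) (a : Γ'.H) :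
    d.cycle (ι a) = ι (d'.cycle a) := by
  by_cases e : ∃ m, d'.1 m = a
  · obtain ⟨m, rfl⟩ := e
    rw [d'.cycle_apply, ← hd, ← hd, d.cycle_apply]
  · rw [d'.cycle_apply_of_notMem (fun m hm => e ⟨m, hm⟩),
      d.cycle_apply_of_notMem (fun m hm => e ⟨m, hι (by rw [← hd, hm])⟩)]

theorem glue_inv_comm (hι : ι.Injective) (hinv : ∀ a, Γ.inv (ι a) = ι (Γ'.inv a))
    (hd : ∀ m, d.1 m = ι (d'.1 m)) (a : Γ'.H) :
    (Γ.glue d).inv (ι a) = ι ((Γ'.glue d').inv a) := by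
  have h : d.cycle.symm (ι a) = ι (d'.cycle.symm a) := by
    rw [Equiv.symm_apply_eq, cycle_comm ι d d' hι hd, Equiv.apply_symm_apply]
  rw [glue_inv, glue_inv, h, hinv, cycle_comm ι d d' hι hd]

theorem tail_comm (hι : ι.Injective) (hinv : ∀ a, Γ.inv (ι a) = ι (Γ'.inv a))
    (hd : ∀ m, d.1 m = ι (d'.1 m)) (ht : ∀ a, Γ.tail (ι a) = Γ'.tail a) (a : Γ'.H) :
    d.tail (ι a) = d'.tail a := by
  unfold tail
  have e1 : (∃ m, d.1 m = ι a) ↔ ∃ m, d'.1 m = a :=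
    exists_congr fun m => by rw [hd, hι.eq_iff]
  have e2 : (∃ m, Γ.inv (d.1 m) = ι a) ↔ ∃ m, Γ'.inv (d'.1 m) = a :=
    exists_congr fun m => by rw [hd, hinv, hι.eq_iff]
  simp only [e1, e2, ht]

end EdgeTuple

end OGraph

namespace LGraph

/-- The labelled graph with the same vertices and half-edges but other edges. -/
def rewire (g : LGraph O) (w : Wiring g.1.H) : LGraph O := ⟨g.1.rewire w, g.2⟩

namespace Emb

variable {g g' : LGraph O}

theorem reversals_contract_add_one (φ : Emb g g') (t : g.1.H)
    (ht : g.1.root t ≠ g.1.root (g.1.inv t)) (h : g'.1.tail (φ.h t) ≠ g.1.tail t) :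
    (φ.contract t ht).reversals + 1 = φ.reversals := by
  have h' : g'.1.tail (φ.h (g.1.inv t)) ≠ g.1.tail (g.1.inv t) := by
    rw [← φ.inv_h, g'.1.tail_inv, g.1.tail_inv]
    exact fun e => h (by simpa using e)
  have e1 : (φ.contract t ht).reversals = Nat.card {a : g.1.H // (a ≠ t ∧ a ≠ g.1.inv t) ∧
      g.1.tail a = true ∧ g'.1.tail (φ.h a) = false} :=
    Nat.card_congr ⟨fun a => ⟨a.1.1, a.1.2, a.2⟩, fun a => ⟨⟨a.1, a.2.1⟩, a.2.2⟩, fun _ => rfl,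
      fun _ => rfl⟩
  -- The lost reversal is counted at whichever half of the contracted edge is its tail in `g`.
  have e2 : 1 = ∑ a, if a = (if g.1.tail t = true then t else g.1.inv t) then 1 else 0 := by simp
  rw [e1, e2, reversals]
  simp only [natCard_subtype_eq_sum]
  rw [← Finset.sum_add_distrib]
  refine Finset.sum_congr rfl fun a _ => ?_
  have hne := g.1.inv_ne t
  by_cases h1 : a = t
  · subst h1
    cases h2 : g.1.tail a <;> cases h3 : g'.1.tail (φ.h a) <;> simp_all [hne.symm]
  by_cases h2 : a = g.1.inv t
  · subst h2
    have h4 := g.1.tail_inv t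
    cases h2 : g.1.tail t <;> cases h3 : g'.1.tail (φ.h (g.1.inv t)) <;> simp_all
  · split_ifs <;> simp_all

/-- The identity between graphs that differ only in the direction of their edges. -/
def retail (g : LGraph O) (w w' : Wiring g.1.H) (h : w.inv = w'.inv) :
    Emb (g.rewire w) (g.rewire w') where
  v := id
  v_inj := Function.injective_id
  h := id
  h_inj := Function.injective_id
  root_h _ := rfl
  inv_h a := (Equiv.congr_fun h a).symm
  surj a _ _ := ⟨a, rfl⟩
  label _ := CyclicOperad.Same.refl _ _

theorem retail_parity (g : LGraph O) (w w' : Wiring g.1.H) (h : w.inv = w'.inv) :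
    (retail g w w' h).parity = tailDiff w.tail w'.tail := by
  have : (retail g w w' h).inversions = 0 := by
    have : IsEmpty {p : (g.rewire w).1.V × (g.rewire w).1.V // p.1 < p.2 ∧
        (retail g w w' h).v p.2 < (retail g w w' h).v p.1} := ⟨fun p => p.2.1.asymm p.2.2⟩
    exact Nat.card_of_isEmpty
  rw [parity, this, zero_add]
  rfl

end Emb

/-! ### Gluing followed by a contraction -/

/-- The term of the polygon boundary given by gluing along `d` and contracting the new edge that
starts at the `p`-th half-edge of `d`. -/
def glueTerm (g : LGraph O) {n : ℕ} (d : g.1.EdgeTuple n) (p : Fin n) : GraphSpace O :=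
  (-1 : k) ^ d.flips • (g.glue d).contrCls (d.1 p)

theorem Emb.glueTerm_eq {g g' : LGraph O} (φ : Emb g g') (hv : φ.v.Surjective) {n : ℕ}
    (d : g.1.EdgeTuple n) (p : Fin n) :
    g.glueTerm d p = (-1 : k) ^ φ.parity • g'.glueTerm (φ.mapTuple d) p := by
  -- After gluing, the entry of the tuple is a tail in both graphs, whatever the directions were
  -- before.
  have h1 := (φ.glue d).contrCls_eq hv (d.1 p)
    (((φ.mapTuple d).tail_apply p).trans (d.tail_apply p).symm)
  unfold glueTerm
  rw [h1, smul_smul, smul_smul, ← pow_add, ← pow_add]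
  have h2 := φ.flips_add_reversals d
  have h3 : (φ.glue d).inversions = φ.inversions := rfl
  have h4 : (-1 : k) ^ (d.flips + (φ.glue d).parity) =
      (-1) ^ (φ.parity + (φ.mapTuple d).flips) := by
    refine neg_one_pow_congr ?_
    rw [parity, parity, h3]
    omega
  rw [h4]
  rfl

/-- The class of the polygon boundary. -/
theorem mkQ_polygonBoundary (i : ℕ+) (g : LGraph O) :
    (Submodule.span k {r | Rel O r}).mkQ (g.polygonBoundary i) =
      ∑ d : g.1.EdgeTuple i, g.glueTerm d (finRotate i ⟨0, i.pos⟩) := by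
  unfold polygonBoundary
  rw [map_sum]
  rfl

/-- A surjective embedding induces a bijection of edge tuples. -/
def Emb.tupleEquiv {g g' : LGraph O} (φ : Emb g g') (hv : φ.v.Surjective) (n : ℕ) :
    g.1.EdgeTuple n ≃ g'.1.EdgeTuple n :=
  Equiv.ofBijective φ.mapTuple ⟨fun d d' e => Subtype.ext (DFunLike.ext _ _ fun m =>
    φ.h_inj (congrArg (fun c : g'.1.EdgeTuple n => c.1 m) e)), fun d => by
    have hs := φ.h_surjective hv
    let ε : g.1.H ≃ g'.1.H := Equiv.ofBijective φ.h ⟨φ.h_inj, hs⟩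
    refine ⟨⟨d.1.trans ε.symm.toEmbedding, fun i j e => d.2 i j ?_⟩, ?_⟩
    · have := congrArg φ.h e
      rw [← φ.inv_h] at this
      have h2 : ∀ a, φ.h (ε.symm a) = a := fun a => ε.apply_symm_apply a
      simpa [h2] using this
    · exact Subtype.ext (DFunLike.ext _ _ fun m => ε.apply_symm_apply (d.1 m))⟩

theorem Emb.sum_glueTerm {g g' : LGraph O} (φ : Emb g g') (hv : φ.v.Surjective) {n : ℕ}
    (p : Fin n) : ∑ d : g.1.EdgeTuple n, g.glueTerm d p =
      (-1 : k) ^ φ.parity • ∑ d : g'.1.EdgeTuple n, g'.glueTerm d p := by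
  rw [Finset.smul_sum]
  exact Fintype.sum_equiv (φ.tupleEquiv hv n) _ _ fun d => φ.glueTerm_eq hv d p

/-! ### Multilinearity -/

/-- The labelled graph with given underlying graph and labels. -/
abbrev mk (Γ : OGraph) (o : (x : Γ.V) → O.obj (Γ.Flags x)) : LGraph O := ⟨Γ, o⟩

section Multilinear

variable (Γ : OGraph) (o : (x : Γ.V) → O.obj (Γ.Flags x)) (x : Γ.V)

theorem cls_update_add (a b : O.obj (Γ.Flags x)) :
    (mk Γ (Function.update o x (a + b))).cls =
      (mk Γ (Function.update o x a)).cls + (mk Γ (Function.update o x b)).cls := by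
  have := (Submodule.Quotient.mk_eq_zero _).2
    (Submodule.subset_span (R := k) (Rel.add (O := O) Γ o x a b))
  rw [Submodule.Quotient.mk_sub, Submodule.Quotient.mk_add, sub_eq_zero] at this
  exact this

theorem cls_update_smul (c : k) (a : O.obj (Γ.Flags x)) :
    (mk Γ (Function.update o x (c • a))).cls =
      c • (mk Γ (Function.update o x a)).cls := by
  have := (Submodule.Quotient.mk_eq_zero _).2
    (Submodule.subset_span (R := k) (Rel.smul (O := O) Γ o x c a))
  rw [Submodule.Quotient.mk_sub, Submodule.Quotient.mk_smul, sub_eq_zero] at this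
  exact this

/-- The label at `x` enters exactly one label of the contracted graph, and linearly: through
`O.comp` if `x` is an end of the edge, by relabelling otherwise. -/
theorem contract_update (t : Γ.H) (ht : Γ.root t ≠ Γ.root (Γ.inv t)) :
    ∃ (z : (Γ.contract t ht).V) (l : O.obj (Γ.Flags x) →ₗ[k] O.obj ((Γ.contract t ht).Flags z))
      (o' : (y : (Γ.contract t ht).V) → O.obj ((Γ.contract t ht).Flags y)), ∀ a,
      (mk Γ (Function.update o x a)).contract t ht =
        ⟨Γ.contract t ht, Function.update o' z (l a)⟩ := by
  have hm (o : (x : Γ.V) → O.obj (Γ.Flags x)) :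
      ((mk Γ o).contract t ht).2 ⟨Γ.root t, ht⟩ = O.map (Γ.contractFlagsMerged t ht)
      (O.comp ⟨t, rfl⟩ ⟨Γ.inv t, rfl⟩ (o (Γ.root t)) (o (Γ.root (Γ.inv t)))) := dif_pos rfl
  have ho (o : (x : Γ.V) → O.obj (Γ.Flags x)) (z : (Γ.contract t ht).V) (hz : z.1 ≠ Γ.root t) :
      ((mk Γ o).contract t ht).2 z =
        O.map (Γ.contractFlagsOther t ht z hz) (o z.1) := dif_neg hz
  have key (z : (Γ.contract t ht).V) (l : O.obj (Γ.Flags x) →ₗ[k] O.obj ((Γ.contract t ht).Flags z))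
      (h1 : ∀ a, ((mk Γ (Function.update o x a)).contract t ht).2 z = l a)
      (h2 : ∀ a y, y ≠ z → ((mk Γ (Function.update o x a)).contract t ht).2 y =
        ((mk Γ o).contract t ht).2 y) (a : O.obj (Γ.Flags x)) :
      (mk Γ (Function.update o x a)).contract t ht = ⟨Γ.contract t ht,
        Function.update ((mk Γ o).contract t ht).2 z (l a)⟩ := by
    refine congrArg (Sigma.mk (Γ.contract t ht)) (funext fun y => ?_)
    by_cases h : y = z
    · subst h
      exact (h1 a).trans (Function.update_self y (l a) ((mk Γ o).contract t ht).2).symm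
    · exact (h2 a y h).trans (Function.update_of_ne h _ _).symm
  by_cases hx : x = Γ.root t
  · subst hx
    refine ⟨⟨Γ.root t, ht⟩, O.map (Γ.contractFlagsMerged t ht) ∘ₗ
      (O.comp (⟨t, rfl⟩ : Γ.Flags (Γ.root t)) (⟨Γ.inv t, rfl⟩ : Γ.Flags (Γ.root (Γ.inv t)))).flip
        (o (Γ.root (Γ.inv t))), _, key _ _ ?_ ?_⟩
    · intro a
      rw [hm, Function.update_self, Function.update_of_ne ht.symm]
      rfl
    · intro a y hy
      have : y.1 ≠ Γ.root t := fun e => hy (Subtype.ext e)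
      rw [ho _ y this, ho _ y this, Function.update_of_ne this]
  by_cases hx' : x = Γ.root (Γ.inv t)
  · subst hx'
    refine ⟨⟨Γ.root t, ht⟩, O.map (Γ.contractFlagsMerged t ht) ∘ₗ
      O.comp (⟨t, rfl⟩ : Γ.Flags (Γ.root t)) (⟨Γ.inv t, rfl⟩ : Γ.Flags (Γ.root (Γ.inv t)))
        (o (Γ.root t)), _, key _ _ ?_ ?_⟩
    · intro a
      rw [hm, Function.update_self, Function.update_of_ne ht]
      rfl
    · intro a y hy
      have : y.1 ≠ Γ.root t := fun e => hy (Subtype.ext e)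
      rw [ho _ y this, ho _ y this, Function.update_of_ne y.2]
  · refine ⟨⟨x, hx'⟩, O.map (Γ.contractFlagsOther t ht ⟨x, hx'⟩ hx), _, key _ _ ?_ ?_⟩
    · intro a
      rw [ho _ ⟨x, hx'⟩ hx, Function.update_self]
      rfl
    · intro a y hy
      by_cases h : y.1 = Γ.root t
      · obtain rfl : y = ⟨Γ.root t, ht⟩ := Subtype.ext h
        rw [hm, hm, Function.update_of_ne (Ne.symm hx), Function.update_of_ne (Ne.symm hx')]
      · rw [ho _ y h, ho _ y h, Function.update_of_ne fun e => hy (Subtype.ext e)]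

theorem contrCls_update_add (t : Γ.H) (a b : O.obj (Γ.Flags x)) :
    (mk Γ (Function.update o x (a + b))).contrCls t =
      (mk Γ (Function.update o x a)).contrCls t +
        (mk Γ (Function.update o x b)).contrCls t := by
  by_cases ht : Γ.root t = Γ.root (Γ.inv t)
  · rw [contrCls_of_eq (mk Γ _) t ht, contrCls_of_eq (mk Γ _) t ht, contrCls_of_eq (mk Γ _) t ht,
      add_zero]
  · obtain ⟨z, l, o', h⟩ := contract_update Γ o x t ht
    rw [contrCls_of_ne (mk Γ _) t ht, contrCls_of_ne (mk Γ _) t ht, contrCls_of_ne (mk Γ _) t ht,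
      h, h, h, map_add, cls_update_add, smul_add]

theorem contrCls_update_smul (t : Γ.H) (c : k) (a : O.obj (Γ.Flags x)) :
    (mk Γ (Function.update o x (c • a))).contrCls t =
      c • (mk Γ (Function.update o x a)).contrCls t := by
  by_cases ht : Γ.root t = Γ.root (Γ.inv t)
  · rw [contrCls_of_eq (mk Γ _) t ht, contrCls_of_eq (mk Γ _) t ht, smul_zero]
  · obtain ⟨z, l, o', h⟩ := contract_update Γ o x t ht
    rw [contrCls_of_ne (mk Γ _) t ht, contrCls_of_ne (mk Γ _) t ht, h, h, map_smul,
      cls_update_smul, smul_comm]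

theorem glueTerm_update_add {n : ℕ} (d : Γ.EdgeTuple n) (p : Fin n) (a b : O.obj (Γ.Flags x)) :
    (mk Γ (Function.update o x (a + b))).glueTerm d p =
      (mk Γ (Function.update o x a)).glueTerm d p +
        (mk Γ (Function.update o x b)).glueTerm d p := by
  unfold glueTerm
  rw [← smul_add]
  exact congrArg _ (contrCls_update_add (Γ.glue d) o x (d.1 p) a b)

theorem glueTerm_update_smul {n : ℕ} (d : Γ.EdgeTuple n) (p : Fin n) (c : k)
    (a : O.obj (Γ.Flags x)) : (mk Γ (Function.update o x (c • a))).glueTerm d p =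
      c • (mk Γ (Function.update o x a)).glueTerm d p := by
  unfold glueTerm
  rw [smul_comm]
  exact congrArg _ (contrCls_update_smul (Γ.glue d) o x (d.1 p) c a)

theorem compGen_update (C : Γ.Comp) (hC : Γ.compOf x ≠ C) (a : O.obj (Γ.Flags x)) :
    (mk Γ (Function.update o x a)).compGen C = (mk Γ o).compGen C := by
  have : (mk Γ (Function.update o x a)).component C =
      (mk Γ o).component C := by
    refine congrArg (Sigma.mk (Γ.component C)) (funext fun y => ?_)
    have hy : y.1 ≠ x := fun e => hC (by rw [← e]; exact y.2)
    exact congrArg _ (Function.update_of_ne hy _ _)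
  unfold compGen
  congr 1

theorem component_update (a : O.obj (Γ.Flags x)) :
    (mk Γ (Function.update o x a)).component (Γ.compOf x) =
      ⟨Γ.component (Γ.compOf x), Function.update
        ((mk Γ o).component (Γ.compOf x)).2 ⟨x, rfl⟩
        (O.map (Γ.componentFlags (Γ.compOf x) ⟨x, rfl⟩) a)⟩ := by
  refine congrArg (Sigma.mk (Γ.component (Γ.compOf x))) (funext fun y => ?_)
  by_cases h : y = ⟨x, rfl⟩
  · subst h
    exact (congrArg (O.map (Γ.componentFlags (Γ.compOf x) ⟨x, rfl⟩))
      (Function.update_self x a o)).trans (Function.update_self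
        (⟨x, rfl⟩ : (Γ.component (Γ.compOf x)).V) _ ((mk Γ o).component (Γ.compOf x)).2).symm
  · exact (congrArg (O.map (Γ.componentFlags (Γ.compOf x) y))
      (Function.update_of_ne (fun e => h (Subtype.ext e)) _ _)).trans
        (Function.update_of_ne (f := ((mk Γ o).component (Γ.compOf x)).2) h _).symm

/-- Listing the component of `x` first isolates the only factor that depends on the label at `x`. -/
theorem split_update : ∃ (L : List Γ.Comp),
    (∀ C ∈ L, Γ.compOf x ≠ C) ∧ ∀ o : (x : Γ.V) → O.obj (Γ.Flags x),
    (mk Γ o).split = (-1 : k) ^ (L.map ((mk Γ o).compInv (Γ.compOf x))).sum •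
      ((mk Γ o).compGen (Γ.compOf x) * (mk Γ o).splitList L) := by
  -- The components depend on `Γ` alone; any labels serve to name their list.
  obtain ⟨o⟩ : Nonempty ((x : Γ.V) → O.obj (Γ.Flags x)) := ⟨fun _ => 0⟩
  let L₀ := (mk Γ o).comps.erase (Γ.compOf x)
  have hnd : L₀.Nodup := (comps_nodup _).erase _
  have hx : Γ.compOf x ∉ L₀ := fun h => ((comps_nodup _).mem_erase_iff.1 h).1 rfl
  refine ⟨L₀, fun C hC e => hx (e ▸ hC), fun o' => ?_⟩
  rw [split_eq_splitList (mk Γ o') (L := Γ.compOf x :: L₀)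
    (List.nodup_cons.2 ⟨hx, hnd⟩) ?_, splitList_cons]
  intro C
  by_cases h : C = Γ.compOf x
  · simp [h]
  · exact List.mem_cons_of_mem _ ((comps_nodup _).mem_erase_iff.2 ⟨h, mem_comps (mk Γ o) C⟩)

theorem splitList_update (L : List Γ.Comp) (hL : ∀ C ∈ L, Γ.compOf x ≠ C) (a : O.obj (Γ.Flags x)) :
    (mk Γ (Function.update o x a)).splitList L = (mk Γ o).splitList L := by
  have h1 : L.map (mk Γ (Function.update o x a)).compGen =
      L.map (mk Γ o).compGen :=
    List.map_congr_left fun C hC => compGen_update Γ o x C (hL C hC) a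
  unfold splitList signedProd
  rw [h1]
  rfl

theorem compGen_update_add (a b : O.obj (Γ.Flags x)) :
    (mk Γ (Function.update o x (a + b))).compGen (Γ.compOf x) =
      (mk Γ (Function.update o x a)).compGen (Γ.compOf x) +
        (mk Γ (Function.update o x b)).compGen (Γ.compOf x) := by
  unfold compGen gen
  rw [← map_add]
  refine congrArg (incl O) (Subtype.ext ?_)
  change LGraph.cls (component (mk Γ (Function.update o x (a + b))) (Γ.compOf x)) =
    LGraph.cls (component (mk Γ (Function.update o x a)) (Γ.compOf x)) +
    LGraph.cls (component (mk Γ (Function.update o x b)) (Γ.compOf x))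
  rw [component_update, component_update, component_update, map_add]
  exact cls_update_add _ _ _ _ _

theorem compGen_update_smul (c : k) (a : O.obj (Γ.Flags x)) :
    (mk Γ (Function.update o x (c • a))).compGen (Γ.compOf x) =
      c • (mk Γ (Function.update o x a)).compGen (Γ.compOf x) := by
  unfold compGen gen
  rw [← map_smul]
  refine congrArg (incl O) (Subtype.ext ?_)
  change LGraph.cls (component (mk Γ (Function.update o x (c • a))) (Γ.compOf x)) =
    c • LGraph.cls (component (mk Γ (Function.update o x a)) (Γ.compOf x))
  rw [component_update, component_update, map_smul]
  exact cls_update_smul _ _ _ _ _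

theorem split_update_add (a b : O.obj (Γ.Flags x)) :
    (mk Γ (Function.update o x (a + b))).split =
      (mk Γ (Function.update o x a)).split +
        (mk Γ (Function.update o x b)).split := by
  obtain ⟨L, hL, h⟩ := split_update (O := O) Γ x
  rw [h, h, h, splitList_update Γ o x L hL, splitList_update Γ o x L hL,
    splitList_update Γ o x L hL, compGen_update_add, add_mul, smul_add]
  rfl

theorem split_update_smul (c : k) (a : O.obj (Γ.Flags x)) :
    (mk Γ (Function.update o x (c • a))).split =
      c • (mk Γ (Function.update o x a)).split := by
  obtain ⟨L, hL, h⟩ := split_update (O := O) Γ x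
  rw [h, h, splitList_update Γ o x L hL, splitList_update Γ o x L hL, compGen_update_smul,
    smul_mul_assoc, smul_comm]
  rfl

end Multilinear

end LGraph

/-! ## Linear maps on the graph space -/

/-- A function on labelled graphs that respects the relations as a linear map. -/
def GraphSpace.lift {M : Type*} [AddCommGroup M] [Module k M] (f : LGraph O → M)
    (hiso : ∀ (g g' : LGraph O) (φ : LGraph.Emb g g'), φ.v.Surjective →
      f g = (-1 : k) ^ φ.parity • f g')
    (hadd : ∀ (Γ : OGraph) (o : (x : Γ.V) → O.obj (Γ.Flags x)) (x : Γ.V) (a b : O.obj (Γ.Flags x)),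
      f ⟨Γ, Function.update o x (a + b)⟩ =
        f ⟨Γ, Function.update o x a⟩ + f ⟨Γ, Function.update o x b⟩)
    (hsmul : ∀ (Γ : OGraph) (o : (x : Γ.V) → O.obj (Γ.Flags x)) (x : Γ.V) (c : k)
      (a : O.obj (Γ.Flags x)),
      f ⟨Γ, Function.update o x (c • a)⟩ = c • f ⟨Γ, Function.update o x a⟩) :
    GraphSpace O →ₗ[k] M :=
  Submodule.liftQ _ (Finsupp.linearCombination k f) (by
    rw [Submodule.span_le]
    have h1 (g : LGraph O) : Finsupp.linearCombination k f g.free = f g := by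
      simp [LGraph.free]
    rintro _ (⟨φ, o, o', h⟩ | ⟨Γ, o, x, a, b⟩ | ⟨Γ, o, x, c, a⟩)
    · rw [SetLike.mem_coe, LinearMap.mem_ker, map_sub, map_smul, sub_eq_zero]
      refine (h1 _).trans ((hiso _ _ (LGraph.Emb.ofIso φ o o' h) φ.v.surjective).trans ?_)
      exact congrArg _ (h1 _).symm
    · rw [SetLike.mem_coe, LinearMap.mem_ker, map_sub, map_add, sub_eq_zero]
      exact (h1 _).trans ((hadd _ _ _ _ _).trans (congrArg₂ _ (h1 _).symm (h1 _).symm))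
    · rw [SetLike.mem_coe, LinearMap.mem_ker, map_sub, map_smul, sub_eq_zero]
      exact (h1 _).trans ((hsmul _ _ _ _ _).trans (congrArg _ (h1 _).symm)))

theorem GraphSpace.lift_mkQ {M : Type*} [AddCommGroup M] [Module k M] (f : LGraph O → M)
    (hiso hadd hsmul) (s : LGraph O →₀ k) :
    GraphSpace.lift f hiso hadd hsmul ((Submodule.span k {r | Rel O r}).mkQ s) =
      Finsupp.linearCombination k f s := rfl

theorem GraphSpace.lift_cls {M : Type*} [AddCommGroup M] [Module k M] (f : LGraph O → M)
    (hiso hadd hsmul) (g : LGraph O) :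
    GraphSpace.lift f hiso hadd hsmul g.cls = f g := by
  refine (GraphSpace.lift_mkQ f hiso hadd hsmul g.free).trans ?_
  simp [LGraph.free]

variable (O)

/-- The linear extension of the splitting into components. -/
def splitMap : GraphSpace O →ₗ[k] SymPrim O :=
  GraphSpace.lift LGraph.split (fun _ _ φ hv => φ.split_eq hv) LGraph.split_update_add
    LGraph.split_update_smul

@[simp] theorem splitMap_cls (g : LGraph O) : splitMap O g.cls = g.split :=
  GraphSpace.lift_cls _ _ _ _ g

/-- The polygon boundary on the graph space. -/
def boundaryMap (i : ℕ+) : GraphSpace O →ₗ[k] GraphSpace O :=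
  GraphSpace.lift (fun g => ∑ d : g.1.EdgeTuple i, g.glueTerm d (finRotate i ⟨0, i.pos⟩))
    (fun _ _ φ hv => φ.sum_glueTerm hv _)
    (fun Γ o x a b => by
      rw [← Finset.sum_add_distrib]
      exact Finset.sum_congr rfl fun d _ => LGraph.glueTerm_update_add Γ o x d _ a b)
    (fun Γ o x c a => by
      rw [Finset.smul_sum]
      exact Finset.sum_congr rfl fun d _ => LGraph.glueTerm_update_smul Γ o x d _ c a)

theorem boundaryMap_cls (i : ℕ+) (g : LGraph O) : boundaryMap O i g.cls =
    ∑ d : g.1.EdgeTuple i, g.glueTerm d (finRotate i ⟨0, i.pos⟩) :=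
  GraphSpace.lift_cls _ _ _ _ g

theorem fission_eq (i : ℕ+) (g : LGraph O) :
    g.fission i = (1 / 2 : k) • symProj O i (splitMap O (boundaryMap O i g.cls)) := by
  rw [boundaryMap_cls, ← LGraph.mkQ_polygonBoundary]
  rfl

variable {O}

namespace LGraph

/-! ### Contracting an edge and gluing elsewhere -/

/-- Changing the edges other than the contracted one before or after the contraction. -/
def contractRewire (g : LGraph O) (t : g.1.H) (ht : g.1.root t ≠ g.1.root (g.1.inv t))
    (w : Wiring g.1.H) (hw : w.inv t = g.1.inv t)
    (ht' : (g.rewire w).1.root t ≠ (g.rewire w).1.root ((g.rewire w).1.inv t))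
    (w' : Wiring (g.contract t ht).1.H) (hi : ∀ a, w.inv a.1 = (w'.inv a).1) :
    Emb ((g.rewire w).contract t ht') ((g.contract t ht).rewire w') :=
  (g.rewire w).contractLift t ht' (g'' := (g.contract t ht).rewire w') (W := g.1.H)
    (fun a => a.1) Subtype.val_injective (g.contractVertex t ht)
    (by
      change g.contractVertex t ht (g.1.root (w.inv t)) = g.contractVertex t ht (g.1.root t)
      rw [hw, contractVertex_inv, contractVertex_root])
    (by
      intro x x' hx hx' e
      replace hx : x ≠ g.1.root (w.inv t) := hx
      replace hx' : x' ≠ g.1.root (w.inv t) := hx'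
      rw [hw] at hx hx'
      exact congrArg Subtype.val ((g.contractVertex_of_ne t ht hx).symm.trans
        (e.trans (g.contractVertex_of_ne t ht hx'))))
    (fun a => ⟨a.1, a.2.1, by rw [← hw]; exact a.2.2⟩)
    (fun a b e => by
      have h : a.1 = b.1 := congrArg (fun c => c.1) e
      exact Subtype.ext h)
    id (fun _ => rfl) (fun _ => rfl)
    (fun a => Subtype.ext (hi ⟨a.1, _⟩).symm)
    (by
      intro a x _
      exact ⟨⟨a.1, a.2.1, by
        change a.1 ≠ w.inv t
        rw [hw]; exact a.2.2⟩, rfl⟩)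
    (by
      intro x hx hx'
      replace hx' : x ≠ g.1.root (w.inv t) := hx'
      rw [hw] at hx'
      have e : g.contractVertex t ht x = ⟨x, hx'⟩ := contractVertex_of_ne _ _ _ hx'
      rw [e]
      exact g.contract_label_other t ht ⟨x, hx'⟩ hx)
    rfl rfl
    (by
      have e : g.contractVertex t ht (g.1.root t) = ⟨g.1.root t, ht⟩ := contractVertex_root _ _ _
      refine CyclicOperad.Same.trans ?_ (g.contract_label_merged t ht
        (g.contractVertex t ht (g.1.root t)) (congrArg Subtype.val e)
        (x := g.1.root t) (y := g.1.root (w.inv t)) rfl (by rw [hw]))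
      exact CyclicOperad.Same.comp
        (CyclicOperad.Same.refl (fun a : g.1.Flags (g.1.root t) => a.1) (g.2 (g.1.root t)))
        (CyclicOperad.Same.refl (fun a : g.1.Flags (g.1.root (w.inv t)) => a.1)
          (g.2 (g.1.root (w.inv t))))
        Subtype.val_injective Subtype.val_injective rfl hw.symm)

section

variable (g : LGraph O) (t : g.1.H) (ht : g.1.root t ≠ g.1.root (g.1.inv t))
    (w : Wiring g.1.H) (hw : w.inv t = g.1.inv t)
    (ht' : (g.rewire w).1.root t ≠ (g.rewire w).1.root ((g.rewire w).1.inv t))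
    (w' : Wiring (g.contract t ht).1.H) (hi : ∀ a, w.inv a.1 = (w'.inv a).1)

theorem contractRewire_v (x : ((g.rewire w).contract t ht').1.V) :
    ((g.contractRewire t ht w hw ht' w' hi).v x).1 = x.1 := by
  have hx : x.1 ≠ g.1.root (w.inv t) := x.2
  rw [hw] at hx
  exact congrArg Subtype.val (g.contractVertex_of_ne t ht hx)

theorem contractRewire_strict (hT : ∀ a, w.tail a.1 = w'.tail a) :
    (g.contractRewire t ht w hw ht' w' hi).Strict where
  mono x y h := by
    change ((g.contractRewire t ht w hw ht' w' hi).v x).1 <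
      ((g.contractRewire t ht w hw ht' w' hi).v y).1
    rw [contractRewire_v, contractRewire_v]
    exact h
  tail a := (hT _).symm

theorem contractRewire_surjective : (g.contractRewire t ht w hw ht' w' hi).v.Surjective := by
  intro x
  refine ⟨⟨x.1, ?_⟩, Subtype.ext (contractRewire_v _ _ _ _ _ _ _ _ _)⟩
  change x.1 ≠ g.1.root (w.inv t)
  rw [hw]
  exact x.2

end

/-- An edge tuple of a contracted graph as an edge tuple of the graph. -/
def liftTuple (g : LGraph O) (t : g.1.H) (ht : g.1.root t ≠ g.1.root (g.1.inv t)) {n : ℕ}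
    (f : (g.contract t ht).1.EdgeTuple n) : g.1.EdgeTuple n :=
  ⟨f.1.trans ⟨fun a => a.1, Subtype.val_injective⟩, fun i j e => f.2 i j (Subtype.ext e)⟩

theorem liftTuple_glue_inv (g : LGraph O) (t : g.1.H) (ht : g.1.root t ≠ g.1.root (g.1.inv t))
    {n : ℕ} (f : (g.contract t ht).1.EdgeTuple n) :
    (g.1.glue (g.liftTuple t ht f)).inv t = g.1.inv t := by
  refine OGraph.EdgeTuple.glue_inv_of_notMem _ (fun m => (f.1 m).2.1) fun m e => ?_
  have h := congrArg g.1.inv e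
  rw [g.1.inv_inv] at h
  exact (f.1 m).2.2 h

/-- Gluing a polygon along edges of a contracted graph and contracting one of the new edges. -/
theorem smul_glueTerm_contract (g : LGraph O) (t : g.1.H)
    (ht : g.1.root t ≠ g.1.root (g.1.inv t)) {n : ℕ} (f : (g.contract t ht).1.EdgeTuple n)
    (q : Fin n) : (-1 : k) ^ g.1.contractParity t • (g.contract t ht).glueTerm f q =
      (-1 : k) ^ (g.liftTuple t ht f).flips •
        (g.glue (g.liftTuple t ht f)).contr2 t ((g.liftTuple t ht f).1 q) := by
  have hw := g.liftTuple_glue_inv t ht f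
  have ht' : g.1.root t ≠ g.1.root ((g.1.glue (g.liftTuple t ht f)).inv t) := by rwa [hw]
  have hq : (g.liftTuple t ht f).1 q ≠ t ∧
      (g.liftTuple t ht f).1 q ≠ (g.1.glue (g.liftTuple t ht f)).inv t := by
    rw [hw]
    exact (f.1 q).2
  have hi (a : (g.contract t ht).1.H) :
      (g.1.glue (g.liftTuple t ht f)).inv a.1 = (((g.contract t ht).1.glue f).inv a).1 :=
    OGraph.EdgeTuple.glue_inv_comm (Γ := g.1) (Γ' := (g.contract t ht).1) (fun a => a.1)
      (g.liftTuple t ht f) f Subtype.val_injective (fun _ => rfl) (fun _ => rfl) a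
  have hT (a : (g.contract t ht).1.H) : (g.liftTuple t ht f).tail a.1 = f.tail a :=
    OGraph.EdgeTuple.tail_comm (Γ := g.1) (Γ' := (g.contract t ht).1) (fun a => a.1)
      (g.liftTuple t ht f) f Subtype.val_injective (fun _ => rfl) (fun _ => rfl) (fun _ => rfl) a
  have hs := g.contractRewire_strict t ht (g.liftTuple t ht f).wiring hw ht' f.wiring hi hT
  have h1 := (g.contractRewire t ht (g.liftTuple t ht f).wiring hw ht' f.wiring hi).contrCls_eq
    (g.contractRewire_surjective t ht (g.liftTuple t ht f).wiring hw ht' f.wiring hi) ⟨_, hq⟩ (hs.tail _)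
  rw [hs.parity_eq, pow_zero, one_smul] at h1
  have h2 : (g.1.glue (g.liftTuple t ht f)).contractParity t = g.1.contractParity t := by
    unfold OGraph.contractParity
    rw [hw]
    rfl
  rw [contr2_of_ne (g.glue _) t _ ht' hq]
  have h3 : (g.liftTuple t ht f).flips = f.flips := rfl
  rw [glueTerm, smul_comm, h3]
  refine congrArg _ ?_
  refine Eq.trans ?_ (congrArg₂ (fun (a : ℕ) b => (-1 : k) ^ a • b) h2.symm h1.symm)
  rfl

namespace Emb

variable {g g' : LGraph O}

/-- Whether the direction of an edge is reversed, as a number. -/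
def reversed (φ : Emb g g') (t : g.1.H) : ℕ := if g'.1.tail (φ.h t) = g.1.tail t then 0 else 1

theorem parity_contract (φ : Emb g g') (hv : φ.v.Surjective) (t : g.1.H)
    (ht : g.1.root t ≠ g.1.root (g.1.inv t)) :
    (g.1.contractParity t + (φ.contract t ht).parity) % 2 =
      (φ.parity + φ.reversed t + g'.1.contractParity (φ.h t)) % 2 := by
  have h1 := φ.inversions_contract hv t ht
  by_cases h : g'.1.tail (φ.h t) = g.1.tail t
  · rw [parity, φ.reversals_contract t ht h, parity, reversed, if_pos h]
    omega
  · have h2 := φ.reversals_contract_add_one t ht h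
    rw [parity, parity, reversed, if_neg h]
    omega

theorem contrCls_eq_reversed (φ : Emb g g') (hv : φ.v.Surjective) (t : g.1.H) :
    g.contrCls t = (-1 : k) ^ (φ.parity + φ.reversed t) • g'.contrCls (φ.h t) := by
  by_cases ht : g.1.root t = g.1.root (g.1.inv t)
  · rw [contrCls_of_eq g t ht, contrCls_of_eq g', smul_zero]
    rw [φ.inv_h, φ.root_h, φ.root_h, ht]
  · rw [contrCls_of_ne g t ht, contrCls_of_ne g' _ (φ.root_ne ht),
      (φ.contract t ht).cls_eq (φ.contract_surjective hv t ht), smul_smul, smul_smul, ← pow_add,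
      ← pow_add, neg_one_pow_congr (φ.parity_contract hv t ht)]

theorem contr2_eq (φ : Emb g g') (hv : φ.v.Surjective) (p q : g.1.H) :
    g.contr2 p q =
      (-1 : k) ^ (φ.parity + φ.reversed p + φ.reversed q) • g'.contr2 (φ.h p) (φ.h q) := by
  by_cases h1 : g.1.root p = g.1.root (g.1.inv p)
  · rw [g.contr2_eq_zero_of_loop p q h1, contr2_eq_zero_of_loop, smul_zero]
    rw [φ.inv_h, φ.root_h, φ.root_h, h1]
  have h3 : (φ.h q ≠ φ.h p ∧ φ.h q ≠ g'.1.inv (φ.h p)) ↔ (q ≠ p ∧ q ≠ g.1.inv p) := by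
    rw [φ.inv_h, φ.h_inj.ne_iff, φ.h_inj.ne_iff]
  by_cases h2 : q ≠ p ∧ q ≠ g.1.inv p
  · rw [g.contr2_of_ne p q h1 h2, g'.contr2_of_ne _ _ (φ.root_ne h1) (h3.2 h2),
      (φ.contract p h1).contrCls_eq_reversed (φ.contract_surjective hv p h1) ⟨q, h2⟩, smul_smul,
      smul_smul, ← pow_add, ← pow_add]
    refine congrArg₂ (· • ·) (neg_one_pow_congr ?_) rfl
    have h4 := φ.parity_contract hv p h1
    have h5 : (φ.contract p h1).reversed ⟨q, h2⟩ = φ.reversed q := rfl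
    rw [h5]
    omega
  · rw [g.contr2_eq_zero_of_eq p q h2, contr2_eq_zero_of_eq _ _ _ (fun h => h2 (h3.1 h)), smul_zero]

end Emb

end LGraph

/-! ## Products of connected graphs -/

variable (O) in
/-- The connected labelled graphs. -/
abbrev ConnGraph : Type (max 1 u) := {g : LGraph O // g.1.IsConnected}

/-- A product of connected graphs. -/
def genProd (l : List (ConnGraph O)) : SymPrim O := (l.map fun g => g.1.gen g.2).prod

/-- The total number of vertices. -/
def totalVerts (l : List (ConnGraph O)) : ℕ := (l.map fun g => g.1.nverts).sum

@[simp] theorem genProd_nil : genProd ([] : List (ConnGraph O)) = 1 := rfl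

theorem genProd_cons (g : ConnGraph O) (l : List (ConnGraph O)) :
    genProd (g :: l) = g.1.gen g.2 * genProd l := by simp [genProd]

theorem genProd_append (l l' : List (ConnGraph O)) :
    genProd (l ++ l') = genProd l * genProd l' := by simp [genProd]

@[simp] theorem totalVerts_nil : totalVerts ([] : List (ConnGraph O)) = 0 := rfl

theorem totalVerts_cons (g : ConnGraph O) (l : List (ConnGraph O)) :
    totalVerts (g :: l) = g.1.nverts + totalVerts l := by simp [totalVerts]

theorem totalVerts_append (l l' : List (ConnGraph O)) :
    totalVerts (l ++ l') = totalVerts l + totalVerts l' := by simp [totalVerts]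

theorem nverts_pos (g : ConnGraph O) : 0 < g.1.nverts := by
  obtain ⟨x⟩ := g.2.nonempty
  exact Nat.card_pos_iff.2 ⟨⟨x⟩, inferInstance⟩

theorem genProd_mem (l : List (ConnGraph O)) : genProd l ∈ symDeg O (totalVerts l) :=
  Submodule.subset_span ⟨l, rfl, rfl⟩

theorem gen_mem_symDeg (g : ConnGraph O) : g.1.gen g.2 ∈ symDeg O g.1.nverts := by
  have := genProd_mem [g]
  rwa [genProd_cons, totalVerts_cons, genProd_nil, totalVerts_nil, mul_one, add_zero] at this

theorem one_mem_symDeg : (1 : SymPrim O) ∈ symDeg O 0 := genProd_mem []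

theorem symDeg_induction {n : ℕ} {P : SymPrim O → Prop}
    (h : ∀ l : List (ConnGraph O), totalVerts l = n → P (genProd l)) (h0 : P 0)
    (hadd : ∀ a b, P a → P b → P (a + b)) (hsmul : ∀ (c : k) a, P a → P (c • a))
    {s : SymPrim O} (hs : s ∈ symDeg O n) : P s := by
  induction hs using Submodule.span_induction with
  | mem s hs => obtain ⟨l, hl, rfl⟩ := hs; exact h l hl
  | zero => exact h0
  | add a b _ _ ha hb => exact hadd a b ha hb
  | smul c a _ ha => exact hsmul c a ha

theorem mul_mem_symDeg {m n : ℕ} {a b : SymPrim O} (ha : a ∈ symDeg O m) (hb : b ∈ symDeg O n) :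
    a * b ∈ symDeg O (m + n) := by
  refine symDeg_induction (P := fun a => a * b ∈ symDeg O (m + n)) (fun l hl => ?_) ?_ ?_ ?_ ha
  · refine symDeg_induction (P := fun b => genProd l * b ∈ symDeg O (m + n)) (fun l' hl' => ?_)
      ?_ ?_ ?_ hb
    · rw [← genProd_append, ← hl, ← hl', ← totalVerts_append]
      exact genProd_mem _
    · simp
    · intro a b ha hb; rw [mul_add]; exact add_mem ha hb
    · intro c a ha; rw [mul_smul_comm]; exact Submodule.smul_mem _ _ ha
  · simp
  · intro a b ha hb; rw [add_mul]; exact add_mem ha hb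
  · intro c a ha; rw [smul_mul_assoc]; exact Submodule.smul_mem _ _ ha

theorem gen_mul_genProd (g : ConnGraph O) (l : List (ConnGraph O)) : g.1.gen g.2 * genProd l =
    (-1 : k) ^ (g.1.nverts * totalVerts l) • (genProd l * g.1.gen g.2) := by
  induction l with
  | nil => simp
  | cons g' l ih =>
    rw [genProd_cons, totalVerts_cons, ← mul_assoc, LGraph.gen_comm g.2 g'.2, smul_mul_assoc,
      mul_assoc, ih, mul_smul_comm, smul_smul, mul_assoc, mul_add, pow_add]

theorem genProd_comm (l l' : List (ConnGraph O)) : genProd l * genProd l' =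
    (-1 : k) ^ (totalVerts l * totalVerts l') • (genProd l' * genProd l) := by
  induction l with
  | nil => simp
  | cons g l ih =>
    rw [genProd_cons, totalVerts_cons, mul_assoc, ih, mul_smul_comm, ← mul_assoc,
      gen_mul_genProd, smul_mul_assoc, smul_smul, mul_assoc, add_mul, pow_add, mul_comm]

theorem symDeg_comm {m n : ℕ} {a b : SymPrim O} (ha : a ∈ symDeg O m) (hb : b ∈ symDeg O n) :
    a * b = (-1 : k) ^ (m * n) • (b * a) := by
  refine symDeg_induction (P := fun a => a * b = (-1 : k) ^ (m * n) • (b * a))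
    (fun l hl => ?_) ?_ ?_ ?_ ha
  · refine symDeg_induction
      (P := fun b => genProd l * b = (-1 : k) ^ (m * n) • (b * genProd l)) (fun l' hl' => ?_)
      ?_ ?_ ?_ hb
    · rw [genProd_comm, hl, hl']
    · simp
    · intro a b ha hb; rw [mul_add, add_mul, ha, hb, smul_add]
    · intro c a ha; rw [mul_smul_comm, smul_mul_assoc, ha, smul_comm]
  · simp
  · intro a b ha hb; rw [mul_add, add_mul, ha, hb, smul_add]
  · intro c a ha; rw [mul_smul_comm, smul_mul_assoc, ha, smul_comm]

/-! ### Generation by connected graphs -/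

theorem prim_induction {P : prim O → Prop}
    (h : ∀ g : ConnGraph O, P ⟨g.1.cls, Submodule.subset_span ⟨g.1, g.2, rfl⟩⟩) (h0 : P 0)
    (hadd : ∀ a b, P a → P b → P (a + b)) (hsmul : ∀ (c : k) a, P a → P (c • a)) (x : prim O) :
    P x := by
  obtain ⟨x, hx⟩ := x
  induction hx using Submodule.span_induction with
  | mem s hs => obtain ⟨g, hg, rfl⟩ := hs; exact h ⟨g, hg⟩
  | zero => exact h0
  | add a b _ _ ha hb => exact hadd _ _ ha hb
  | smul c a _ ha => exact hsmul _ _ ha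

theorem adjoin_range_incl : Algebra.adjoin k (Set.range (incl O)) = ⊤ := by
  have h1 := TensorAlgebra.adjoin_range_ι (R := k) (M := prim O)
  have h2 := congrArg (Subalgebra.map (RingQuot.mkAlgHom k (SymRel O))) h1
  rw [Algebra.map_top, (AlgHom.range_eq_top _).2 (RingQuot.mkAlgHom_surjective k (SymRel O)),
    AlgHom.map_adjoin, ← Set.range_comp] at h2
  exact h2

theorem adjoin_range_gen :
    Algebra.adjoin k (Set.range fun g : ConnGraph O => g.1.gen g.2) = ⊤ := by
  rw [eq_top_iff, ← adjoin_range_incl, Algebra.adjoin_le_iff]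
  rintro _ ⟨x, rfl⟩
  refine prim_induction (P := fun x => incl O x ∈ Algebra.adjoin k
    (Set.range fun g : ConnGraph O => g.1.gen g.2)) ?_ ?_ ?_ ?_ x
  · intro g
    exact Algebra.subset_adjoin ⟨g, rfl⟩
  · rw [map_zero]; exact zero_mem _
  · intro a b ha hb; rw [map_add]; exact add_mem ha hb
  · intro c a ha; rw [map_smul]; exact Subalgebra.smul_mem _ ha c

theorem span_range_genProd : Submodule.span k (Set.range (genProd (O := O))) = ⊤ := by
  have h1 := congrArg Subalgebra.toSubmodule (adjoin_range_gen (O := O))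
  rw [Algebra.adjoin_eq_span, Algebra.top_toSubmodule] at h1
  rw [eq_top_iff, ← h1]
  refine Submodule.span_mono ?_
  intro s hs
  obtain ⟨l, hl, rfl⟩ := Submonoid.exists_list_of_mem_closure hs
  clear hs h1
  induction l with
  | nil => exact ⟨[], rfl⟩
  | cons a l ih =>
    obtain ⟨g, hg⟩ := hl a (by simp)
    obtain ⟨l', hl'⟩ := ih fun b hb => hl b (by simp [hb])
    exact ⟨g :: l', by rw [genProd_cons, hl', List.prod_cons, ← hg]⟩

theorem symPrim_induction {P : SymPrim O → Prop} (h : ∀ l : List (ConnGraph O), P (genProd l))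
    (h0 : P 0) (hadd : ∀ a b, P a → P b → P (a + b)) (hsmul : ∀ (c : k) a, P a → P (c • a))
    (s : SymPrim O) : P s := by
  have hs : s ∈ Submodule.span k (Set.range (genProd (O := O))) := by
    rw [span_range_genProd]; trivial
  induction hs using Submodule.span_induction with
  | mem s hs => obtain ⟨l, rfl⟩ := hs; exact h l
  | zero => exact h0
  | add a b _ _ ha hb => exact hadd _ _ ha hb
  | smul c a _ ha => exact hsmul _ _ ha

theorem linearMap_ext_genProd {M : Type*} [AddCommGroup M] [Module k M] {f f' : SymPrim O →ₗ[k] M}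
    (h : ∀ l, f (genProd l) = f' (genProd l)) : f = f' := by
  refine LinearMap.ext fun s => ?_
  refine symPrim_induction (P := fun s => f s = f' s) h (by simp) ?_ ?_ s
  · intro a b ha hb; rw [map_add, map_add, ha, hb]
  · intro c a ha; rw [map_smul, map_smul, ha]

/-! ### Word length -/

theorem wordLength_incl (x : prim O) :
    wordLength O (incl O x) = Polynomial.monomial 1 (incl O x) := by
  simp only [wordLength, incl, LinearMap.comp_apply, AlgHom.toLinearMap_apply,
    RingQuot.liftAlgHom_mkAlgHom_apply, TensorAlgebra.lift_ι_apply]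
  rfl

theorem wordLength_genProd (l : List (ConnGraph O)) :
    wordLength O (genProd l) = Polynomial.monomial l.length (genProd l) := by
  induction l with
  | nil => rw [genProd_nil, map_one]; rfl
  | cons g l ih =>
    rw [genProd_cons, map_mul, ih, LGraph.gen, wordLength_incl, Polynomial.monomial_mul_monomial,
      List.length_cons, add_comm]

theorem symProj_genProd (i : ℕ) (l : List (ConnGraph O)) :
    symProj O i (genProd l) = if l.length = i then genProd l else 0 := by
  change Polynomial.coeff (wordLength O (genProd l)) i = _
  rw [wordLength_genProd, Polynomial.coeff_monomial]

theorem symProj_mem_symDeg (i : ℕ) {n : ℕ} {s : SymPrim O} (hs : s ∈ symDeg O n) :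
    symProj O i s ∈ symDeg O n := by
  refine symDeg_induction (P := fun s => symProj O i s ∈ symDeg O n) (fun l hl => ?_) ?_ ?_ ?_ hs
  · rw [symProj_genProd]
    split_ifs
    · rw [← hl]; exact genProd_mem l
    · exact zero_mem _
  · rw [map_zero]; exact zero_mem _
  · intro a b ha hb; rw [map_add]; exact add_mem ha hb
  · intro c a ha; rw [map_smul]; exact Submodule.smul_mem _ _ ha

theorem LGraph.exists_split_eq (g : LGraph O) : ∃ (e : ℕ) (l : List (ConnGraph O)),
    g.split = (-1 : k) ^ e • genProd l ∧ l.length = g.1.ncomp ∧ totalVerts l = g.nverts := by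
  let e : g.1.Comp ≃ Fin (Nat.card g.1.Comp) := Finite.equivFin g.1.Comp
  refine ⟨Nat.card {p : g.1.V × g.1.V // p.1 < p.2 ∧ e (g.1.compOf p.2) < e (g.1.compOf p.1)},
    List.ofFn fun j => ⟨g.component (e.symm j), g.1.component_isConnected (e.symm j)⟩,
    ?_, ?_, ?_⟩
  rotate_left
  · rw [List.length_ofFn]; rfl
  · rw [totalVerts, List.map_ofFn, List.sum_ofFn]
    have h1 : ∑ C : g.1.Comp, Nat.card {x : g.1.V // g.1.compOf x = C} = Nat.card g.1.V := by
      rw [← Nat.card_sigma]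
      exact Nat.card_congr (Equiv.sigmaFiberEquiv g.1.compOf)
    rw [LGraph.nverts, ← h1]
    exact Fintype.sum_equiv e.symm _ _ fun j => rfl
  · rw [genProd, List.map_ofFn]
    rfl

theorem LGraph.symProj_split (g : LGraph O) (i : ℕ) :
    symProj O i g.split = if g.1.ncomp = i then g.split else 0 := by
  obtain ⟨e, l, h1, h2, -⟩ := g.exists_split_eq
  rw [h1, map_smul, symProj_genProd, h2]
  split_ifs <;> simp

theorem LGraph.split_mem_symDeg (g : LGraph O) : g.split ∈ symDeg O g.nverts := by
  obtain ⟨e, l, h1, -, h2⟩ := g.exists_split_eq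
  rw [h1, ← h2]
  exact Submodule.smul_mem _ _ (genProd_mem l)

/-! ## Odd derivations -/

namespace IsOddDerivation

variable {D D' : SymPrim O →ₗ[k] SymPrim O}

theorem map_one_eq_zero (hD : IsOddDerivation O D) : D 1 = 0 := by
  have := hD 0 1 1 one_mem_symDeg
  simpa using this

theorem genProd_cons (hD : IsOddDerivation O D) (g : ConnGraph O) (l : List (ConnGraph O)) :
    D (genProd (g :: l)) = D (g.1.gen g.2) * genProd l +
      (-1 : k) ^ g.1.nverts • (g.1.gen g.2 * D (genProd l)) := by
  rw [FissionOperad.genProd_cons]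
  exact hD _ _ _ (gen_mem_symDeg g)

theorem ext (hD : IsOddDerivation O D) (hD' : IsOddDerivation O D')
    (h : ∀ g : ConnGraph O, D (g.1.gen g.2) = D' (g.1.gen g.2)) : D = D' := by
  refine linearMap_ext_genProd fun l => ?_
  induction l with
  | nil => rw [genProd_nil, hD.map_one_eq_zero, hD'.map_one_eq_zero]
  | cons g l ih => rw [hD.genProd_cons, hD'.genProd_cons, h, ih]

theorem map_symDeg_zero (hD : IsOddDerivation O D) {s : SymPrim O} (hs : s ∈ symDeg O 0) :
    D s = 0 := by
  refine symDeg_induction (P := fun s => D s = 0) (fun l hl => ?_) (map_zero D) ?_ ?_ hs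
  · cases l with
    | nil => exact hD.map_one_eq_zero
    | cons g l =>
      rw [totalVerts_cons] at hl
      have := nverts_pos g
      omega
  · intro a b ha hb; rw [map_add, ha, hb, add_zero]
  · intro c a ha; rw [map_smul, ha, smul_zero]

theorem map_mem_symDeg (hD : IsOddDerivation O D)
    (h : ∀ (g : ConnGraph O) n, g.1.nverts = n + 1 → D (g.1.gen g.2) ∈ symDeg O n)
    (n : ℕ) {s : SymPrim O} (hs : s ∈ symDeg O (n + 1)) : D s ∈ symDeg O n := by
  refine symDeg_induction (P := fun s => D s ∈ symDeg O n) (fun l hl => ?_) ?_ ?_ ?_ hs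
  · clear hs
    induction l generalizing n with
    | nil => rw [genProd_nil, hD.map_one_eq_zero]; exact zero_mem _
    | cons g l ih =>
      rw [totalVerts_cons] at hl
      obtain ⟨m, hm⟩ := Nat.exists_eq_succ_of_ne_zero (nverts_pos g).ne'
      rw [hD.genProd_cons]
      refine add_mem ?_ (Submodule.smul_mem _ _ ?_)
      · have := mul_mem_symDeg (h g m hm) (genProd_mem l)
        rwa [show m + totalVerts l = n by omega] at this
      · by_cases hl0 : totalVerts l = 0
        · rw [hD.map_symDeg_zero (hl0 ▸ genProd_mem l), mul_zero]
          exact zero_mem _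
        · obtain ⟨r, hr⟩ := Nat.exists_eq_succ_of_ne_zero hl0
          have := mul_mem_symDeg (gen_mem_symDeg g) (ih r hr)
          rwa [show g.1.nverts + r = n by omega] at this
  · rw [map_zero]; exact zero_mem _
  · intro a b ha hb; rw [map_add]; exact add_mem ha hb
  · intro c a ha; rw [map_smul]; exact Submodule.smul_mem _ _ ha

/-- The anticommutator of two odd derivations of degree `-1` is determined on generators. -/
theorem anticomm (hD : IsOddDerivation O D) (hD' : IsOddDerivation O D')
    (h : ∀ (g : ConnGraph O) n, g.1.nverts = n + 1 → D (g.1.gen g.2) ∈ symDeg O n)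
    (h' : ∀ (g : ConnGraph O) n, g.1.nverts = n + 1 → D' (g.1.gen g.2) ∈ symDeg O n)
    (h0 : ∀ g : ConnGraph O, D (D' (g.1.gen g.2)) + D' (D (g.1.gen g.2)) = 0) (s : SymPrim O) :
    D (D' s) + D' (D s) = 0 := by
  have key : D ∘ₗ D' + D' ∘ₗ D = 0 := by
    refine linearMap_ext_genProd fun l => ?_
    change D (D' (genProd l)) + D' (D (genProd l)) = 0
    induction l with
    | nil => rw [genProd_nil, hD.map_one_eq_zero, hD'.map_one_eq_zero, map_zero, map_zero, add_zero]
    | cons g l ih =>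
      obtain ⟨m, hm⟩ := Nat.exists_eq_succ_of_ne_zero (nverts_pos g).ne'
      have h1 := gen_mem_symDeg g
      -- Applying either derivation lowers the degree `m + 1` of `g` to `m`, so each mixed product
      -- of an image of `g` with an image of `l` occurs with both signs. What survives is controlled
      -- by `h0` and `ih`.
      rw [hD.genProd_cons, hD'.genProd_cons, map_add, map_add, map_smul, map_smul,
        hD m _ _ (h' g m hm), hD' m _ _ (h g m hm), hD _ _ _ h1, hD' _ _ _ h1, hm]
      have h2 := congrArg (· * genProd l) (h0 g)
      have h3 := congrArg (g.1.gen g.2 * ·) ih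
      simp only [add_mul, mul_add, zero_mul, mul_zero] at h2 h3
      simp only [pow_succ, mul_neg, mul_one, neg_smul, smul_add, smul_neg, smul_smul, neg_neg]
      have hsq : -(-1 : k) ^ m * (-1) ^ m = -1 := by rw [neg_mul, ← mul_pow]; simp
      simp only [hsq, neg_smul, one_smul, neg_neg]
      calc _ = (D (D' (g.1.gen g.2)) * genProd l + D' (D (g.1.gen g.2)) * genProd l) +
            (g.1.gen g.2 * D (D' (genProd l)) + g.1.gen g.2 * D' (D (genProd l))) := by abel
        _ = 0 := by rw [h2, h3, add_zero]
  exact LinearMap.congr_fun key s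

end IsOddDerivation

/-! ## Extension of linear maps to derivations -/

theorem LGraph.Emb.nverts_eq {g g' : LGraph O} (φ : LGraph.Emb g g') (hv : φ.v.Surjective) :
    g.nverts = g'.nverts :=
  Nat.card_eq_of_bijective φ.v ⟨φ.v_inj, hv⟩

variable (O) in
/-- The sign of the number of vertices. -/
def parityMap : GraphSpace O →ₗ[k] GraphSpace O :=
  GraphSpace.lift (fun g => (-1 : k) ^ g.nverts • g.cls)
    (fun g g' φ hv => by rw [φ.cls_eq hv, φ.nverts_eq hv, smul_comm])
    (fun Γ o x a b => (congrArg (fun c => (-1 : k) ^ Nat.card Γ.V • c)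
      (LGraph.cls_update_add Γ o x a b)).trans (smul_add _ _ _))
    (fun Γ o x c a => by
      rw [smul_comm]
      exact congrArg _ (LGraph.cls_update_smul Γ o x c a))

theorem parityMap_cls (g : LGraph O) : parityMap O g.cls = (-1 : k) ^ g.nverts • g.cls :=
  GraphSpace.lift_cls _ _ _ _ g

/-- Defining the sign on graphs spares a proof that `prim O` is the direct sum of its graded pieces.
-/
theorem parityMap_of_mem_primDeg {n : ℕ} {x : prim O} (hx : x ∈ primDeg O n) :
    parityMap O x.1 = (-1 : k) ^ n • x.1 := by
  induction hx using Submodule.span_induction with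
  | mem x hx =>
    obtain ⟨g, hg, rfl, h⟩ := hx
    rw [h, parityMap_cls]
  | zero => simp
  | add a b _ _ ha hb => rw [Submodule.coe_add, map_add, ha, hb, smul_add]
  | smul c a _ ha => rw [Submodule.coe_smul, map_smul, ha, smul_comm]

theorem parityMap_mem_prim (x : GraphSpace O) (hx : x ∈ prim O) : parityMap O x ∈ prim O := by
  induction hx using Submodule.span_induction with
  | mem x hx =>
    obtain ⟨g, hg, rfl⟩ := hx
    rw [parityMap_cls]
    exact Submodule.smul_mem _ _ (Submodule.subset_span ⟨g, hg, rfl⟩)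
  | zero => rw [map_zero]; exact zero_mem _
  | add a b _ _ ha hb => rw [map_add]; exact add_mem ha hb
  | smul c a _ ha => rw [map_smul]; exact Submodule.smul_mem _ _ ha

variable (O) in
/-- The sign of the number of vertices on the span of the connected graphs. -/
def primParity : prim O →ₗ[k] prim O := (parityMap O).restrict parityMap_mem_prim

theorem primParity_of_mem {n : ℕ} {x : prim O} (hx : x ∈ primDeg O n) :
    primParity O x = (-1 : k) ^ n • x :=
  Subtype.ext (parityMap_of_mem_primDeg hx)

theorem incl_mem_symDeg {n : ℕ} {x : prim O} (hx : x ∈ primDeg O n) : incl O x ∈ symDeg O n := by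
  induction hx using Submodule.span_induction with
  | mem x hx =>
    obtain ⟨g, hg, rfl, h⟩ := hx
    obtain rfl : x = ⟨g.cls, Submodule.subset_span ⟨g, hg, rfl⟩⟩ := Subtype.ext h
    exact gen_mem_symDeg ⟨g, hg⟩
  | zero => rw [map_zero]; exact zero_mem _
  | add a b _ _ ha hb => rw [map_add]; exact add_mem ha hb
  | smul c a _ ha => rw [map_smul]; exact Submodule.smul_mem _ _ ha

theorem eq_zero_of_mem_primDeg_zero {x : prim O} (hx : x ∈ primDeg O 0) : x = 0 := by
  induction hx using Submodule.span_induction with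
  | mem x hx =>
    obtain ⟨g, hg, h0, h⟩ := hx
    have := nverts_pos (⟨g, hg⟩ : ConnGraph O)
    exact absurd h0 this.ne'
  | zero => rfl
  | add a b _ _ ha hb => rw [ha, hb, add_zero]
  | smul c a _ ha => rw [ha, smul_zero]

/-- An algebra homomorphism out of `S(P𝒢^𝒪)`. -/
def symLift {A : Type*} [Ring A] [Algebra k A] (f : prim O →ₗ[k] A)
    (hf : ∀ {m n : ℕ} {x y : prim O}, x ∈ primDeg O m → y ∈ primDeg O n →
      f x * f y = (-1 : k) ^ (m * n) • (f y * f x)) : SymPrim O →ₐ[k] A :=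
  RingQuot.liftAlgHom k ⟨TensorAlgebra.lift k f, by
    rintro _ _ ⟨hx, hy⟩
    simp only [map_mul, map_smul, TensorAlgebra.lift_ι_apply]
    exact hf hx hy⟩

theorem symLift_incl {A : Type*} [Ring A] [Algebra k A] (f : prim O →ₗ[k] A) (hf) (x : prim O) :
    symLift f hf (incl O x) = f x := by
  simp only [symLift, incl, LinearMap.comp_apply, AlgHom.toLinearMap_apply,
    RingQuot.liftAlgHom_mkAlgHom_apply, TensorAlgebra.lift_ι_apply]

section Extension

variable (δ : prim O →ₗ[k] SymPrim O)

/-- The triangular matrix whose upper right corner is `δ`. -/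
def triangular : prim O →ₗ[k] Matrix (Fin 2) (Fin 2) (SymPrim O) where
  toFun x := !![incl O (primParity O x), δ x; 0, incl O x]
  map_add' x y := by
    ext i j
    fin_cases i <;> fin_cases j <;> simp
  map_smul' c x := by
    ext i j
    fin_cases i <;> fin_cases j <;> simp

theorem triangular_apply (x : prim O) :
    triangular δ x = !![incl O (primParity O x), δ x; 0, incl O x] := rfl

/-- This is what `symLift` needs in order to extend the matrices to an algebra homomorphism. The
diagonal of that homomorphism is the parity automorphism and the identity, so its multiplicativity
in the upper right corner is the odd Leibniz rule. There the sign of the parity entry makes up for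
`δ` lowering degrees by one. -/
theorem triangular_comm
    (hδ : ∀ {n : ℕ} {x : prim O}, x ∈ primDeg O (n + 1) → δ x ∈ symDeg O n) {m n : ℕ}
    {x y : prim O} (hx : x ∈ primDeg O m) (hy : y ∈ primDeg O n) :
    triangular δ x * triangular δ y =
      (-1 : k) ^ (m * n) • (triangular δ y * triangular δ x) := by
  have hxy := incl_comm O hx hy
  -- Connected graphs have a vertex, so the degree zero part vanishes; otherwise the image under `δ`
  -- has degree exactly one less.
  cases m with
  | zero => rw [eq_zero_of_mem_primDeg_zero hx]; simp
  | succ m =>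
  cases n with
  | zero => rw [eq_zero_of_mem_primDeg_zero hy]; simp
  | succ n =>
  have h1 := symDeg_comm (incl_mem_symDeg hx) (hδ hy)
  have h2 := symDeg_comm (hδ hx) (incl_mem_symDeg hy)
  rw [triangular_apply, triangular_apply, primParity_of_mem hx, primParity_of_mem hy,
    Matrix.mul_fin_two, Matrix.mul_fin_two]
  ext i j
  fin_cases i <;> fin_cases j
  · simp only [map_smul, mul_zero, add_zero, Matrix.smul_apply, Fin.zero_eta, Matrix.of_apply,
      Matrix.cons_val_zero, Matrix.cons_val', smul_mul_smul_comm]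
    rw [hxy, smul_smul, smul_smul, mul_comm, mul_comm ((-1 : k) ^ (m + 1))]
  · simp only [Fin.zero_eta, Fin.mk_one, Matrix.smul_apply, Matrix.of_apply, Matrix.cons_val', 
      Matrix.cons_val_zero, Matrix.cons_val_one, map_smul, smul_mul_assoc]
    rw [h1, h2, smul_add, smul_smul, smul_smul, ← pow_add, ← pow_add, add_comm,
      neg_one_pow_congr (show (m * (n + 1)) % 2 = ((m + 1) * (n + 1) + (n + 1)) % 2 by
        rw [show (m + 1) * (n + 1) + (n + 1) = m * (n + 1) + 2 * (n + 1) by ring]; omega),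
      show m + 1 + (m + 1) * n = (m + 1) * (n + 1) by ring]
  · simp
  · simp [hxy]

variable (hδ : ∀ {n : ℕ} {x : prim O}, x ∈ primDeg O (n + 1) → δ x ∈ symDeg O n)

/-- The extension of `δ` to a derivation. -/
def extendDerivation : SymPrim O →ₗ[k] SymPrim O where
  toFun s := symLift (triangular δ) (triangular_comm δ hδ) s 0 1
  map_add' s t := by rw [map_add, Matrix.add_apply]
  map_smul' c s := by rw [map_smul, Matrix.smul_apply]; rfl

theorem extendDerivation_incl (x : prim O) : extendDerivation δ hδ (incl O x) = δ x := by
  change symLift (triangular δ) (triangular_comm δ hδ) (incl O x) 0 1 = _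
  rw [symLift_incl]
  rfl

theorem symLift_triangular (l : List (ConnGraph O)) :
    symLift (triangular δ) (triangular_comm δ hδ) (genProd l) =
      !![(-1 : k) ^ totalVerts l • genProd l, extendDerivation δ hδ (genProd l); 0, genProd l] := by
  have h1 : symLift (triangular δ) (triangular_comm δ hδ) (genProd l) 0 0 =
      (-1 : k) ^ totalVerts l • genProd l ∧
    symLift (triangular δ) (triangular_comm δ hδ) (genProd l) 1 0 = 0 ∧
    symLift (triangular δ) (triangular_comm δ hδ) (genProd l) 1 1 = genProd l := by
    induction l with
    | nil => simp
    | cons g l ih =>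
      obtain ⟨h1, h2, h3⟩ := ih
      have h4 : primParity O ⟨g.1.cls, Submodule.subset_span ⟨g.1, g.2, rfl⟩⟩ =
          (-1 : k) ^ g.1.nverts • _ :=
        primParity_of_mem (Submodule.subset_span ⟨g.1, g.2, rfl, rfl⟩)
      rw [genProd_cons, map_mul, LGraph.gen, symLift_incl, triangular_apply, h4]
      simp only [Matrix.mul_apply, Fin.sum_univ_two, h1, h2, h3]
      simp [totalVerts_cons, pow_add, smul_smul, mul_comm]
  ext i j
  fin_cases i <;> fin_cases j
  · exact h1.1
  · rfl
  · exact h1.2.1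
  · exact h1.2.2

theorem extendDerivation_isOddDerivation : IsOddDerivation O (extendDerivation δ hδ) := by
  intro n a b ha
  refine symDeg_induction (P := fun a => extendDerivation δ hδ (a * b) =
    extendDerivation δ hδ a * b + (-1 : k) ^ n • (a * extendDerivation δ hδ b))
    (fun l hl => ?_) ?_ ?_ ?_ ha
  · refine symPrim_induction (P := fun b => extendDerivation δ hδ (genProd l * b) =
      extendDerivation δ hδ (genProd l) * b +
        (-1 : k) ^ n • (genProd l * extendDerivation δ hδ b)) (fun l' => ?_) ?_ ?_ ?_ b
    · have h1 : extendDerivation δ hδ (genProd l * genProd l') =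
        symLift (triangular δ) (triangular_comm δ hδ) (genProd l * genProd l') 0 1 := rfl
      rw [h1, map_mul, symLift_triangular δ hδ, symLift_triangular δ hδ, Matrix.mul_fin_two, ← hl]
      simp [add_comm]
    · simp
    · intro b c hb hc
      rw [mul_add, map_add, map_add, hb, hc, mul_add, mul_add, smul_add]
      abel
    · intro c b hb
      rw [mul_smul_comm, map_smul, map_smul, hb, mul_smul_comm, mul_smul_comm, smul_add,
        smul_comm ((-1 : k) ^ n)]
  · simp
  · intro x y hx hy
    rw [add_mul, map_add, map_add, hx, hy, add_mul, add_mul, smul_add]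
    abel
  · intro c x hx
    rw [smul_mul_assoc, map_smul, map_smul, hx, smul_mul_assoc, smul_mul_assoc, smul_add,
      smul_comm ((-1 : k) ^ n)]

end Extension

/-! ## Existence of the fission operators -/

namespace LGraph

theorem glueTerm_split_mem (g : LGraph O) {n m : ℕ} (d : g.1.EdgeTuple n) (p : Fin n)
    (hm : g.nverts = m + 1) : splitMap O (g.glueTerm d p) ∈ symDeg O m := by
  rw [glueTerm, map_smul]
  refine Submodule.smul_mem _ _ ?_
  by_cases ht : (g.glue d).1.root (d.1 p) = (g.glue d).1.root ((g.glue d).1.inv (d.1 p))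
  · rw [contrCls_of_eq (g.glue d) _ ht, map_zero]; exact zero_mem _
  · rw [contrCls_of_ne (g.glue d) _ ht, map_smul, splitMap_cls]
    refine Submodule.smul_mem _ _ ?_
    have h := ((g.glue d).contract _ ht).split_mem_symDeg
    have h2 : ((g.glue d).contract _ ht).nverts = m := by
      have h3 : ((g.glue d).contract _ ht).nverts = g.nverts - 1 := by
        rw [nverts, nverts, Nat.card_eq_fintype_card, Nat.card_eq_fintype_card]
        exact Set.card_ne_eq _
      omega
    rwa [h2] at h

theorem fission_mem (g : LGraph O) (i : ℕ+) {m : ℕ} (hm : g.nverts = m + 1) :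
    g.fission i ∈ symDeg O m := by
  rw [fission_eq, boundaryMap_cls, map_sum]
  refine Submodule.smul_mem _ _ (symProj_mem_symDeg _ (Submodule.sum_mem _ fun d _ => ?_))
  exact g.glueTerm_split_mem d _ hm

end LGraph

variable (O) in
/-- The fission operator on the span of the connected graphs. -/
def primFission (i : ℕ+) : prim O →ₗ[k] SymPrim O :=
  (1 / 2 : k) • (symProj O i ∘ₗ splitMap O ∘ₗ boundaryMap O i ∘ₗ (prim O).subtype)

theorem primFission_cls (i : ℕ+) (g : LGraph O) (h : g.cls ∈ prim O) :
    primFission O i ⟨g.cls, h⟩ = g.fission i := (fission_eq O i g).symm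

theorem primFission_mem (i : ℕ+) {n : ℕ} {x : prim O} (hx : x ∈ primDeg O (n + 1)) :
    primFission O i x ∈ symDeg O n := by
  induction hx using Submodule.span_induction with
  | mem x hx =>
    obtain ⟨g, hg, hn, h⟩ := hx
    obtain rfl : x = ⟨g.cls, Submodule.subset_span ⟨g, hg, rfl⟩⟩ := Subtype.ext h
    exact (primFission_cls i g _).symm ▸ g.fission_mem i hn
  | zero => rw [map_zero]; exact zero_mem _
  | add a b _ _ ha hb => rw [map_add]; exact add_mem ha hb
  | smul c a _ ha => rw [map_smul]; exact Submodule.smul_mem _ _ ha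

theorem existsUnique_isFission (i : ℕ+) :
    ∃! D : SymPrim O →ₗ[k] SymPrim O, IsFission O i D := by
  refine ⟨extendDerivation (primFission O i) (primFission_mem i),
    ⟨extendDerivation_isOddDerivation _ _, fun g hg => ?_⟩, fun D hD => ?_⟩
  · rw [LGraph.gen, extendDerivation_incl]
    exact primFission_cls i g _
  · refine hD.1.ext (extendDerivation_isOddDerivation _ _) fun g => ?_
    rw [hD.2, LGraph.gen, extendDerivation_incl]
    exact (primFission_cls i g.1 _).symm

/-! ## The number of components -/

namespace OGraph

variable {Γ : OGraph} {n : ℕ} (d : Γ.EdgeTuple n)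

/-- The components of the glued graph that meet the polygon. -/
def touched : Set (Γ.glue d).Comp := Set.range fun m => (Γ.glue d).compOf (Γ.root (d.1 m))

theorem compOf_glue_inv (m : Fin n) :
    (Γ.glue d).compOf (Γ.root (Γ.inv (d.1 m))) ∈ touched d := by
  refine ⟨finRotate n m, ?_⟩
  have h := (Γ.glue d).compOf_inv (d.1 (finRotate n m))
  rw [d.glue_inv_apply] at h
  exact h.symm

/-- The component of a vertex in the glued graph, where the components that meet the polygon are
identified. -/
def untouchedComp (x : Γ.V) : Option {C : (Γ.glue d).Comp // C ∉ touched d} :=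
  if h : (Γ.glue d).compOf x ∈ touched d then none else some ⟨_, h⟩

theorem untouchedComp_of_mem {x : Γ.V} (h : (Γ.glue d).compOf x ∈ touched d) :
    untouchedComp d x = none := dif_pos h

/-- Away from the polygon the old and new edges agree. An old edge along which the polygon is glued
has both ends in touched components, all of which are sent to `none`. -/
theorem untouchedComp_inv (h : Γ.H) :
    untouchedComp d (Γ.root (Γ.inv h)) = untouchedComp d (Γ.root h) := by
  by_cases h1 : ∃ m, d.1 m = h
  · obtain ⟨m, rfl⟩ := h1
    rw [untouchedComp_of_mem d (compOf_glue_inv d m), untouchedComp_of_mem d ⟨m, rfl⟩]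
  by_cases h2 : ∃ m, d.1 m = Γ.inv h
  · obtain ⟨m, hm⟩ := h2
    obtain rfl : Γ.inv (d.1 m) = h := by rw [hm, Γ.inv_inv]
    rw [Γ.inv_inv, untouchedComp_of_mem d (compOf_glue_inv d m), untouchedComp_of_mem d ⟨m, rfl⟩]
  · have h3 : (Γ.glue d).inv h = Γ.inv h :=
      d.glue_inv_of_notMem (fun m e => h1 ⟨m, e⟩) fun m e => h2 ⟨m, by rw [← e, Γ.inv_inv]⟩
    have h4 := (Γ.glue d).compOf_inv h
    rw [h3] at h4
    unfold untouchedComp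
    have h5 : (Γ.glue d).compOf (Γ.root (Γ.inv h)) = (Γ.glue d).compOf (Γ.root h) := h4
    simp only [h5]

/-- The map from the components of a graph to those of the glued graph, where the components that
meet the polygon are identified. -/
def compToUntouched : Γ.Comp → Option {C : (Γ.glue d).Comp // C ∉ touched d} :=
  Γ.compLift (untouchedComp d) (untouchedComp_inv d)

theorem compToUntouched_surjective (hn : 0 < n) : (compToUntouched d).Surjective := by
  rintro (_ | ⟨C, hC⟩)
  · exact ⟨Γ.compOf (Γ.root (d.1 ⟨0, hn⟩)), untouchedComp_of_mem d ⟨⟨0, hn⟩, rfl⟩⟩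
  · induction C using (Γ.glue d).comp_ind with | _ x
    exact ⟨Γ.compOf x, dif_neg hC⟩

theorem ncomp_glue_eq : (Γ.glue d).ncomp + 1 = Nat.card (touched d) +
    Nat.card (Option {C : (Γ.glue d).Comp // C ∉ touched d}) := by
  have h1 := Nat.card_congr (Equiv.sumCompl fun C => C ∈ touched d)
  rw [Nat.card_sum] at h1
  rw [Finite.card_option, ncomp, ← h1, add_assoc]

theorem card_touched_le : Nat.card (touched d) ≤ n := by
  have := Finite.card_range_le fun m => (Γ.glue d).compOf (Γ.root (d.1 m))
  rwa [Nat.card_fin] at this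

theorem card_untouched_le (hn : 0 < n) :
    Nat.card (Option {C : (Γ.glue d).Comp // C ∉ touched d}) ≤ Γ.ncomp :=
  Nat.card_le_card_of_surjective _ (compToUntouched_surjective d hn)

/-- Gluing a `2n`-gon creates at most `n - 1` components. -/
theorem ncomp_glue_le (hn : 0 < n) : (Γ.glue d).ncomp + 1 ≤ Γ.ncomp + n := by
  have h1 := ncomp_glue_eq d
  have h2 := card_touched_le d
  have h3 := card_untouched_le d hn
  omega

/-- Equality in the bound forces the surjection `compToUntouched` to be a bijection, and it sends
the components of all edges of the polygon to `none`. -/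
theorem compOf_eq_of_ncomp_glue (h : (Γ.glue d).ncomp + 1 = Γ.ncomp + n) (m m' : Fin n) :
    Γ.compOf (Γ.root (d.1 m)) = Γ.compOf (Γ.root (d.1 m')) := by
  have hn : 0 < n := m.pos
  have h1 := ncomp_glue_eq d
  have h2 := card_touched_le d
  have h3 := card_untouched_le d hn
  have h4 : (compToUntouched d).Bijective :=
    (compToUntouched_surjective d hn).bijective_of_nat_card_le
      (by change Γ.ncomp ≤ _; omega)
  refine h4.1 ?_
  exact (untouchedComp_of_mem d ⟨m, rfl⟩).trans (untouchedComp_of_mem d ⟨m', rfl⟩).symm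

/-- Equality in the bound also forces the number of touched components to be `n`, one for each new
edge. -/
theorem compOf_glue_injective (h : (Γ.glue d).ncomp + 1 = Γ.ncomp + n) :
    Function.Injective fun m => (Γ.glue d).compOf (Γ.root (d.1 m)) := by
  intro m m' e
  have hn : 0 < n := m.pos
  have h1 := ncomp_glue_eq d
  have h2 := card_touched_le d
  have h3 := card_untouched_le d hn
  have h4 : (Set.rangeFactorization fun m => (Γ.glue d).compOf (Γ.root (d.1 m))).Bijective :=
    Set.rangeFactorization_surjective.bijective_of_nat_card_le (by
      rw [Nat.card_fin]
      change n ≤ Nat.card (touched d)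
      omega)
  exact h4.1 (Subtype.ext e)

end OGraph

namespace LGraph

theorem ncomp_contract (g : LGraph O) (t : g.1.H) (ht : g.1.root t ≠ g.1.root (g.1.inv t)) :
    (g.contract t ht).1.ncomp = g.1.ncomp := by
  let f : g.1.Comp → (g.contract t ht).1.Comp :=
    g.1.compLift (fun x => (g.contract t ht).1.compOf (g.contractVertex t ht x)) fun h => by
      by_cases h1 : h = t
      · subst h1
        rw [contractVertex_inv, contractVertex_root]
      by_cases h2 : h = g.1.inv t
      · subst h2
        rw [contractVertex_inv, g.1.inv_inv, contractVertex_root]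
      · exact (g.contract t ht).1.compOf_inv ⟨h, h1, h2⟩
  let f' : (g.contract t ht).1.Comp → g.1.Comp :=
    (g.contract t ht).1.compLift (fun x => g.1.compOf x.1) fun h => by
      have key (x : g.1.V) : g.1.compOf (g.contractVertex t ht x).1 = g.1.compOf x := by
        by_cases h1 : x = g.1.root (g.1.inv t)
        · rw [contractVertex_of_eq _ _ _ h1, h1, g.1.compOf_inv]
        · rw [contractVertex_of_ne _ _ _ h1]
      rw [contract_root, contract_root, key, key]
      exact g.1.compOf_inv h.1
  refine Nat.card_congr ⟨f', f, ?_, ?_⟩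
  · intro C
    induction C using (g.contract t ht).1.comp_ind with | _ x
    change (g.contract t ht).1.compOf (g.contractVertex t ht x.1) = _
    rw [contractVertex_val]
  · intro C
    induction C using g.1.comp_ind with | _ x
    change g.1.compOf (g.contractVertex t ht x).1 = g.1.compOf x
    by_cases h1 : x = g.1.root (g.1.inv t)
    · rw [contractVertex_of_eq _ _ _ h1, h1, g.1.compOf_inv]
    · rw [contractVertex_of_ne _ _ _ h1]

/-! ### The terms with the largest number of components -/

/-- The part of the polygon boundary in which the number of components is as large as possible. -/
def topSum (g : LGraph O) {n : ℕ} (p : Fin n) : GraphSpace O :=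
  ∑ d : g.1.EdgeTuple n,
    if (g.1.glue d).ncomp + 1 = g.1.ncomp + n then g.glueTerm d p else 0

theorem symProj_glueTerm (g : LGraph O) {n : ℕ} (d : g.1.EdgeTuple n) (p : Fin n) (i : ℕ) :
    symProj O i (splitMap O (g.glueTerm d p)) =
      splitMap O (if (g.1.glue d).ncomp = i then g.glueTerm d p else 0) := by
  by_cases ht : (g.glue d).1.root (d.1 p) = (g.glue d).1.root ((g.glue d).1.inv (d.1 p))
  · rw [glueTerm, contrCls_of_eq (g.glue d) _ ht]
    simp
  · have h := ncomp_contract (g.glue d) _ ht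
    rw [glueTerm, contrCls_of_ne (g.glue d) _ ht, map_smul, map_smul, map_smul, map_smul,
      splitMap_cls, symProj_split, h]
    change _ = splitMap O (if (g.glue d).1.ncomp = i then _ else _)
    split_ifs
    · rw [map_smul, map_smul, splitMap_cls]
    · simp

/-- For a connected graph, `i` components after gluing is the extreme case of
`OGraph.ncomp_glue_le`. Unlike the projection to word length `i`, the condition of extremality is
also the right one for disconnected graphs. -/
theorem fission_of_isConnected {g : LGraph O} (hg : g.1.IsConnected) (i : ℕ+) :
    g.fission i = (1 / 2 : k) • splitMap O (g.topSum (finRotate i ⟨0, i.pos⟩)) := by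
  rw [fission_eq, boundaryMap_cls, topSum, map_sum, map_sum, map_sum, ncomp_eq_one hg]
  congr 1
  refine Finset.sum_congr rfl fun d _ => ?_
  rw [symProj_glueTerm]
  have : (g.1.glue d).ncomp + 1 = 1 + i ↔ (g.1.glue d).ncomp = i := by omega
  simp only [this]

end LGraph

namespace LGraph

/-! ### Unions of components -/

section Restrict

variable (g : LGraph O) (p : g.1.V → Prop) (hp : ∀ h, p (g.1.root (g.1.inv h)) ↔ p (g.1.root h))

/-- The half-edges at a vertex of a union of components. -/
def restrictFlags (x : {x // p x}) : g.1.Flags x.1 ≃ {h : {h // p (g.1.root h)} //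
    (⟨g.1.root h.1, h.2⟩ : {x // p x}) = x} where
  toFun h := ⟨⟨h.1, by rw [h.2]; exact x.2⟩, Subtype.ext h.2⟩
  invFun h := ⟨h.1.1, congrArg Subtype.val h.2⟩
  left_inv _ := rfl
  right_inv _ := rfl

/-- A union of components with the restricted vertex ordering and edge directions. -/
def restrictGraph : OGraph where
  V := {x // p x}
  H := {h // p (g.1.root h)}
  root h := ⟨g.1.root h.1, h.2⟩
  inv := g.1.inv.subtypeEquiv fun h => (hp h).symm
  inv_inv h := Subtype.ext (g.1.inv_inv h.1)
  inv_ne h e := g.1.inv_ne h.1 (congrArg Subtype.val e)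
  tail h := g.1.tail h.1
  tail_inv h := g.1.tail_inv h.1
  valence x := by
    rw [← Nat.card_congr (g.restrictFlags p x)]
    exact g.1.valence x.1

/-- A union of components of a labelled graph. -/
def restrict : LGraph O :=
  ⟨g.restrictGraph p hp, fun x => O.map (g.restrictFlags p x) (g.2 x.1)⟩

/-- The inclusion of a union of components. -/
def ofRestrict : Emb (g.restrict p hp) g where
  v x := x.1
  v_inj := Subtype.val_injective
  h a := a.1
  h_inj := Subtype.val_injective
  root_h _ := rfl
  inv_h _ := rfl
  surj a x e := ⟨⟨a, by rw [e]; exact x.2⟩, rfl⟩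
  label x := (CyclicOperad.Same.map (g.restrictFlags p x) (fun _ => rfl) (g.2 x.1)).symm

theorem ofRestrict_strict : (g.ofRestrict p hp).Strict := ⟨fun _ _ h => h, fun _ => rfl⟩

end Restrict

/-! ### Contraction in a disjoint union -/

namespace Emb

variable {g₁ g₂ g' : LGraph O} {φ : Emb g₁ g'} {ψ : Emb g₂ g'}

theorem IsSum.symm (H : IsSum φ ψ) : IsSum ψ φ :=
  ⟨fun x y e => H.disjoint y x e.symm, fun z => (H.cover z).symm⟩

theorem IsSum.crossing_add (H : IsSum φ ψ) :
    φ.crossing ψ + ψ.crossing φ = g₁.nverts * g₂.nverts := by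
  have h1 : ψ.crossing φ = Nat.card {p : g₁.1.V × g₂.1.V // ¬ ψ.v p.2 < φ.v p.1} := by
    refine Nat.card_congr ((Equiv.prodComm _ _).subtypeEquiv fun p => ?_)
    change φ.v p.2 < ψ.v p.1 ↔ ¬ ψ.v p.1 < φ.v p.2
    rw [not_lt]
    exact ⟨le_of_lt, fun h => lt_of_le_of_ne h (H.disjoint _ _)⟩
  rw [h1, crossing, ← Nat.card_sum, nverts, nverts, ← Nat.card_prod]
  exact Nat.card_congr (Equiv.sumCompl _)

theorem IsSum.contract (H : IsSum φ ψ) (t : g₁.1.H) (ht : g₁.1.root t ≠ g₁.1.root (g₁.1.inv t)) :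
    IsSum (φ.contract t ht) (ψ.contractAway (φ.h t) (φ.root_ne ht)
      (fun x e => H.disjoint _ _ ((φ.root_h t).symm.trans e.symm))
      (fun x e => H.disjoint (g₁.1.root (g₁.1.inv t)) x (by rw [e, φ.inv_h, φ.root_h]))) where
  disjoint x y e := H.disjoint x.1 y (by
    rw [← φ.contract_v t ht]
    exact congrArg (fun z => z.1) e)
  cover z := by
    rcases H.cover z.1 with ⟨x, hx⟩ | ⟨y, hy⟩
    · refine Or.inl ⟨⟨x, fun e => z.2 ?_⟩, Subtype.ext ((φ.contract_v _ _ _).trans hx)⟩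
      rw [← hx, e, φ.inv_h, φ.root_h]
    · exact Or.inr ⟨y, Subtype.ext hy⟩

/-- The vertices of `g₂` before the removed vertex are counted on the left by the position of that
vertex in `g'`, and on the right by the pairs that disappear from the crossing. -/
theorem IsSum.crossing_contract (H : IsSum φ ψ) (hφ : φ.Strict) (t : g₁.1.H)
    (ht : g₁.1.root t ≠ g₁.1.root (g₁.1.inv t)) (h1 h2) :
    g'.1.contractParity (φ.h t) +
        (φ.contract t ht).crossing (ψ.contractAway (φ.h t) (φ.root_ne ht) h1 h2) =
      g₁.1.contractParity t + φ.crossing ψ := by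
  set y := g₁.1.root (g₁.1.inv t) with hy
  have e0 : g'.1.root (g'.1.inv (φ.h t)) = φ.v y := by rw [φ.inv_h, φ.root_h]
  have e1 : Nat.card {z : g'.1.V // z < φ.v y} =
      Nat.card {x : g₁.1.V // x < y} + Nat.card {x : g₂.1.V // ψ.v x < φ.v y} := by
    rw [← Nat.card_sum]
    refine (Nat.card_congr (Equiv.ofBijective (Sum.elim (fun x => ⟨φ.v x.1, hφ.mono _ _ x.2⟩)
      fun x => ⟨ψ.v x.1, x.2⟩) ⟨?_, ?_⟩)).symm
    · rintro (x | x) (x' | x') e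
      · exact congrArg Sum.inl (Subtype.ext (φ.v_inj (congrArg Subtype.val e)))
      · exact absurd (congrArg Subtype.val e) (H.disjoint _ _)
      · exact absurd (congrArg Subtype.val e).symm (H.disjoint _ _)
      · exact congrArg Sum.inr (Subtype.ext (ψ.v_inj (congrArg Subtype.val e)))
    · rintro ⟨z, hz⟩
      rcases H.cover z with ⟨x, rfl⟩ | ⟨x, rfl⟩
      · exact ⟨Sum.inl ⟨x, (hφ.lt_iff _ _).1 hz⟩, rfl⟩
      · exact ⟨Sum.inr ⟨x, hz⟩, rfl⟩
  have e2 : φ.crossing ψ = Nat.card {p : {x // x ≠ y} × g₂.1.V // ψ.v p.2 < φ.v p.1.1} +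
      Nat.card {x : g₂.1.V // ψ.v x < φ.v y} := by
    rw [← Nat.card_sum]
    refine (Nat.card_congr (Equiv.ofBijective (Sum.elim (fun p => ⟨(p.1.1.1, p.1.2), p.2⟩)
      fun x => ⟨(y, x.1), x.2⟩) ⟨?_, ?_⟩)).symm
    · rintro (⟨⟨x, z⟩, h⟩ | x) (⟨⟨x', z'⟩, h'⟩ | x') e
      · simp only [Sum.elim_inl, Subtype.mk.injEq, Prod.mk.injEq] at e
        obtain ⟨e, rfl⟩ := e
        obtain rfl : x = x' := Subtype.ext e
        rfl
      · exact absurd (congrArg (fun c => c.1.1) e) x.2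
      · exact absurd (congrArg (fun c => c.1.1) e).symm x'.2
      · exact congrArg Sum.inr (Subtype.ext (congrArg (fun c => c.1.2) e))
    · rintro ⟨⟨x, z⟩, h⟩
      by_cases hx : x = y
      · subst hx
        exact ⟨Sum.inr ⟨z, h⟩, rfl⟩
      · exact ⟨Sum.inl ⟨(⟨x, hx⟩, z), h⟩, rfl⟩
  have e3 : (φ.contract t ht).crossing (ψ.contractAway (φ.h t) (φ.root_ne ht) h1 h2) =
      Nat.card {p : {x // x ≠ y} × g₂.1.V // ψ.v p.2 < φ.v p.1.1} := by
    refine Nat.card_congr (Equiv.subtypeEquivRight fun p => ?_)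
    have : ((φ.contract t ht).v p.1).1 = φ.v p.1.1 := φ.contract_v t ht p.1
    change ψ.v p.2 < ((φ.contract t ht).v p.1).1 ↔ _
    rw [this]
  unfold OGraph.contractParity
  rw [e0, e1, e2, e3, ← hy]
  omega

theorem IsSum.split_contrCls (H : IsSum φ ψ) (hφ : φ.Strict) (hψ : ψ.Strict) (t : g₁.1.H) :
    splitMap O (g'.contrCls (φ.h t)) =
      (-1 : k) ^ φ.crossing ψ • (splitMap O (g₁.contrCls t) * g₂.split) := by
  by_cases ht : g₁.1.root t = g₁.1.root (g₁.1.inv t)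
  · rw [contrCls_of_eq g₁ t ht, contrCls_of_eq g' _ (by rw [φ.inv_h, φ.root_h, φ.root_h, ht])]
    simp
  · rw [contrCls_of_ne g₁ t ht, contrCls_of_ne g' _ (φ.root_ne ht), map_smul, map_smul,
      splitMap_cls, splitMap_cls,
      (H.contract t ht).split_eq (hφ.contract t ht) (hψ.contractAway _ _ _ _), smul_mul_assoc,
      smul_smul, smul_smul, ← pow_add, ← pow_add, H.crossing_contract hφ t ht, add_comm]

theorem splitMap_contrCls_mem (g : LGraph O) (t : g.1.H) {m : ℕ} (hm : g.nverts = m + 1) :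
    splitMap O (g.contrCls t) ∈ symDeg O m := by
  by_cases ht : g.1.root t = g.1.root (g.1.inv t)
  · rw [contrCls_of_eq g _ ht, map_zero]; exact zero_mem _
  · rw [contrCls_of_ne g _ ht, map_smul, splitMap_cls]
    refine Submodule.smul_mem _ _ ?_
    have h := (g.contract _ ht).split_mem_symDeg
    have h2 : (g.contract _ ht).nverts = m := by
      have h3 : (g.contract _ ht).nverts = g.nverts - 1 := by
        rw [nverts, nverts, Nat.card_eq_fintype_card, Nat.card_eq_fintype_card]
        exact Set.card_ne_eq _
      omega
    rwa [h2] at h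

/-- Exchange the summands and then the factors. The two crossings add up to the product of the
vertex numbers, but the second factor has lost one vertex, which leaves the sign of `g₁.nverts`. -/
theorem IsSum.split_contrCls' (H : IsSum φ ψ) (hφ : φ.Strict) (hψ : ψ.Strict) (t : g₂.1.H) :
    splitMap O (g'.contrCls (ψ.h t)) =
      (-1 : k) ^ (φ.crossing ψ + g₁.nverts) • (g₁.split * splitMap O (g₂.contrCls t)) := by
  have hpos : 0 < g₂.nverts := Nat.card_pos_iff.2 ⟨⟨g₂.1.root t⟩, inferInstance⟩
  obtain ⟨m, hm⟩ := Nat.exists_eq_succ_of_ne_zero hpos.ne'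
  rw [H.symm.split_contrCls hψ hφ, symDeg_comm (splitMap_contrCls_mem g₂ t hm)
    g₁.split_mem_symDeg, smul_smul, ← pow_add]
  congr 1
  refine neg_one_pow_congr ?_
  have h1 := H.crossing_add
  rw [hm] at h1
  have h2 : g₁.nverts * m.succ = m * g₁.nverts + g₁.nverts := by rw [Nat.succ_eq_add_one]; ring
  omega

theorem IsSum.glue (H : IsSum φ ψ) {n : ℕ} (d : g₁.1.EdgeTuple n) :
    IsSum (φ.glue d) (ψ.glueAway (φ.mapTuple d) (fun m a e => H.disjoint (g₁.1.root (d.1 m))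
      (g₂.1.root a) (by rw [← φ.root_h, ← ψ.root_h, ← e]; rfl))) :=
  ⟨H.disjoint, H.cover⟩

theorem mapTuple_injective (φ : Emb g₁ g') {n : ℕ} :
    Function.Injective (φ.mapTuple : g₁.1.EdgeTuple n → g'.1.EdgeTuple n) :=
  fun _ _ e => Subtype.ext (DFunLike.ext _ _ fun m =>
    φ.h_inj (congrArg (fun c : g'.1.EdgeTuple n => c.1 m) e))

theorem exists_mapTuple (φ : Emb g₁ g') {n : ℕ} (d : g'.1.EdgeTuple n)
    (h : ∀ m, ∃ a, φ.h a = d.1 m) : ∃ d', φ.mapTuple d' = d := by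
  choose f hf using h
  refine ⟨⟨⟨f, fun i j e => d.1.injective (by rw [← hf, ← hf, e])⟩, fun i j e => d.2 i j ?_⟩,
    Subtype.ext (DFunLike.ext _ _ hf)⟩
  rw [← hf, ← hf, φ.inv_h]
  exact congrArg φ.h e

theorem IsSum.ncomp_glue (H : IsSum φ ψ) {n : ℕ} (d : g₁.1.EdgeTuple n) :
    (g'.1.glue (φ.mapTuple d)).ncomp + 1 = g'.1.ncomp + n ↔
      (g₁.1.glue d).ncomp + 1 = g₁.1.ncomp + n := by
  have h1 := (H.glue d).ncomp_eq
  have h2 := H.ncomp_eq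
  change (g'.1.glue (φ.mapTuple d)).ncomp = (g₁.1.glue d).ncomp + g₂.1.ncomp at h1
  omega

theorem exists_mapTuple_of_top (φ : Emb g₁ g') {n : ℕ} (d : g'.1.EdgeTuple n)
    (h : (g'.1.glue d).ncomp + 1 = g'.1.ncomp + n) (m : Fin n) (x : g₁.1.V)
    (hx : φ.v x = g'.1.root (d.1 m)) : ∃ d', φ.mapTuple d' = d := by
  refine φ.exists_mapTuple d fun m' => ?_
  have h1 := OGraph.compOf_eq_of_ncomp_glue d h m' m
  rw [← hx] at h1
  obtain ⟨x', hx'⟩ := φ.exists_of_compOf_eq h1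
  exact φ.surj _ _ hx'.symm

/-- A polygon that creates as many components as possible has all its edges in one component, hence
in one summand. No mixed terms occur, and the top part obeys the odd Leibniz rule. -/
theorem IsSum.split_topSum (H : IsSum φ ψ) (hφ : φ.Strict) (hψ : ψ.Strict) {n : ℕ} (p : Fin n) :
    splitMap O (g'.topSum p) = (-1 : k) ^ φ.crossing ψ •
      (splitMap O (g₁.topSum p) * g₂.split +
        (-1 : k) ^ g₁.nverts • (g₁.split * splitMap O (g₂.topSum p))) := by
  have key : g'.topSum p = ∑ d : g₁.1.EdgeTuple n ⊕ g₂.1.EdgeTuple n, Sum.elim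
      (fun d => if (g₁.1.glue d).ncomp + 1 = g₁.1.ncomp + n then
        g'.glueTerm (φ.mapTuple d) p else 0)
      (fun d => if (g₂.1.glue d).ncomp + 1 = g₂.1.ncomp + n then
        g'.glueTerm (ψ.mapTuple d) p else 0) d := by
    refine (Fintype.sum_of_injective (Sum.elim φ.mapTuple ψ.mapTuple) ?_ _ _ ?_ ?_).symm
    · rintro (d | d) (d' | d') e
      · exact congrArg Sum.inl (φ.mapTuple_injective e)
      · refine absurd (congrArg (fun c => g'.1.root (c.1 p)) e) ?_
        refine fun e => H.disjoint (g₁.1.root (d.1 p)) (g₂.1.root (d'.1 p)) ?_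
        rw [← φ.root_h, ← ψ.root_h]
        exact e
      · refine absurd (congrArg (fun c => g'.1.root (c.1 p)) e) ?_
        refine fun e => H.disjoint (g₁.1.root (d'.1 p)) (g₂.1.root (d.1 p)) ?_
        rw [← φ.root_h, ← ψ.root_h]
        exact e.symm
      · exact congrArg Sum.inr (ψ.mapTuple_injective e)
    · intro d hd
      refine if_neg fun h => hd ?_
      rcases H.cover (g'.1.root (d.1 p)) with ⟨x, hx⟩ | ⟨x, hx⟩
      · obtain ⟨d', rfl⟩ := φ.exists_mapTuple_of_top d h p x hx
        exact ⟨Sum.inl d', rfl⟩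
      · obtain ⟨d', rfl⟩ := ψ.exists_mapTuple_of_top d h p x hx
        exact ⟨Sum.inr d', rfl⟩
    · rintro (d | d)
      · exact if_congr (H.ncomp_glue d).symm rfl rfl
      · exact if_congr (H.symm.ncomp_glue d).symm rfl rfl
  rw [key, Fintype.sum_sum_type, map_add, map_sum, map_sum, smul_add, topSum, topSum, map_sum,
    map_sum, Finset.sum_mul, Finset.mul_sum, Finset.smul_sum, Finset.smul_sum, Finset.smul_sum]
  congr 1
  · refine Finset.sum_congr rfl fun d _ => ?_
    simp only [Sum.elim_inl]
    split_ifs with h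
    · rw [glueTerm, glueTerm, map_smul, map_smul, hφ.flips_mapTuple, smul_mul_assoc, smul_comm]
      exact congrArg _ ((H.glue d).split_contrCls (hφ.glue d) (hψ.glueAway _ _) (d.1 p))
    · simp
  · refine Finset.sum_congr rfl fun d _ => ?_
    simp only [Sum.elim_inr]
    split_ifs with h
    · rw [glueTerm, glueTerm, map_smul, map_smul, hψ.flips_mapTuple, mul_smul_comm, smul_smul,
        smul_comm, ← pow_add]
      exact congrArg _ ((H.symm.glue d).symm.split_contrCls' (hφ.glueAway _ _) (hψ.glue d) (d.1 p))
    · simp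

end Emb

/-! ### The fission operators on disconnected graphs -/

/-- A disconnected graph is the disjoint union of the component of a vertex and the rest. Both sides
satisfy the same Leibniz rule there, so induction on the number of vertices reduces to connected
graphs. -/
theorem apply_split {i : ℕ+} {D : SymPrim O →ₗ[k] SymPrim O} (hD : IsFission O i D) (g : LGraph O) :
    D g.split = (1 / 2 : k) • splitMap O (g.topSum (finRotate i ⟨0, i.pos⟩)) := by
  induction hn : Nat.card g.1.V using Nat.strong_induction_on generalizing g with
  | _ n ih =>
  by_cases hV : IsEmpty g.1.V
  · rw [split_of_isEmpty, hD.1.map_one_eq_zero, topSum]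
    have : IsEmpty (g.1.EdgeTuple i) := ⟨fun d => hV.elim (g.1.root (d.1 ⟨0, i.pos⟩))⟩
    simp
  rw [not_isEmpty_iff] at hV
  obtain ⟨x⟩ := hV
  by_cases hg : g.1.IsConnected
  · rw [split_of_isConnected hg, hD.2, fission_of_isConnected hg]
  obtain ⟨y, hy⟩ : ∃ y, g.1.compOf y ≠ g.1.compOf x := by
    by_contra! h
    exact hg (g.1.isConnected_iff.2 ⟨⟨x⟩, fun a b => (h a).trans (h b).symm⟩)
  let P (z : g.1.V) : Prop := g.1.compOf z = g.1.compOf x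
  let P' (z : g.1.V) : Prop := g.1.compOf z ≠ g.1.compOf x
  have hp (h : g.1.H) : P (g.1.root (g.1.inv h)) ↔ P (g.1.root h) := by
    change g.1.compOf _ = _ ↔ _
    rw [g.1.compOf_inv]
  have hp' (h : g.1.H) : P' (g.1.root (g.1.inv h)) ↔ P' (g.1.root h) := not_congr (hp h)
  have H : Emb.IsSum (g.ofRestrict P hp) (g.ofRestrict P' hp') :=
    ⟨fun a b e => b.2 (by
      have h1 : a.1 = b.1 := e
      rw [← h1]; exact a.2), fun z => by
      by_cases hz : g.1.compOf z = g.1.compOf x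
      · exact Or.inl ⟨⟨z, hz⟩, rfl⟩
      · exact Or.inr ⟨⟨z, hz⟩, rfl⟩⟩
  have hs := g.ofRestrict_strict P hp
  have hs' := g.ofRestrict_strict P' hp'
  have c1 : Nat.card (g.restrict P hp).1.V < n := by
    rw [← hn]
    exact Finite.card_subtype_lt (x := y) hy
  have c2 : Nat.card (g.restrict P' hp').1.V < n := by
    rw [← hn]
    exact Finite.card_subtype_lt (x := x) (fun h => h rfl)
  rw [H.split_eq hs hs', map_smul, hD.1 _ _ _ (split_mem_symDeg _), ih _ c1 _ rfl, ih _ c2 _ rfl,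
    H.split_topSum hs hs', smul_comm, smul_add (1 / 2 : k), smul_mul_assoc, mul_smul_comm,
    smul_comm _ (1 / 2 : k) (_ * _)]

end LGraph

/-! ## Gluing polygons to an involution -/

namespace Polygon

open Equiv (Perm)

variable {H : Type} [Fintype H] {n a b : ℕ}

/-- The cyclic permutation along a tuple. -/
def cyc (d : Fin n → H) : Perm H :=
  -- The value `1` is a default, so that sums may range over all functions `Fin n → H`.
  if h : d.Injective then (finRotate n).viaFintypeEmbedding ⟨d, h⟩ else 1

theorem cyc_apply {d : Fin (a + 1) → H} (h : d.Injective) (m : Fin (a + 1)) :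
    cyc d (d m) = d (m + 1) := by
  rw [cyc, dif_pos h]
  refine (Perm.viaFintypeEmbedding_apply_image (finRotate (a + 1)) ⟨d, h⟩ m).trans ?_
  rw [finRotate_apply]
  rfl

theorem cyc_of_notMem (d : Fin n → H) {x : H} (h : ∀ m, d m ≠ x) : cyc d x = x := by
  unfold cyc
  split_ifs with hd
  · exact Perm.viaFintypeEmbedding_apply_notMem_range _ _ (by rintro ⟨m, hm⟩; exact h m hm)
  · rfl

theorem cyc_inv_apply {d : Fin (a + 1) → H} (h : d.Injective) (m : Fin (a + 1)) :
    (cyc d)⁻¹ (d (m + 1)) = d m := by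
  rw [Perm.inv_eq_iff_eq, cyc_apply h]

theorem cyc_inv_of_notMem (d : Fin n → H) {x : H} (h : ∀ m, d m ≠ x) : (cyc d)⁻¹ x = x := by
  rw [Perm.inv_eq_iff_eq, cyc_of_notMem d h]

theorem cyc_rotate (d : Fin (a + 1) → H) (c : Fin (a + 1)) : cyc (fun s => d (s + c)) = cyc d := by
  by_cases hd : d.Injective
  · have hd' : Function.Injective fun s => d (s + c) := fun s t e => by simpa using hd e
    ext x
    by_cases hx : ∃ m, d m = x
    · obtain ⟨m, rfl⟩ := hx
      have := cyc_apply hd' (m - c)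
      simp only [sub_add_cancel] at this
      rw [this, cyc_apply hd]
      congr 1
      abel
    · push Not at hx
      rw [cyc_of_notMem _ hx, cyc_of_notMem _ fun m => hx _]
  · have hd' : ¬ Function.Injective fun s => d (s + c) := fun h => hd fun s t e => by
      have := @h (s - c) (t - c) (by simpa using e)
      simpa using this
    rw [cyc, cyc, dif_neg hd, dif_neg hd']

/-- The involution obtained by gluing a polygon. -/
def reglue (σ : Perm H) (d : Fin n → H) : Perm H := cyc d * σ * (cyc d)⁻¹

/-- The entries of `d` start on different edges. -/
def IsTuple (σ : Perm H) (d : Fin n → H) : Prop := d.Injective ∧ ∀ i j, d i ≠ σ (d j)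

variable {σ : Perm H}

theorem reglue_reglue_self (hσ : ∀ x, σ (σ x) = x) (d : Fin n → H) (x : H) :
    reglue σ d (reglue σ d x) = x := by
  simp [reglue, hσ]

section Apply

variable (hσ : ∀ x, σ (σ x) = x) {d : Fin (a + 1) → H} (hd : IsTuple σ d)

theorem reglue_apply_succ (hd : IsTuple σ d) (m : Fin (a + 1)) :
    reglue σ d (d (m + 1)) = σ (d m) := by
  rw [reglue, Perm.mul_apply, Perm.mul_apply, cyc_inv_apply hd.1,
    cyc_of_notMem _ fun m' => hd.2 m' m]

theorem reglue_apply (hd : IsTuple σ d) (m : Fin (a + 1)) :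
    reglue σ d (d m) = σ (d (m - 1)) := by
  have := reglue_apply_succ hd (m - 1)
  rwa [sub_add_cancel] at this

theorem reglue_inv_apply (hσ : ∀ x, σ (σ x) = x) (hd : IsTuple σ d) (m : Fin (a + 1)) :
    reglue σ d (σ (d m)) = d (m + 1) := by
  rw [← reglue_apply_succ hd, reglue_reglue_self hσ]

theorem reglue_of_notMem (hσ : ∀ x, σ (σ x) = x) {x : H} (h1 : ∀ m, d m ≠ x)
    (h2 : ∀ m, σ (d m) ≠ x) : reglue σ d x = σ x := by
  rw [reglue, Perm.mul_apply, Perm.mul_apply, cyc_inv_of_notMem _ h1, cyc_of_notMem]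
  intro m e
  exact h2 m (by rw [e, hσ])

/-- The old and the new edges at a polygon consist of the same half-edges, paired differently. -/
theorem eq_or_eq_reglue (hσ : ∀ x, σ (σ x) = x) (hd : IsTuple σ d) (x : H) :
    (∃ m, x = d m ∨ x = reglue σ d (d m)) ↔ ∃ m, x = d m ∨ x = σ (d m) := by
  constructor
  · rintro ⟨m, h | h⟩
    · exact ⟨m, Or.inl h⟩
    · rw [reglue_apply hd] at h
      exact ⟨_, Or.inr h⟩
  · rintro ⟨m, h | h⟩
    · exact ⟨m, Or.inl h⟩
    · rw [← reglue_apply_succ hd] at h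
      exact ⟨_, Or.inr h⟩

end Apply

/-! ### Reflection -/

/-- The reflected tuple, along the opposite directions of the same edges. -/
def reflect (σ : Perm H) (c : Fin (a + 1)) (d : Fin (a + 1) → H) (s : Fin (a + 1)) : H :=
  σ (d (c - s))

theorem reflect_reflect (hσ : ∀ x, σ (σ x) = x) (c : Fin (a + 1)) (d : Fin (a + 1) → H) :
    reflect σ c (reflect σ c d) = d := by
  funext s
  simp [reflect, hσ]

theorem isTuple_reflect (hσ : ∀ x, σ (σ x) = x) (c : Fin (a + 1)) {d : Fin (a + 1) → H}
    (hd : IsTuple σ d) : IsTuple σ (reflect σ c d) := by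
  refine ⟨fun s t e => ?_, fun s t e => ?_⟩
  · have := hd.1 (σ.injective e)
    simpa using this
  · rw [reflect, reflect, hσ] at e
    exact hd.2 _ _ e.symm

theorem isTuple_reflect_iff (hσ : ∀ x, σ (σ x) = x) (c : Fin (a + 1)) {d : Fin (a + 1) → H} :
    IsTuple σ (reflect σ c d) ↔ IsTuple σ d :=
  ⟨fun h => reflect_reflect hσ c d ▸ isTuple_reflect hσ c h, isTuple_reflect hσ c⟩

/-- Reversing both the cyclic order and the direction of every edge gives the same polygon: it still
pairs `d m` with `σ (d (m - 1))`. -/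
theorem reglue_reflect (hσ : ∀ x, σ (σ x) = x) (c : Fin (a + 1)) {d : Fin (a + 1) → H}
    (hd : IsTuple σ d) : reglue σ (reflect σ c d) = reglue σ d := by
  have hr := isTuple_reflect hσ c hd
  have e (m : Fin (a + 1)) : d m = σ (reflect σ c d (c - m)) := by simp [reflect, hσ]
  have e' (m : Fin (a + 1)) : σ (d m) = reflect σ c d (c - m) := by rw [e, hσ]
  ext x
  by_cases h1 : ∃ m, d m = x
  · obtain ⟨m, rfl⟩ := h1
    rw [reglue_apply hd, e m, reglue_inv_apply hσ hr, e']
    congr 1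
    abel
  by_cases h2 : ∃ m, σ (d m) = x
  · obtain ⟨m, rfl⟩ := h2
    rw [reglue_inv_apply hσ hd, e' m, reglue_apply hr, e (m + 1)]
    congr 2
    abel
  · push Not at h1 h2
    rw [reglue_of_notMem hσ h1 h2, reglue_of_notMem hσ]
    · intro m; exact h2 _
    · intro m; rw [reflect, hσ]; exact h1 _

/-! ### Two polygons -/

/-- No entry of `f` lies on an edge of `d`. -/
def Away (σ : Perm H) {m n : ℕ} (d : Fin m → H) (f : Fin n → H) : Prop :=
  ∀ i j, f j ≠ d i ∧ f j ≠ σ (d i)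

theorem Away.symm (hσ : ∀ x, σ (σ x) = x) {m : ℕ} {d : Fin m → H} {f : Fin n → H}
    (h : Away σ d f) : Away σ f d :=
  fun i j => ⟨(h j i).1.symm, fun e => (h j i).2 (by rw [e, hσ])⟩

theorem Away.reglue_apply (hσ : ∀ x, σ (σ x) = x) {d : Fin (a + 1) → H} {f : Fin n → H}
    (h : Away σ d f) (j : Fin n) : reglue σ d (f j) = σ (f j) :=
  reglue_of_notMem hσ (fun i => (h i j).1.symm) fun i => (h i j).2.symm

theorem Away.isTuple_iff (hσ : ∀ x, σ (σ x) = x) {d : Fin (a + 1) → H} {f : Fin n → H}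
    (h : Away σ d f) : IsTuple (reglue σ d) f ↔ IsTuple σ f := by
  unfold IsTuple
  simp only [h.reglue_apply hσ]

/-- The two cycles have disjoint supports, so they commute. -/
theorem Away.reglue_comm {d : Fin (a + 1) → H} {f : Fin n → H} (h : Away σ d f) :
    reglue (reglue σ d) f = reglue (reglue σ f) d := by
  have hc : cyc f * cyc d = cyc d * cyc f := by
    refine (Perm.Disjoint.commute fun x => ?_)
    by_cases hx : ∃ i, d i = x
    · obtain ⟨i, rfl⟩ := hx
      exact Or.inl (cyc_of_notMem _ fun j => (h i j).1)
    · push Not at hx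
      exact Or.inr (cyc_of_notMem _ hx)
  have e (x y : Perm H) : reglue (reglue σ d) f = (cyc f * cyc d) * σ * (cyc f * cyc d)⁻¹ := by
    simp only [reglue]; group
  rw [e 1 1, hc]
  simp only [reglue]
  group

/-- The concatenation of two tuples with the same first entry. -/
def join (d : Fin (a + 1) → H) (f : Fin (b + 1) → H) (t : Fin (a + b + 1)) : H :=
  if h : t.1 < a + 1 then d ⟨t.1, h⟩ else f ⟨t.1 - a, by omega⟩

/-- The positions of the first tuple. -/
def posL (b : ℕ) (s : Fin (a + 1)) : Fin (a + b + 1) := ⟨s.1, by omega⟩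

/-- The positions of the second tuple. -/
def posR (a : ℕ) (s : Fin (b + 1)) : Fin (a + b + 1) := if s = 0 then 0 else ⟨a + s.1, by omega⟩

theorem posR_val {s : Fin (b + 1)} (hs : s ≠ 0) : (posR a s).1 = a + s.1 := by
  rw [posR, if_neg hs]

theorem join_posL (d : Fin (a + 1) → H) (f : Fin (b + 1) → H) (s : Fin (a + 1)) :
    join d f (posL b s) = d s := dif_pos s.2

theorem join_posR (d : Fin (a + 1) → H) (f : Fin (b + 1) → H) (h : f 0 = d 0) (s : Fin (b + 1)) :
    join d f (posR a s) = f s := by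
  unfold posR
  split_ifs with hs
  · rw [hs, h]
    exact dif_pos (Nat.succ_pos a)
  · have h0 : s.1 ≠ 0 := fun e => hs (Fin.ext e)
    rw [join, dif_neg (by simp only; omega)]
    congr 1
    ext
    simp

theorem join_pos (z : Fin (a + b + 1) → H) :
    join (fun s => z (posL b s)) (fun s => z (posR a s)) = z := by
  funext t
  unfold join
  split_ifs with h
  · rfl
  · have h0 : (⟨t.1 - a, by omega⟩ : Fin (b + 1)) ≠ 0 := fun e => by
      have := congrArg Fin.val e
      simp at this
      omega
    refine congrArg z (Fin.ext ?_)
    rw [posR_val h0]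
    simp only
    omega

theorem pos_cases (t : Fin (a + b + 1)) :
    (∃ s, t = posL b s) ∨ ∃ s : Fin (b + 1), s ≠ 0 ∧ t = posR a s := by
  by_cases h : t.1 < a + 1
  · exact Or.inl ⟨⟨t.1, h⟩, rfl⟩
  · have h0 : (⟨t.1 - a, by omega⟩ : Fin (b + 1)) ≠ 0 := fun e => by
      have := congrArg Fin.val e
      simp at this
      omega
    refine Or.inr ⟨_, h0, Fin.ext ?_⟩
    rw [posR_val h0]
    simp only
    omega

theorem posL_injective : Function.Injective (posL b : Fin (a + 1) → Fin (a + b + 1)) :=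
  fun s t e => Fin.ext (by
    have h := congrArg Fin.val e
    exact h)

theorem posR_injective : Function.Injective (posR a : Fin (b + 1) → Fin (a + b + 1)) := by
  intro s t e
  by_cases hs : s = 0 <;> by_cases ht : t = 0
  · rw [hs, ht]
  · have h := congrArg Fin.val e
    rw [posR_val ht, hs, posR, if_pos rfl] at h
    have h0 : t.1 ≠ 0 := fun e => ht (Fin.ext e)
    simp at h
    omega
  · have h := congrArg Fin.val e
    rw [posR_val hs, ht, posR, if_pos rfl] at h
    have h0 : s.1 ≠ 0 := fun e => hs (Fin.ext e)
    simp at h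
    omega
  · have h := congrArg Fin.val e
    rw [posR_val hs, posR_val ht] at h
    exact Fin.ext (by omega)

theorem posL_ne_posR (s : Fin (a + 1)) {t : Fin (b + 1)} (ht : t ≠ 0) : posL b s ≠ posR a t := by
  intro e
  have h := congrArg Fin.val e
  rw [posR_val ht] at h
  have h0 : t.1 ≠ 0 := fun e => ht (Fin.ext e)
  have h1 : (posL b s).1 = s.1 := rfl
  omega

theorem posL_add_one {s : Fin (a + 1)} (hs : s + 1 ≠ 0) :
    posL b s + 1 = posL b (s + 1) := by
  have h1 : s.1 < a := by
    by_contra h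
    refine hs ?_
    have : s = Fin.last a := Fin.ext (by rw [Fin.val_last]; omega)
    rw [this, Fin.last_add_one]
  ext
  have h2 : (s + 1).1 = s.1 + 1 := Fin.val_add_one_of_lt (Fin.lt_def.2 h1)
  have h3 : (posL b s + 1).1 = (posL b s).1 + 1 :=
    Fin.val_add_one_of_lt (Fin.lt_def.2 (by simp [posL]; omega))
  rw [h3]
  simp only [posL]
  omega

theorem posR_add_one {s : Fin (b + 1)} (hs : s ≠ 0) : posR a s + 1 = posR a (s + 1) := by
  by_cases h : s = Fin.last b
  · have h1 : posR a s = Fin.last (a + b) := Fin.ext (by rw [posR_val hs, h]; simp)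
    rw [h1, Fin.last_add_one, h, Fin.last_add_one, posR, if_pos rfl]
  · have h1 : s.1 < b := by
      by_contra h'
      exact h (Fin.ext (by rw [Fin.val_last]; omega))
    have h2 : (s + 1).1 = s.1 + 1 := Fin.val_add_one_of_lt (Fin.lt_def.2 h1)
    have h3 : s + 1 ≠ 0 := fun e => by rw [e] at h2; simp at h2
    ext
    rw [posR_val h3, h2, Fin.val_add_one_of_lt (Fin.lt_def.2 (by rw [posR_val hs]; simp; omega)),
      posR_val hs, add_assoc]

theorem posL_last_add_one : posL b (Fin.last a) + 1 = posR a (1 : Fin (b + 1)) := by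
  cases b with
  | zero =>
    have h1 : posL 0 (Fin.last a) = Fin.last a := rfl
    have h2 : (1 : Fin (0 + 1)) = 0 := rfl
    rw [h2, posR, if_pos rfl]
    exact Fin.last_add_one a
  | succ b =>
    have h0 : (1 : Fin (b + 1 + 1)) ≠ 0 := by simp
    ext
    rw [posR_val h0, Fin.val_add_one_of_lt (Fin.lt_def.2 (by simp [posL]))]
    simp [posL]

/-- The first entry of `f` is the first entry of `d` and no other entry lies on an edge of `d`. -/
structure Adjoined (σ : Perm H) (d : Fin (a + 1) → H) (f : Fin (b + 1) → H) : Prop where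
  left : IsTuple σ d
  right : IsTuple (reglue σ d) f
  start : f 0 = d 0
  away : ∀ s, s ≠ 0 → ∀ m, f s ≠ d m ∧ f s ≠ σ (d m)

theorem Adjoined.reglue_apply (hσ : ∀ x, σ (σ x) = x) {d : Fin (a + 1) → H} {f : Fin (b + 1) → H}
    (h : Adjoined σ d f) {s : Fin (b + 1)} (hs : s ≠ 0) : reglue σ d (f s) = σ (f s) :=
  reglue_of_notMem hσ (fun m => (h.away s hs m).1.symm) fun m => (h.away s hs m).2.symm

theorem Adjoined.isTuple_join (hσ : ∀ x, σ (σ x) = x) {d : Fin (a + 1) → H} {f : Fin (b + 1) → H}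
    (h : Adjoined σ d f) : IsTuple σ (join d f) := by
  refine ⟨fun t t' e => ?_, fun t t' e => ?_⟩
  · rcases pos_cases t with ⟨s, rfl⟩ | ⟨s, hs, rfl⟩ <;>
    rcases pos_cases t' with ⟨s', rfl⟩ | ⟨s', hs', rfl⟩
    · rw [join_posL, join_posL] at e
      rw [h.left.1 e]
    · rw [join_posL, join_posR _ _ h.start] at e
      exact absurd e.symm (h.away s' hs' s).1
    · rw [join_posL, join_posR _ _ h.start] at e
      exact absurd e (h.away s hs s').1
    · rw [join_posR _ _ h.start, join_posR _ _ h.start] at e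
      rw [h.right.1 e]
  · rcases pos_cases t with ⟨s, rfl⟩ | ⟨s, hs, rfl⟩ <;>
    rcases pos_cases t' with ⟨s', rfl⟩ | ⟨s', hs', rfl⟩
    · rw [join_posL, join_posL] at e
      exact h.left.2 _ _ e
    · rw [join_posL, join_posR _ _ h.start] at e
      exact (h.away s' hs' s).2 (by rw [e, hσ])
    · rw [join_posL, join_posR _ _ h.start] at e
      exact (h.away s hs s').2 e
    · rw [join_posR _ _ h.start, join_posR _ _ h.start, ← h.reglue_apply hσ hs'] at e
      exact h.right.2 _ _ e

/-- This is the inverse of `join`: a polygon is cut into two that share the half-edge `z 0`. -/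
theorem adjoined_of_isTuple (hσ : ∀ x, σ (σ x) = x) {z : Fin (a + b + 1) → H} (hz : IsTuple σ z) :
    Adjoined σ (fun s => z (posL b s)) (fun s => z (posR a s)) := by
  have hl : IsTuple σ fun s : Fin (a + 1) => z (posL b s) :=
    ⟨hz.1.comp posL_injective, fun i j => hz.2 _ _⟩
  have ha : ∀ s : Fin (b + 1), s ≠ 0 → ∀ m : Fin (a + 1), z (posR a s) ≠ z (posL b m) ∧
      z (posR a s) ≠ σ (z (posL b m)) :=
    fun s hs m => ⟨fun e => posL_ne_posR m hs (hz.1 e).symm, hz.2 _ _⟩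
  refine ⟨hl, ⟨hz.1.comp posR_injective, fun i j => ?_⟩, rfl, ha⟩
  by_cases hj : j = 0
  · subst hj
    have h1 := Polygon.reglue_apply hl 0
    have h2 : reglue σ (fun s : Fin (a + 1) => z (posL b s)) (z (posR a (0 : Fin (b + 1)))) =
      σ (z (posL b (0 - 1))) := h1
    change z (posR a i) ≠ reglue σ _ (z (posR a 0))
    rw [h2]
    exact hz.2 _ _
  · change z (posR a i) ≠ reglue σ _ (z (posR a j))
    rw [reglue_of_notMem hσ (fun m => (ha j hj m).1.symm) fun m => (ha j hj m).2.symm]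
    exact hz.2 _ _

/-- Two cycles that share only their first entry multiply to the cycle along the joined tuple: the
last entry of `d` goes to `d 0 = f 0` and from there to `f 1`. -/
theorem Adjoined.reglue_join (hσ : ∀ x, σ (σ x) = x) {d : Fin (a + 1) → H} {f : Fin (b + 1) → H}
    (h : Adjoined σ d f) : reglue (reglue σ d) f = reglue σ (join d f) := by
  have hz := h.isTuple_join hσ
  have hc : cyc f * cyc d = cyc (join d f) := by
    ext x
    rw [Perm.mul_apply]
    by_cases h1 : ∃ s, d s = x
    · obtain ⟨s, rfl⟩ := h1
      rw [cyc_apply h.left.1, ← join_posL d f s, cyc_apply hz.1]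
      by_cases hs : s + 1 = 0
      · have h2 : s = Fin.last a := by
          rw [← add_left_inj 1, hs, Fin.last_add_one]
        rw [hs, ← h.start, cyc_apply h.right.1, zero_add, h2, posL_last_add_one,
          join_posR _ _ h.start]
      · rw [posL_add_one hs, join_posL, cyc_of_notMem]
        intro s' e
        by_cases hs' : s' = 0
        · rw [hs', h.start] at e
          exact hs (h.left.1 e).symm
        · exact (h.away s' hs' _).1 e
    · push Not at h1
      rw [cyc_of_notMem _ h1]
      by_cases h2 : ∃ s, f s = x
      · obtain ⟨s, rfl⟩ := h2
        have hs : s ≠ 0 := by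
          rintro rfl
          exact h1 0 h.start.symm
        rw [cyc_apply h.right.1, ← join_posR d f h.start s, cyc_apply hz.1, posR_add_one hs,
          join_posR _ _ h.start]
      · push Not at h2
        rw [cyc_of_notMem _ h2, cyc_of_notMem]
        intro t e
        rcases pos_cases t with ⟨s, rfl⟩ | ⟨s, hs, rfl⟩
        · rw [join_posL] at e
          exact h1 _ e
        · rw [join_posR _ _ h.start] at e
          exact h2 _ e
  rw [reglue, reglue, reglue, ← hc]
  group

end Polygon

namespace Polygon

open Equiv (Perm)

variable {H : Type} [Fintype H] {n a b : ℕ} {σ : Perm H}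

theorem reglue_rotate (d : Fin (a + 1) → H) (c : Fin (a + 1)) :
    reglue σ (fun s => d (s + c)) = reglue σ d := by
  rw [reglue, reglue, cyc_rotate]

theorem isTuple_rotate {d : Fin (a + 1) → H} (c : Fin (a + 1)) :
    IsTuple σ (fun s => d (s + c)) ↔ IsTuple σ d := by
  constructor
  · refine fun h => ⟨fun s t e => ?_, fun i j e => ?_⟩
    · have := @h.1 (s - c) (t - c) (by simpa using e)
      simpa using this
    · exact h.2 (i - c) (j - c) (by simpa using e)
  · exact fun h => ⟨fun s t e => by simpa using h.1 e, fun i j => h.2 _ _⟩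

/-! ### Cancellation in sums over pairs of polygons -/

/-- An antisymmetric function of two edges of an involution. -/
structure IsEdgePairing {M : Type*} [AddCommGroup M] (F : Perm H → H → H → M) : Prop where
  swap (τ : Perm H) (p q : H) : F τ q p = -F τ p q
  inv (τ : Perm H) (p q : H) : F τ (τ p) q = F τ p q

/-- Two polygons, of which the second one is glued away from the edge `d 1` made by the
first one. -/
structure Admissible (σ : Perm H) (d : Fin (a + 1) → H) (f : Fin (b + 1) → H) : Prop where
  left : IsTuple σ d
  right : IsTuple (reglue σ d) f
  away : ∀ s, f s ≠ d 1 ∧ f s ≠ reglue σ d (d 1)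

section Cancellation

variable {M : Type*} [AddCommGroup M] {F : Perm H → H → H → M}

theorem IsEdgePairing.inv_right (hF : IsEdgePairing F) (τ : Perm H) (p q : H) :
    F τ p (τ q) = F τ p q := by
  rw [hF.swap, hF.inv, ← hF.swap]

/-- A suitable reflection keeps the polygon and exchanges its new edges at the positions `p` and
`q`. By antisymmetry the sum equals its own negative. -/
theorem sum_isTuple_eq_zero (h2 : ∀ x : M, x = -x → x = 0) (hσ : ∀ x, σ (σ x) = x)
    (hF : IsEdgePairing F) (p q : Fin (n + 1)) :
    ∑ z : Fin (n + 1) → H, (if IsTuple σ z then F (reglue σ z) (z p) (z q) else 0) = 0 := by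
  apply h2
  rw [← Finset.sum_neg_distrib]
  -- The new edge at position `q` consists of `z q` and `σ (z (q - 1))`. For the latter to be entry
  -- `p` of the reflected tuple, the centre must be `p + q - 1`.
  refine Fintype.sum_equiv (Function.Involutive.toPerm (reflect σ (p + q - 1))
    (reflect_reflect hσ _)) _ _ fun z => ?_
  change _ = -(if IsTuple σ (reflect σ (p + q - 1) z) then _ else 0)
  simp only [isTuple_reflect_iff hσ]
  split_ifs with hz
  · have e1 : reflect σ (p + q - 1) z p = reglue σ z (z q) := by
      rw [reglue_apply hz, reflect]
      congr 2
      abel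
    have e2 : reflect σ (p + q - 1) z q = reglue σ z (z p) := by
      rw [reglue_apply hz, reflect]
      congr 2
      abel
    change _ = -F (reglue σ (reflect σ (p + q - 1) z)) (reflect σ (p + q - 1) z p)
      (reflect σ (p + q - 1) z q)
    rw [reglue_reflect hσ _ hz, e1, e2, hF.inv, hF.inv_right, ← hF.swap]
  · rw [neg_zero]

theorem sum_adjoined_eq_zero (h2 : ∀ x : M, x = -x → x = 0) (hσ : ∀ x, σ (σ x) = x)
    (hF : IsEdgePairing F) (p : Fin (a + 1)) (q : Fin (b + 1)) :
    ∑ e : (Fin (a + 1) → H) × (Fin (b + 1) → H), (if Adjoined σ e.1 e.2 then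
      F (reglue (reglue σ e.1) e.2) (e.1 p) (e.2 q) else 0) = 0 := by
  refine Eq.trans ?_ (sum_isTuple_eq_zero h2 hσ hF (posL b p) (posR a q))
  rw [← Finset.sum_filter, ← Finset.sum_filter]
  refine Finset.sum_bij' (fun e _ => join e.1 e.2)
    (fun z _ => (fun s => z (posL b s), fun s => z (posR a s))) ?_ ?_ ?_ ?_ ?_
  · intro e he
    rw [Finset.mem_filter] at he ⊢
    exact ⟨Finset.mem_univ _, he.2.isTuple_join hσ⟩
  · intro z hz
    rw [Finset.mem_filter] at hz ⊢
    exact ⟨Finset.mem_univ _, adjoined_of_isTuple hσ hz.2⟩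
  · intro e he
    rw [Finset.mem_filter] at he
    exact Prod.ext (funext fun s => join_posL _ _ s)
      (funext fun s => join_posR _ _ he.2.start s)
  · intro z _
    exact join_pos z
  · intro e he
    rw [Finset.mem_filter] at he
    rw [he.2.reglue_join hσ, join_posL, join_posR _ _ he.2.start]

/-- The summand for a pair of polygons. -/
def pairTerm (σ : Perm H) (F : Perm H → H → H → M) (d : Fin (a + 1) → H) (f : Fin (b + 1) → H) : M :=
  if Admissible σ d f then F (reglue (reglue σ d) f) (d 1) (f 1) else 0

/-- The second polygon meets at most one of the edges made by the first one. -/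
def Separated (σ : Perm H) (F : Perm H → H → H → M) (a b : ℕ) : Prop :=
  ∀ (d : Fin (a + 1) → H) (f : Fin (b + 1) → H), IsTuple σ d → IsTuple (reglue σ d) f →
    ∀ p q, F (reglue (reglue σ d) f) p q ≠ 0 → ∀ s s' m m', (f s = d m ∨ f s = reglue σ d (d m)) →
      (f s' = d m' ∨ f s' = reglue σ d (d m')) → m = m'

theorem sum_single_ite {ι κ : Type*} [Fintype ι] [Fintype κ] (p : ι → κ → Prop) (x : M) {i : ι}
    {j : κ} (h : p i j) (hu : ∀ i' j', p i' j' → i' = i ∧ j' = j) :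
    ∑ i', ∑ j', (if p i' j' then x else 0) = x := by
  rw [Finset.sum_eq_single i, Finset.sum_eq_single j, if_pos h]
  · exact fun j' _ hj => if_neg fun h' => hj (hu _ _ h').2
  · simp
  · exact fun i' _ hi => Finset.sum_eq_zero fun j' _ => if_neg fun h' => hi (hu _ _ h').1
  · simp

/-- By separation the second polygon uses at most one edge made by the first, and since it is a
tuple it does so at one position and in one direction. Hence a nonzero term is counted exactly once
on the right. -/
theorem pairTerm_eq (hσ : ∀ x, σ (σ x) = x) (hS : Separated σ F a b) (d : Fin (a + 1) → H)
    (f : Fin (b + 1) → H) : pairTerm σ F d f = (if Away σ d f then pairTerm σ F d f else 0) +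
      (∑ s, ∑ m, if f s = d m then pairTerm σ F d f else 0) +
      ∑ s, ∑ m, if f s = reglue σ d (d m) then pairTerm σ F d f else 0 := by
  by_cases h0 : pairTerm σ F d f = 0
  · simp [h0]
  have hA : Admissible σ d f := by
    by_contra h
    exact h0 (if_neg h)
  have hF : F (reglue (reglue σ d) f) (d 1) (f 1) ≠ 0 := by
    rwa [pairTerm, if_pos hA] at h0
  have hs := hS d f hA.left hA.right _ _ hF
  have hσ' := reglue_reglue_self hσ d
  by_cases hw : Away σ d f
  · have h1 (s m) : f s ≠ d m := (hw m s).1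
    have h2 (s m) : f s ≠ reglue σ d (d m) := by
      rw [reglue_apply hA.left]
      exact (hw _ s).2
    simp [hw, h1, h2]
  have h1 : ∃ s m, f s = d m ∨ f s = reglue σ d (d m) := by
    unfold Away at hw
    push Not at hw
    obtain ⟨i, s, h⟩ := hw
    have h' : ∃ m, f s = d m ∨ f s = σ (d m) := by
      by_cases e : f s = d i
      · exact ⟨i, Or.inl e⟩
      · exact ⟨i, Or.inr (h e)⟩
    exact ⟨s, (eq_or_eq_reglue hσ hA.left _).2 h'⟩
  rw [if_neg hw, zero_add]
  obtain ⟨s, m, h | h⟩ := h1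
  · rw [sum_single_ite (fun s m => f s = d m) _ h, Finset.sum_eq_zero, add_zero]
    · intro s' _
      refine Finset.sum_eq_zero fun m' _ => if_neg fun h' => ?_
      obtain rfl := hs s s' m m' (Or.inl h) (Or.inr h')
      exact hA.right.2 s' s (by rw [h', h])
    · intro s' m' h'
      obtain rfl := hs s s' m m' (Or.inl h) (Or.inl h')
      exact ⟨hA.right.1 (h'.trans h.symm), rfl⟩
  · rw [sum_single_ite (fun s m => f s = reglue σ d (d m)) _ h, Finset.sum_eq_zero, zero_add]
    · intro s' _
      refine Finset.sum_eq_zero fun m' _ => if_neg fun h' => ?_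
      obtain rfl := hs s s' m m' (Or.inr h) (Or.inl h')
      exact hA.right.2 s s' (by rw [h', h])
    · intro s' m' h'
      obtain rfl := hs s s' m m' (Or.inr h) (Or.inr h')
      exact ⟨hA.right.1 (h'.trans h.symm), rfl⟩

/-- Rotating both tuples so that the common half-edge comes first gives adjoined polygons, whose sum
vanishes. For `m = 1` there is nothing to sum, because the second polygon must avoid the contracted
edge. -/
theorem sum_meeting_start (h2 : ∀ x : M, x = -x → x = 0) (hσ : ∀ x, σ (σ x) = x)
    (hF : IsEdgePairing F) (hS : Separated σ F a b) (s : Fin (b + 1)) (m : Fin (a + 1)) :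
    ∑ e : (Fin (a + 1) → H) × (Fin (b + 1) → H),
      (if e.2 s = e.1 m then pairTerm σ F e.1 e.2 else 0) = 0 := by
  by_cases hm : m = 1
  · refine Finset.sum_eq_zero fun e _ => ?_
    split_ifs with h
    · refine if_neg fun hA => (hA.away s).1 ?_
      rw [h, hm]
    · rfl
  refine Eq.trans ?_ (sum_adjoined_eq_zero h2 hσ hF (1 - m) (1 - s))
  refine Fintype.sum_equiv (Equiv.prodCongr ((Equiv.addRight (-m)).arrowCongr (Equiv.refl H))
    ((Equiv.addRight (-s)).arrowCongr (Equiv.refl H))) _ _ fun ⟨d, f⟩ => ?_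
  have e1 : ((Equiv.addRight (-m)).arrowCongr (Equiv.refl H)) d = fun t => d (t + m) := by
    funext t
    simp [Equiv.arrowCongr]
  have e2 : ((Equiv.addRight (-s)).arrowCongr (Equiv.refl H)) f = fun t => f (t + s) := by
    funext t
    simp [Equiv.arrowCongr]
  simp only [Equiv.prodCongr_apply, Prod.map_apply, e1, e2, reglue_rotate, sub_add_cancel]
  -- Separation, needed for `key`, is available only where `F` does not vanish.
  by_cases h0 : F (reglue (reglue σ d) f) (d 1) (f 1) = 0
  · simp [pairTerm, h0]
  have key : (f s = d m ∧ Admissible σ d f) ↔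
      Adjoined σ (fun t => d (t + m)) (fun t => f (t + s)) := by
    constructor
    · rintro ⟨h, hA⟩
      refine ⟨(isTuple_rotate m).2 hA.left, ?_, by simpa using h, ?_⟩
      · rw [reglue_rotate]
        exact (isTuple_rotate s).2 hA.right
      · intro t ht m'
        by_contra hc
        have h' : ∃ i, f (t + s) = d i ∨ f (t + s) = σ (d i) := by
          by_cases e : f (t + s) = d (m' + m)
          · exact ⟨_, Or.inl e⟩
          · exact ⟨m' + m, Or.inr (by simpa [e] using hc)⟩
        rw [← eq_or_eq_reglue hσ hA.left] at h'
        obtain ⟨i, hi⟩ := h'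
        obtain rfl := hS d f hA.left hA.right _ _ h0 s (t + s) m i (Or.inl h) hi
        rcases hi with hi | hi
        · have := hA.right.1 (hi.trans h.symm)
          exact ht (by simpa using this)
        · exact hA.right.2 (t + s) s (by rw [hi, h])
    · rintro ⟨hl, hr, hst, haw⟩
      rw [reglue_rotate] at hr
      have hl' := (isTuple_rotate m).1 hl
      have hr' := (isTuple_rotate s).1 hr
      have hst' : f s = d m := by simpa using hst
      refine ⟨hst', hl', hr', fun t => ?_⟩
      by_cases ht : t = s
      · rw [ht, hst', ← hst']
        refine ⟨fun e => hm (hl'.1 (hst'.symm.trans e)), fun e => ?_⟩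
        rw [reglue_apply hl', hst'] at e
        exact hl'.2 _ _ e
      · have h3 := haw (t - s) (sub_ne_zero.2 ht)
        simp only [sub_add_cancel] at h3
        refine ⟨?_, ?_⟩
        · have := (h3 (1 - m)).1
          rwa [sub_add_cancel] at this
        · have := (h3 (1 - 1 - m)).2
          rw [sub_add_cancel] at this
          rwa [reglue_apply hl']
  rw [pairTerm, ← ite_and]
  exact if_congr key rfl rfl

theorem reflect_admissible (hσ : ∀ x, σ (σ x) = x) {d : Fin (a + 1) → H} {f : Fin (b + 1) → H}
    (h : Admissible σ d f) : Admissible σ d (reflect (reglue σ d) 1 f) := by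
  have hσ' := reglue_reglue_self hσ d
  refine ⟨h.left, isTuple_reflect hσ' 1 h.right, fun s => ⟨fun e => ?_, fun e => ?_⟩⟩
  · refine (h.away (1 - s)).2 ?_
    rw [← e, reflect, hσ']
  · exact (h.away (1 - s)).1 ((reglue σ d).injective e)

theorem pairTerm_reflect (hσ : ∀ x, σ (σ x) = x) (hF : IsEdgePairing F) (d : Fin (a + 1) → H)
    (f : Fin (b + 1) → H) : pairTerm σ F d (reflect (reglue σ d) 1 f) = pairTerm σ F d f := by
  have hσ' := reglue_reglue_self hσ d
  have h1 : Admissible σ d (reflect (reglue σ d) 1 f) ↔ Admissible σ d f :=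
    ⟨fun h => reflect_reflect hσ' 1 f ▸ reflect_admissible hσ h, reflect_admissible hσ⟩
  unfold pairTerm
  simp only [h1]
  split_ifs with h
  · rw [reglue_reflect hσ' 1 h.right]
    have : reflect (reglue σ d) 1 f 1 = reglue (reglue σ d) f (f 1) := by
      rw [reglue_apply h.right, reflect]
    rw [this, hF.inv_right]
  · rfl

/-- Reflecting the second polygon about `1` changes neither its gluing nor its contracted edge, but
replaces the other half of the common edge by `d m`, which is the previous case. -/
theorem sum_meeting_end (h2 : ∀ x : M, x = -x → x = 0) (hσ : ∀ x, σ (σ x) = x)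
    (hF : IsEdgePairing F) (hS : Separated σ F a b) (s : Fin (b + 1)) (m : Fin (a + 1)) :
    ∑ e : (Fin (a + 1) → H) × (Fin (b + 1) → H),
      (if e.2 s = reglue σ e.1 (e.1 m) then pairTerm σ F e.1 e.2 else 0) = 0 := by
  refine Eq.trans ?_ (sum_meeting_start h2 hσ hF hS (1 - s) m)
  rw [Fintype.sum_prod_type, Fintype.sum_prod_type]
  refine Finset.sum_congr rfl fun d _ => ?_
  have hσ' := reglue_reglue_self hσ d
  refine Fintype.sum_equiv (Function.Involutive.toPerm (reflect (reglue σ d) 1)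
    (reflect_reflect hσ' _)) _ _ fun f => ?_
  change _ = if reflect (reglue σ d) 1 f (1 - s) = d m then
    pairTerm σ F d (reflect (reglue σ d) 1 f) else 0
  rw [pairTerm_reflect hσ hF]
  refine if_congr ?_ rfl rfl
  have : reflect (reglue σ d) 1 f (1 - s) = reglue σ d (f s) := by
    rw [reflect, sub_sub_cancel]
  rw [this]
  change f s = reglue σ d (d m) ↔ _
  exact ⟨fun e => by rw [e, hσ'], fun e => by rw [← e, hσ']⟩

theorem sum_sum_sum_eq_zero {ι κ μ : Type*} [Fintype ι] [Fintype κ] [Fintype μ]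
    {f : ι → κ → μ → M} (h : ∀ s m, ∑ e, f e s m = 0) : ∑ e, ∑ s, ∑ m, f e s m = 0 := by
  rw [Finset.sum_comm]
  refine Finset.sum_eq_zero fun s _ => ?_
  rw [Finset.sum_comm]
  exact Finset.sum_eq_zero fun m _ => h s m

theorem sum_pairTerm (h2 : ∀ x : M, x = -x → x = 0) (hσ : ∀ x, σ (σ x) = x)
    (hF : IsEdgePairing F) (hS : Separated σ F a b) :
    ∑ e : (Fin (a + 1) → H) × (Fin (b + 1) → H), pairTerm σ F e.1 e.2 =
      ∑ e : (Fin (a + 1) → H) × (Fin (b + 1) → H),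
        if Away σ e.1 e.2 then pairTerm σ F e.1 e.2 else 0 := by
  rw [Finset.sum_congr rfl fun e _ => pairTerm_eq hσ hS e.1 e.2, Finset.sum_add_distrib,
    Finset.sum_add_distrib, sum_sum_sum_eq_zero fun s m => sum_meeting_start h2 hσ hF hS s m,
    sum_sum_sum_eq_zero fun s m => sum_meeting_end h2 hσ hF hS s m, add_zero, add_zero]

theorem Away.admissible_iff (hσ : ∀ x, σ (σ x) = x) {d : Fin (a + 1) → H} {f : Fin (b + 1) → H}
    (h : Away σ d f) : Admissible σ d f ↔ IsTuple σ d ∧ IsTuple σ f := by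
  constructor
  · exact fun hA => ⟨hA.left, (h.isTuple_iff hσ).1 hA.right⟩
  · rintro ⟨hd, hf⟩
    refine ⟨hd, (h.isTuple_iff hσ).2 hf, fun s => ⟨(h _ s).1, ?_⟩⟩
    rw [Polygon.reglue_apply hd]
    exact (h _ s).2

/-- The sums over pairs of polygons anticommute. -/
theorem sum_pairTerm_add (h2 : ∀ x : M, x = -x → x = 0) (hσ : ∀ x, σ (σ x) = x)
    (hF : IsEdgePairing F) (hS : Separated σ F a b) (hS' : Separated σ F b a) :
    ∑ e : (Fin (a + 1) → H) × (Fin (b + 1) → H), pairTerm σ F e.1 e.2 +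
      ∑ e : (Fin (b + 1) → H) × (Fin (a + 1) → H), pairTerm σ F e.1 e.2 = 0 := by
  rw [sum_pairTerm h2 hσ hF hS, sum_pairTerm h2 hσ hF hS', add_eq_zero_iff_eq_neg,
    ← Finset.sum_neg_distrib]
  refine Fintype.sum_equiv (Equiv.prodComm _ _) _ _ fun ⟨d, f⟩ => ?_
  have h1 : Away σ f d ↔ Away σ d f := ⟨Away.symm hσ, Away.symm hσ⟩
  simp only [Equiv.prodComm_apply, Prod.swap_prod_mk, h1]
  split_ifs with h
  · unfold pairTerm
    simp only [h.admissible_iff hσ, (h.symm hσ).admissible_iff hσ, h.reglue_comm,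
      and_comm (a := IsTuple σ f)]
    split_ifs
    · exact hF.swap _ _ _
    · rw [neg_zero]
  · rw [neg_zero]

end Cancellation

end Polygon

/-! ## The sign of a change of the edges -/

section Sign

open Equiv (Perm)

variable {H : Type} [Fintype H] {σ ρ : Perm H} {T : H → Bool}

/-- Such a permutation acts on the half-edges with `T` true and on those with `T` false, and `σ`
conjugates one action into the other; the sign is a square. -/
theorem sign_eq_one_of_commute (hT : ∀ x, T (σ x) = !T x) (hρ : ∀ x, ρ (σ x) = σ (ρ x))
    (h0 : ∀ x, T x = true → T (ρ x) = true) : Perm.sign ρ = 1 := by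
  have h1 (x : H) : T x = true ↔ T (ρ x) = true := by
    refine ⟨h0 x, fun h => ?_⟩
    by_contra h'
    have h2 := h0 (σ x) (by rw [hT]; simpa using h')
    rw [hρ, hT, h] at h2
    exact absurd h2 (by simp)
  let p (x : H) : Prop := T x = true
  have h2 : ρ = Perm.subtypeCongr (ρ.subtypePerm (p := p) fun x => (h1 x).symm)
      (ρ.subtypePerm (p := fun x => ¬ p x) fun x => not_congr (h1 x).symm) := by
    ext x
    by_cases hx : p x
    · rw [Perm.subtypeCongr.left_apply _ _ hx]
      rfl
    · rw [Perm.subtypeCongr.right_apply _ _ hx]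
      rfl
  let e : {x // p x} ≃ {x // ¬ p x} := σ.subtypeEquiv fun x => by
    change T x = true ↔ ¬ T (σ x) = true
    rw [hT]
    simp
  have h3 : Perm.sign (ρ.subtypePerm (p := fun x => ¬ p x) fun x => not_congr (h1 x).symm) =
      Perm.sign (ρ.subtypePerm (p := p) fun x => (h1 x).symm) := by
    rw [← Perm.sign_permCongr e (ρ.subtypePerm (p := p) fun x => (h1 x).symm)]
    congr 1
    ext y
    obtain ⟨x, rfl⟩ := e.surjective y
    rw [Equiv.permCongr_apply, Equiv.symm_apply_apply]
    exact hρ x.1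
  rw [h2, Perm.sign_subtypeCongr, h3, Int.units_mul_self]

/-- The sign of a permutation of the half-edges that preserves the edges. -/
theorem sign_eq_of_commute (hσ : ∀ x, σ (σ x) = x) (hT : ∀ x, T (σ x) = !T x)
    (hρ : ∀ x, ρ (σ x) = σ (ρ x)) :
    Perm.sign ρ = (-1 : ℤˣ) ^ tailDiff T (fun x => T (ρ x)) := by
  induction hn : tailDiff T (fun x => T (ρ x)) generalizing ρ with
  | zero =>
    rw [pow_zero]
    refine sign_eq_one_of_commute hT hρ fun x hx => ?_
    by_contra h
    have : IsEmpty {a // T a = true ∧ T (ρ a) = false} := by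
      rcases Nat.card_eq_zero.1 hn with h | h
      · exact h
      · exact absurd (inferInstance : Finite {a // T a = true ∧ T (ρ a) = false}) (by
          rwa [not_finite_iff_infinite])
    exact this.elim ⟨x, hx, by simpa using h⟩
  | succ n ih =>
    obtain ⟨⟨h, h1, h2⟩⟩ : Nonempty {a // T a = true ∧ T (ρ a) = false} :=
      (Nat.card_pos_iff.1 (by change 0 < tailDiff T _; omega)).1
    have hne : ρ h ≠ σ (ρ h) := fun e => by
      have := hT (ρ h)
      rw [← e, h2] at this
      exact absurd this (by simp)
    -- Exchanging the two halves of the edge at `ρ h` repairs one reversed edge, still commutes with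
    -- `σ`, and changes the sign.
    let ρ' : Perm H := Equiv.swap (ρ h) (σ (ρ h)) * ρ
    have hρ' (x : H) : ρ' (σ x) = σ (ρ' x) := by
      have := Equiv.mul_swap_eq_swap_mul σ (ρ h) (σ (ρ h))
      rw [hσ] at this
      have h3 := Equiv.congr_fun this (ρ x)
      simp only [Perm.mul_apply] at h3
      simp only [ρ', Perm.mul_apply]
      rw [h3, hρ, Equiv.swap_comm]
    have ha : ρ' h = σ (ρ h) := by simp [ρ']
    have hb : ρ' (σ h) = ρ h := by rw [hρ', ha, hσ]
    have hc (x : H) (h3 : x ≠ h) (h4 : x ≠ σ h) : ρ' x = ρ x := by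
      simp only [ρ', Perm.mul_apply]
      refine Equiv.swap_apply_of_ne_of_ne (fun e => h3 (ρ.injective e)) fun e => h4 ?_
      rw [← hρ] at e
      exact ρ.injective e
    have hN : tailDiff T (fun x => T (ρ' x)) = n := by
      have key : tailDiff T (fun x => T (ρ x)) = tailDiff T (fun x => T (ρ' x)) + 1 := by
        have e2 : 1 = ∑ x, if x = h then 1 else 0 := by simp
        unfold tailDiff
        rw [e2]
        simp only [natCard_subtype_eq_sum]
        rw [← Finset.sum_add_distrib]
        refine Finset.sum_congr rfl fun x _ => ?_
        by_cases h3 : x = h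
        · subst h3
          simp [h1, h2, ha, hT]
        by_cases h4 : x = σ h
        · subst h4
          simp [hT, h1, h3]
        · simp [hc x h3 h4, h3]
      omega
    have h5 := ih hρ' hN
    simp only [ρ', Perm.sign_mul, Perm.sign_swap hne] at h5
    rw [pow_succ, ← h5]
    simp

end Sign

theorem tailDiff_comp {H : Type} (t t' : H → Bool) (π : Equiv.Perm H) :
    tailDiff (fun x => t (π x)) (fun x => t' (π x)) = tailDiff t t' :=
  Nat.card_congr (π.subtypeEquiv fun _ => Iff.rfl)

/-- The sign of a permutation in a field. -/
def permSign (k : Type v) [Field k] {H : Type} [Fintype H] (π : Equiv.Perm H) : k :=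
  ((Equiv.Perm.sign π : ℤˣ) : ℤ)

theorem permSign_mul {H : Type} [Fintype H] (π ρ : Equiv.Perm H) :
    permSign k (π * ρ) = permSign k π * permSign k ρ := by
  simp [permSign]

/-! ### Contraction of two edges as a function of the edge involution -/

namespace LGraph

open Equiv (Perm)

/-- The sign exponent that compares the direction of an edge with that of a wiring. -/
def _root_.FissionOperad.Wiring.against {H : Type} (w : Wiring H) (p : H) : ℕ :=
  if w.tail p = true then 0 else 1

/-- The contraction of two edges after a change of the edges, in a normalization that does not
depend on the directions of the edges. -/
def edgeTerm (g : LGraph O) (w : Wiring g.1.H) (π : Perm g.1.H) (p q : g.1.H) : GraphSpace O :=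
  permSign k π • (-1 : k) ^ (tailDiff g.1.tail (fun x => w.tail (π x)) + w.against p + w.against q) •
    (g.rewire w).contr2 p q

variable (g : LGraph O)

/-- Redirecting edges changes the contracted class by the same sign as `tailDiff` and `against`
together. Two admissible permutations differ by one that preserves the edges of `g`, whose sign is
the number of edges it reverses by `sign_eq_of_commute`, and this is also the change in `tailDiff`.
-/
theorem edgeTerm_congr {w w' : Wiring g.1.H} (h : w.inv = w'.inv) {π π' : Perm g.1.H}
    (hπ : ∀ x, w.inv (π x) = π (g.1.inv x)) (hπ' : ∀ x, w'.inv (π' x) = π' (g.1.inv x))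
    (p q : g.1.H) : g.edgeTerm w π p q = g.edgeTerm w' π' p q := by
  have e1 : g.edgeTerm w π p q = g.edgeTerm w' π p q := by
    have hp (x : g.1.H) : w'.inv (π x) = π (g.1.inv x) := by rw [← h, hπ]
    unfold edgeTerm
    rw [(Emb.retail g w w' h).contr2_eq Function.surjective_id p q, smul_smul _ _ (contr2 _ _ _),
      ← pow_add, Emb.retail_parity]
    refine congrArg₂ (· • ·) rfl (congrArg₂ (· • ·) (neg_one_pow_congr ?_) rfl)
    have c := tailDiff_cocycle g.1.inv g.1.tail_inv
      (t₁ := fun x => w.tail (π x)) (fun x => by rw [← hπ, w.tail_inv])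
      (t₂ := fun x => w'.tail (π x)) (fun x => by rw [← hp, w'.tail_inv])
    rw [tailDiff_comp] at c
    have r (x : g.1.H) : (w.against x + (Emb.retail g w w' h).reversed x) % 2 =
        w'.against x % 2 := by
      unfold Wiring.against Emb.reversed
      change (_ + if w'.tail x = w.tail x then 0 else 1) % 2 = _
      cases w.tail x <;> cases w'.tail x <;> rfl
    have rp := r p
    have rq := r q
    omega
  have e2 : g.edgeTerm w' π p q = g.edgeTerm w' π' p q := by
    have hp (x : g.1.H) : w'.inv (π x) = π (g.1.inv x) := by rw [← h, hπ]
    let ρ : Perm g.1.H := π⁻¹ * π'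
    have hρ (x : g.1.H) : ρ (g.1.inv x) = g.1.inv (ρ x) := by
      simp only [ρ, Perm.mul_apply]
      rw [Perm.inv_eq_iff_eq, ← hp, ← hπ']
      simp
    have hs := sign_eq_of_commute (σ := g.1.inv) (ρ := ρ) (T := fun x => w'.tail (π x)) g.1.inv_inv
      (fun x => by rw [← hp, w'.tail_inv]) hρ
    have c := tailDiff_cocycle g.1.inv g.1.tail_inv
      (t₁ := fun x => w'.tail (π x)) (fun x => by rw [← hp, w'.tail_inv])
      (t₂ := fun x => w'.tail (π' x)) (fun x => by rw [← hπ', w'.tail_inv])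
    have e3 : (fun x => w'.tail (π (ρ x))) = fun x => w'.tail (π' x) := by
      funext x
      simp [ρ]
    simp only [e3] at hs
    have e4 : permSign k π' =
        permSign k π * (-1) ^ tailDiff (fun x => w'.tail (π x)) fun x => w'.tail (π' x) := by
      have : π' = π * ρ := by simp [ρ]
      rw [this, permSign_mul, ← this]
      congr 1
      rw [permSign, hs]
      simp
    unfold edgeTerm
    rw [e4, smul_smul, smul_smul, mul_assoc, ← pow_add]
    refine congrArg₂ (· • ·) (congrArg₂ (· * ·) rfl (neg_one_pow_congr ?_)) rfl
    omega
  rw [e1, e2]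

theorem edgeTerm_swap (w : Wiring g.1.H) (π : Perm g.1.H) (p q : g.1.H) :
    g.edgeTerm w π q p = -g.edgeTerm w π p q := by
  unfold edgeTerm
  have h1 : (g.rewire w).contr2 q p = -(g.rewire w).contr2 p q := (g.rewire w).contr2_swap q p
  rw [h1, smul_neg, smul_neg, add_right_comm]

theorem edgeTerm_inv (w : Wiring g.1.H) (π : Perm g.1.H) (p q : g.1.H) :
    g.edgeTerm w π (w.inv p) q = g.edgeTerm w π p q := by
  unfold edgeTerm
  have h1 : (g.rewire w).contr2 (w.inv p) q = -(g.rewire w).contr2 p q :=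
    (g.rewire w).contr2_inv_left p q
  rw [h1, ← neg_one_smul k ((g.rewire w).contr2 p q), smul_smul _ (-1 : k), ← pow_succ]
  refine congrArg₂ (· • ·) rfl (congrArg₂ (· • ·) (neg_one_pow_congr ?_) rfl)
  have : (w.against (w.inv p) + 1) % 2 = w.against p % 2 := by
    unfold Wiring.against
    rw [w.tail_inv]
    cases w.tail p <;> rfl
  omega

theorem ncomp_rewire_congr (Γ : OGraph) {w w' : Wiring Γ.H} (h : w.inv = w'.inv) :
    (Γ.rewire w).ncomp = (Γ.rewire w').ncomp := by
  have h1 : (Γ.rewire w).simple = (Γ.rewire w').simple := by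
    ext x y
    change (x ≠ y ∧ ∃ a, Γ.root a = x ∧ Γ.root (w.inv a) = y) ↔
      (x ≠ y ∧ ∃ a, Γ.root a = x ∧ Γ.root (w'.inv a) = y)
    rw [h]
  exact congrArg (fun G : SimpleGraph Γ.V => Nat.card G.ConnectedComponent) h1

/-- The contraction of two edges after a change of the edges that yields `n` components, as a
function of the involution. -/
def edgePairing (n : ℕ) (τ : Perm g.1.H) (p q : g.1.H) : GraphSpace O :=
  -- Any choice gives the same value, by `edgeTerm_congr` and `ncomp_rewire_congr`; without one the
  -- value is zero.
  if h : ∃ e : Wiring g.1.H × Perm g.1.H, e.1.inv = τ ∧ ∀ x, τ (e.2 x) = e.2 (g.1.inv x) then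
    if (g.1.rewire h.choose.1).ncomp = n then g.edgeTerm h.choose.1 h.choose.2 p q else 0
  else 0

theorem edgePairing_eq (n : ℕ) (w : Wiring g.1.H) {π : Perm g.1.H}
    (hπ : ∀ x, w.inv (π x) = π (g.1.inv x)) (p q : g.1.H) : g.edgePairing n w.inv p q =
      if (g.1.rewire w).ncomp = n then g.edgeTerm w π p q else 0 := by
  have h : ∃ e : Wiring g.1.H × Perm g.1.H, e.1.inv = w.inv ∧
    ∀ x, w.inv (e.2 x) = e.2 (g.1.inv x) := ⟨(w, π), rfl, hπ⟩
  rw [edgePairing, dif_pos h, ncomp_rewire_congr g.1 h.choose_spec.1,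
    g.edgeTerm_congr h.choose_spec.1 (fun x => by rw [h.choose_spec.1, h.choose_spec.2]) hπ]

theorem edgePairing_isEdgePairing (n : ℕ) : Polygon.IsEdgePairing (g.edgePairing n) where
  swap τ p q := by
    unfold edgePairing
    split_ifs
    · exact edgeTerm_swap _ _ _ _ _
    · rw [neg_zero]
    · rw [neg_zero]
  inv τ p q := by
    unfold edgePairing
    split_ifs with h
    · have := edgeTerm_inv g h.choose.1 h.choose.2 p q
      rwa [h.choose_spec.1] at this
    · rfl
    · rfl

end LGraph

namespace LGraph

/-! ### Two polygons -/

theorem Emb.ncomp_eq {g g' : LGraph O} (φ : Emb g g') (hv : φ.v.Surjective) :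
    g'.1.ncomp = g.1.ncomp := by
  refine (Nat.card_congr (Equiv.ofBijective φ.comp ⟨φ.comp_injective, fun C => ?_⟩)).symm
  induction C using g'.1.comp_ind with | _ y
  obtain ⟨x, rfl⟩ := hv y
  exact ⟨g.1.compOf x, rfl⟩

theorem ncomp_glue_contract (g : LGraph O) (t : g.1.H)
    (ht : g.1.root t ≠ g.1.root (g.1.inv t)) {n : ℕ} (f : (g.contract t ht).1.EdgeTuple n) :
    ((g.contract t ht).1.glue f).ncomp = (g.1.glue (g.liftTuple t ht f)).ncomp := by
  have hw := g.liftTuple_glue_inv t ht f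
  have ht' : g.1.root t ≠ g.1.root ((g.1.glue (g.liftTuple t ht f)).inv t) := by rwa [hw]
  have hi (a : (g.contract t ht).1.H) :
      (g.1.glue (g.liftTuple t ht f)).inv a.1 = (((g.contract t ht).1.glue f).inv a).1 :=
    OGraph.EdgeTuple.glue_inv_comm (Γ := g.1) (Γ' := (g.contract t ht).1) (fun a => a.1)
      (g.liftTuple t ht f) f Subtype.val_injective (fun _ => rfl) (fun _ => rfl) a
  have h1 := (g.contractRewire t ht (g.liftTuple t ht f).wiring hw ht' f.wiring hi).ncomp_eq
    (g.contractRewire_surjective t ht (g.liftTuple t ht f).wiring hw ht' f.wiring hi)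
  exact h1.trans (ncomp_contract (g.glue (g.liftTuple t ht f)) t ht')

/-- The top part of the polygon boundary of the contraction of `t`, in terms of the graph before
the contraction. -/
def awaySum (g : LGraph O) (t : g.1.H) {n : ℕ} (q : Fin n) : GraphSpace O :=
  ∑ f : g.1.EdgeTuple n,
    if (∀ s, f.1 s ≠ t ∧ f.1 s ≠ g.1.inv t) ∧ (g.1.glue f).ncomp + 1 = g.1.ncomp + n then
      (-1 : k) ^ f.flips • (g.glue f).contr2 t (f.1 q)
    else 0

theorem awaySum_of_loop (g : LGraph O) (t : g.1.H) (ht : g.1.root t = g.1.root (g.1.inv t)) {n : ℕ}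
    (q : Fin n) : g.awaySum t q = 0 := by
  refine Finset.sum_eq_zero fun f _ => ?_
  split_ifs with h
  · have hw : (g.1.glue f).inv t = g.1.inv t := by
      refine OGraph.EdgeTuple.glue_inv_of_notMem _ (fun m => (h.1 m).1) fun m e => (h.1 m).2 ?_
      rw [← e, g.1.inv_inv]
    have h0 : (g.glue f).contr2 t (f.1 q) = 0 := contr2_eq_zero_of_loop (g.glue f) t _ (by
      change g.1.root t = g.1.root ((g.1.glue f).inv t)
      rw [hw, ht])
    rw [h0, smul_zero]
  · rfl

/-- The edge tuples of the contracted graph are those of `g` that avoid the contracted edge, and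
contraction does not change the number of components. -/
theorem smul_topSum_contract (g : LGraph O) (t : g.1.H) (ht : g.1.root t ≠ g.1.root (g.1.inv t))
    {n : ℕ} (q : Fin n) :
    (-1 : k) ^ g.1.contractParity t • (g.contract t ht).topSum q = g.awaySum t q := by
  unfold topSum awaySum
  rw [Finset.smul_sum]
  refine Fintype.sum_of_injective (g.liftTuple t ht) ?_ _ _ ?_ ?_
  · intro f f' e
    exact Subtype.ext (DFunLike.ext _ _ fun m =>
      Subtype.ext (congrArg (fun c : g.1.EdgeTuple n => c.1 m) e))
  · intro f hf
    refine if_neg fun h => hf ?_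
    exact ⟨⟨⟨fun m => ⟨f.1 m, h.1 m⟩, fun i j e => f.1.injective (congrArg Subtype.val e)⟩,
      fun i j e => f.2 i j (congrArg Subtype.val e)⟩, rfl⟩
  · intro f
    have h1 : (((g.contract t ht).1.glue f).ncomp + 1 = (g.contract t ht).1.ncomp + n) ↔
        (∀ s, (g.liftTuple t ht f).1 s ≠ t ∧ (g.liftTuple t ht f).1 s ≠ g.1.inv t) ∧
          (g.1.glue (g.liftTuple t ht f)).ncomp + 1 = g.1.ncomp + n := by
      rw [ncomp_glue_contract, ncomp_contract]
      exact ⟨fun h => ⟨fun s => (f.1 s).2, h⟩, fun h => h.2⟩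
    by_cases h : ((g.contract t ht).1.glue f).ncomp + 1 = (g.contract t ht).1.ncomp + n
    · rw [if_pos h, if_pos (h1.1 h), smul_glueTerm_contract]
    · rw [if_neg h, if_neg (fun h' => h (h1.2 h')), smul_zero]

theorem apply_splitMap_contrCls {i : ℕ+} {D : SymPrim O →ₗ[k] SymPrim O} (hD : IsFission O i D)
    (g : LGraph O) (t : g.1.H) : D (splitMap O (g.contrCls t)) =
      (1 / 2 : k) • splitMap O (g.awaySum t (finRotate i ⟨0, i.pos⟩)) := by
  by_cases ht : g.1.root t = g.1.root (g.1.inv t)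
  · rw [contrCls_of_eq g t ht, awaySum_of_loop g t ht, map_zero, map_zero, smul_zero]
  · rw [contrCls_of_ne g t ht, ← smul_topSum_contract g t ht, map_smul, map_smul, map_smul,
      splitMap_cls, apply_split hD, smul_comm]

/-- The sum over the pairs of polygons that create as many components as possible. -/
def doubleSum (g : LGraph O) {m n : ℕ} (p : Fin m) (q : Fin n) : GraphSpace O :=
  ∑ d : g.1.EdgeTuple m, if (g.1.glue d).ncomp + 1 = g.1.ncomp + m then
    (-1 : k) ^ d.flips • (g.glue d).awaySum (d.1 p) q else 0

theorem apply_apply_gen {i j : ℕ+} {D D' : SymPrim O →ₗ[k] SymPrim O} (hD : IsFission O i D)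
    (hD' : IsFission O j D') (g : LGraph O) (hg : g.1.IsConnected) :
    D' (D (g.gen hg)) = (1 / 2 * (1 / 2) : k) •
      splitMap O (g.doubleSum (finRotate i ⟨0, i.pos⟩) (finRotate j ⟨0, j.pos⟩)) := by
  rw [hD.2, fission_of_isConnected hg, map_smul, mul_smul, topSum, doubleSum]
  congr 1
  rw [map_sum, map_sum, map_sum, Finset.smul_sum]
  refine Finset.sum_congr rfl fun d _ => ?_
  split_ifs
  · rw [glueTerm, map_smul, map_smul, map_smul, smul_comm]
    congr 1
    exact apply_splitMap_contrCls hD' (g.glue d) _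
  · rw [map_zero, map_zero, smul_zero]

end LGraph

/-! ### From pairs of glued graphs to tuples of half-edges -/

open FissionOperad.Polygon

namespace OGraph

variable {Γ : OGraph} {n : ℕ}

theorem EdgeTuple.cycle_eq_cyc (d : Γ.EdgeTuple n) : d.cycle = cyc d.1 := by
  rw [cyc, dif_pos d.1.injective]
  rfl

theorem glue_inv_eq_reglue (d : Γ.EdgeTuple n) : (Γ.glue d).inv = reglue Γ.inv d.1 := by
  rw [reglue, ← d.cycle_eq_cyc]
  rfl

theorem EdgeTuple.isTuple (d : Γ.EdgeTuple n) : IsTuple Γ.inv d.1 := ⟨d.1.injective, d.2⟩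

theorem exists_edgeTuple {d : Fin n → Γ.H} (hd : IsTuple Γ.inv d) :
    ∃ d' : Γ.EdgeTuple n, (d'.1 : Fin n → Γ.H) = d := ⟨⟨⟨d, hd.1⟩, hd.2⟩, rfl⟩

theorem EdgeTuple.permSign_cycle {a : ℕ} (d : Γ.EdgeTuple (a + 1)) :
    permSign k d.cycle = (-1) ^ a := by
  rw [permSign, cycle, Equiv.Perm.viaFintypeEmbedding_sign, sign_finRotate]
  simp

/-- The permutation of the half-edges by which two polygons are glued. -/
def EdgeTuple.cycle₂ {m : ℕ} (d : Γ.EdgeTuple m) (f : (Γ.glue d).EdgeTuple n) : Equiv.Perm Γ.H :=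
  (show Equiv.Perm Γ.H from f.cycle) * d.cycle

/-- The edges after two polygons have been glued. -/
def EdgeTuple.wiring₂ {m : ℕ} (d : Γ.EdgeTuple m) (f : (Γ.glue d).EdgeTuple n) : Wiring Γ.H :=
  f.wiring

theorem EdgeTuple.glue_inv_cycle (d : Γ.EdgeTuple n) (x : Γ.H) :
    (Γ.glue d).inv (d.cycle x) = d.cycle (Γ.inv x) := by
  rw [glue_inv, Equiv.symm_apply_apply]

theorem EdgeTuple.wiring₂_inv_cycle₂ {m : ℕ} (d : Γ.EdgeTuple m) (f : (Γ.glue d).EdgeTuple n)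
    (x : Γ.H) : (d.wiring₂ f).inv (d.cycle₂ f x) = d.cycle₂ f (Γ.inv x) :=
  (f.glue_inv_cycle (d.cycle x)).trans (congrArg f.cycle (d.glue_inv_cycle x))

theorem EdgeTuple.wiring₂_inv {m : ℕ} (d : Γ.EdgeTuple m) (f : (Γ.glue d).EdgeTuple n) :
    (d.wiring₂ f).inv = reglue (reglue Γ.inv d.1) f.1 := by
  rw [← glue_inv_eq_reglue d]
  exact glue_inv_eq_reglue f

/-- Each cycle moves only half-edges that are tails after its own redirection, so pulling directions
back along it loses nothing. The cocycle rule then separates the two redirections. -/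
theorem EdgeTuple.tailDiff_wiring₂ {m : ℕ} (d : Γ.EdgeTuple m) (f : (Γ.glue d).EdgeTuple n) :
    tailDiff Γ.tail (fun x => (d.wiring₂ f).tail (d.cycle₂ f x)) % 2 = (d.flips + f.flips) % 2 := by
  have e1 : (fun x => (d.wiring₂ f).tail (d.cycle₂ f x)) = fun x => f.tail (d.cycle x) :=
    funext fun x => f.tail_cycle (d.cycle x)
  have e2 : d.tail = fun x => d.tail (d.cycle x) := funext fun x => (d.tail_cycle x).symm
  have c := tailDiff_cocycle Γ.inv Γ.tail_inv (t₁ := d.tail) d.tail_inv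
    (t₂ := fun x => (d.wiring₂ f).tail (d.cycle₂ f x))
    (fun x => by rw [← d.wiring₂_inv_cycle₂, (d.wiring₂ f).tail_inv])
  have e3 : tailDiff d.tail (fun x => (d.wiring₂ f).tail (d.cycle₂ f x)) = f.flips := by
    rw [e1, f.flips_eq_tailDiff]
    nth_rewrite 1 [e2]
    exact tailDiff_comp d.tail f.tail d.cycle
  rw [e3, ← d.flips_eq_tailDiff] at c
  exact c.symm

theorem EdgeTuple.permSign_cycle₂ {a b : ℕ} (d : Γ.EdgeTuple (a + 1))
    (f : (Γ.glue d).EdgeTuple (b + 1)) : permSign k (d.cycle₂ f) = (-1) ^ (a + b) := by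
  rw [cycle₂, permSign_mul, pow_add, mul_comm]
  exact congrArg₂ (· * ·) d.permSign_cycle f.permSign_cycle

end OGraph

namespace LGraph

variable (g : LGraph O) {a b : ℕ}

/-- The factor `(-1) ^ (a + b)` is the sign of two cycles of lengths `a + 1` and `b + 1`. It does
not depend on which polygon comes first, so it is harmless. -/
theorem pairTerm_edgePairing (d : g.1.EdgeTuple (a + 1)) (f : (g.1.glue d).EdgeTuple (b + 1)) :
    pairTerm g.1.inv (g.edgePairing (g.1.ncomp + a + b)) d.1 f.1 =
      (-1 : k) ^ (a + b) • if (g.1.glue d).ncomp + 1 = g.1.ncomp + (a + 1) ∧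
          (∀ s, f.1 s ≠ d.1 1 ∧ f.1 s ≠ (g.1.glue d).inv (d.1 1)) ∧
            ((g.1.glue d).glue f).ncomp + 1 = (g.1.glue d).ncomp + (b + 1) then
        (-1 : k) ^ (d.flips + f.flips) • ((g.glue d).glue f).contr2 (d.1 1) (f.1 1) else 0 := by
  have hi := OGraph.glue_inv_eq_reglue d
  have hA : Admissible g.1.inv d.1 f.1 ↔
      ∀ s, f.1 s ≠ d.1 1 ∧ f.1 s ≠ (g.1.glue d).inv (d.1 1) := by
    refine ⟨fun h s => ?_, fun h => ⟨d.isTuple, hi ▸ f.isTuple, fun s => ?_⟩⟩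
    · have := h.away s
      rwa [← hi] at this
    · exact ⟨(h s).1, fun e => (h s).2 (e.trans (Equiv.congr_fun hi _).symm)⟩
  -- Neither gluing can exceed its bound, so the total is extremal if and only if both gluings are.
  have hN : ((g.1.glue d).ncomp + 1 = g.1.ncomp + (a + 1) ∧
      ((g.1.glue d).glue f).ncomp + 1 = (g.1.glue d).ncomp + (b + 1)) ↔
        ((g.1.glue d).glue f).ncomp = g.1.ncomp + a + b := by
    have h1 := OGraph.ncomp_glue_le d a.succ_pos
    have h2 := OGraph.ncomp_glue_le f b.succ_pos
    omega
  by_cases hw : ∀ s, f.1 s ≠ d.1 1 ∧ f.1 s ≠ (g.1.glue d).inv (d.1 1)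
  · have hF := g.edgePairing_eq (g.1.ncomp + a + b) (d.wiring₂ f) (d.wiring₂_inv_cycle₂ f)
      (d.1 1) (f.1 1)
    -- The first gluing makes `d.1 1` a tail, and the second polygon avoids its edge.
    have hp1 : (d.wiring₂ f).against (d.1 1) = 0 := by
      refine if_pos ?_
      change f.tail (d.1 1) = true
      rw [f.tail_of_notMem (fun s => (hw s).1), show (g.1.glue d).tail (d.1 1) = d.tail (d.1 1) from rfl,
        d.tail_apply]
      intro s e
      refine (hw s).2 ?_
      rw [← e, (g.1.glue d).inv_inv]
    have hp2 : (d.wiring₂ f).against (f.1 1) = 0 := if_pos (f.tail_apply 1)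
    rw [d.wiring₂_inv f] at hF
    refine (if_pos (hA.2 hw)).trans (hF.trans ?_)
    have hc : (g.1.rewire (d.wiring₂ f)).ncomp = ((g.1.glue d).glue f).ncomp := rfl
    by_cases hn : ((g.1.glue d).glue f).ncomp = g.1.ncomp + a + b
    · rw [hc, if_pos hn, if_pos ⟨(hN.2 hn).1, hw, (hN.2 hn).2⟩]
      refine congrArg₂ (· • ·) (d.permSign_cycle₂ f) (congrArg₂ (· • ·) ?_ rfl)
      rw [hp1, hp2]
      exact neg_one_pow_congr (d.tailDiff_wiring₂ f)
    · rw [hc, if_neg hn, if_neg (fun h => hn (hN.1 ⟨h.1, h.2.2⟩)), smul_zero]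
  · rw [if_neg (fun h => hw h.2.1), smul_zero]
    exact if_neg fun h => hw (hA.1 h)

theorem sum_pairTerm_edgePairing :
    ∑ e : (Fin (a + 1) → g.1.H) × (Fin (b + 1) → g.1.H),
      pairTerm g.1.inv (g.edgePairing (g.1.ncomp + a + b)) e.1 e.2 =
        (-1 : k) ^ (a + b) • g.doubleSum (1 : Fin (a + 1)) (1 : Fin (b + 1)) := by
  rw [Fintype.sum_prod_type, doubleSum, Finset.smul_sum]
  symm
  refine Fintype.sum_of_injective (fun d : g.1.EdgeTuple (a + 1) => (d.1 : Fin (a + 1) → g.1.H))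
    (fun d d' e => Subtype.ext (DFunLike.coe_injective e)) _ _ ?_ fun d => ?_
  · intro d hd
    refine Finset.sum_eq_zero fun f _ => if_neg fun h => hd ?_
    exact OGraph.exists_edgeTuple h.left
  · have h1 : ∑ f : Fin (b + 1) → g.1.H,
        pairTerm g.1.inv (g.edgePairing (g.1.ncomp + a + b)) d.1 f =
          ∑ f : (g.1.glue d).EdgeTuple (b + 1),
            pairTerm g.1.inv (g.edgePairing (g.1.ncomp + a + b)) d.1 f.1 := by
      symm
      refine Fintype.sum_of_injective
        (fun f : (g.1.glue d).EdgeTuple (b + 1) => (f.1 : Fin (b + 1) → g.1.H))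
        (fun d d' e => Subtype.ext (DFunLike.coe_injective e)) _ _ ?_ fun _ => rfl
      intro f hf
      refine if_neg fun h => hf ?_
      have h2 := h.right
      rw [← OGraph.glue_inv_eq_reglue d] at h2
      exact OGraph.exists_edgeTuple h2
    rw [h1, Finset.sum_congr rfl fun f _ => g.pairTerm_edgePairing d f, ← Finset.smul_sum]
    congr 1
    by_cases h : (g.1.glue d).ncomp + 1 = g.1.ncomp + (a + 1)
    · rw [if_pos h]
      refine (Finset.smul_sum (N := GraphSpace O) (r := (-1 : k) ^ d.flips)).trans ?_
      refine Finset.sum_congr rfl fun f _ => ?_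
      by_cases h' : (∀ s, f.1 s ≠ d.1 1 ∧ f.1 s ≠ (g.1.glue d).inv (d.1 1)) ∧
            ((g.1.glue d).glue f).ncomp + 1 = (g.1.glue d).ncomp + (b + 1)
      · refine (congrArg _ (if_pos h')).trans ((if_pos (And.intro h h')).trans ?_).symm
        rw [pow_add, mul_smul]
        rfl
      · exact ((congrArg _ (if_neg h')).trans (smul_zero _)).trans
          (if_neg fun h2 => h' h2.2).symm
    · rw [if_neg h]
      exact (Finset.sum_eq_zero fun f _ => if_neg fun h2 => h h2.1).symm

/-- A nonzero value means that both gluings are extremal. Then the edges of the second polygon lie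
in one component, while the new edges of the first lie in different components, so only one of these
can be used. -/
theorem separated_edgePairing :
    Separated g.1.inv (g.edgePairing (g.1.ncomp + a + b)) a b := by
  intro d₀ f₀ hd hf p q hF s s' m m' h h'
  obtain ⟨d, rfl⟩ := OGraph.exists_edgeTuple hd
  have hi := OGraph.glue_inv_eq_reglue d
  rw [← hi] at hf h h'
  obtain ⟨f, rfl⟩ := OGraph.exists_edgeTuple hf
  have hn : ((g.1.glue d).glue f).ncomp = g.1.ncomp + a + b := by
    by_contra hn
    refine hF ?_
    rw [← d.wiring₂_inv f, g.edgePairing_eq _ _ (d.wiring₂_inv_cycle₂ f)]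
    exact if_neg hn
  have h1 := OGraph.ncomp_glue_le d a.succ_pos
  have h2 := OGraph.ncomp_glue_le f b.succ_pos
  have hf' := OGraph.compOf_eq_of_ncomp_glue f (by omega) s s'
  have key (s : Fin (b + 1)) (m : Fin (a + 1))
      (h : f.1 s = d.1 m ∨ f.1 s = (g.1.glue d).inv (d.1 m)) :
      (g.1.glue d).compOf (g.1.root (f.1 s)) = (g.1.glue d).compOf (g.1.root (d.1 m)) := by
    rcases h with h | h
    · rw [h]
    · rw [h]
      exact (g.1.glue d).compOf_inv (d.1 m)
  exact OGraph.compOf_glue_injective d (by omega) ((key s m h).symm.trans (hf'.trans (key s' m' h')))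

theorem doubleSum_add (h2 : (2 : k) ≠ 0) :
    g.doubleSum (1 : Fin (a + 1)) (1 : Fin (b + 1)) +
      g.doubleSum (1 : Fin (b + 1)) (1 : Fin (a + 1)) = 0 := by
  have h2' (x : GraphSpace O) (hx : x = -x) : x = 0 := by
    have : (2 : k) • x = 0 := by
      rw [two_smul]
      nth_rewrite 2 [hx]
      exact add_neg_cancel x
    exact (smul_eq_zero.1 this).resolve_left h2
  have hab : g.1.ncomp + b + a = g.1.ncomp + a + b := by omega
  have h := sum_pairTerm_add h2' g.1.inv_inv (g.edgePairing_isEdgePairing (g.1.ncomp + a + b))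
    g.separated_edgePairing (hab ▸ g.separated_edgePairing (a := b) (b := a))
  rw [g.sum_pairTerm_edgePairing] at h
  rw [← hab, g.sum_pairTerm_edgePairing, add_comm b a, ← smul_add] at h
  exact (smul_eq_zero.1 h).resolve_left (pow_ne_zero _ (neg_ne_zero.2 one_ne_zero))

end LGraph

/-- The fission operators anticommute. -/
theorem IsFission.anticomm (h2 : (2 : k) ≠ 0) {i j : ℕ+} {D D' : SymPrim O →ₗ[k] SymPrim O}
    (hD : IsFission O i D) (hD' : IsFission O j D') (s : SymPrim O) : D (D' s) + D' (D s) = 0 := by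
  refine hD.1.anticomm hD'.1 (fun g n h => ?_) (fun g n h => ?_) (fun g => ?_) s
  · rw [hD.2]
    exact g.1.fission_mem i h
  · rw [hD'.2]
    exact g.1.fission_mem j h
  · rw [LGraph.apply_apply_gen hD hD', LGraph.apply_apply_gen hD' hD, ← smul_add, ← map_add]
    have key : g.1.doubleSum (finRotate j ⟨0, j.pos⟩) (finRotate i ⟨0, i.pos⟩) +
        g.1.doubleSum (finRotate i ⟨0, i.pos⟩) (finRotate j ⟨0, j.pos⟩) = 0 := by
      obtain ⟨i, hi⟩ := i
      obtain ⟨j, hj⟩ := j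
      obtain ⟨a, rfl⟩ := Nat.exists_eq_succ_of_ne_zero hi.ne'
      obtain ⟨b, rfl⟩ := Nat.exists_eq_succ_of_ne_zero hj.ne'
      -- For the bigon, `n = 0`, the element `1` of `Fin 1` is `0` again.
      have r (n : ℕ) : finRotate (n + 1) 0 = 1 := by rw [finRotate_apply, zero_add]
      have h := g.1.doubleSum_add (a := b) (b := a) h2
      rw [← r, ← r] at h
      exact h
    rw [key, map_zero, smul_zero]

/-! ## Sums of fission operators -/

theorem symProj_symProj (i j : ℕ) (s : SymPrim O) :
    symProj O i (symProj O j s) = if i = j then symProj O j s else 0 := by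
  refine symPrim_induction
    (P := fun s => symProj O i (symProj O j s) = if i = j then symProj O j s else 0) ?_ ?_ ?_ ?_ s
  · intro l
    rw [symProj_genProd]
    by_cases h : l.length = j
    · rw [if_pos h, symProj_genProd, h]
      simp only [eq_comm]
    · rw [if_neg h, map_zero, ite_self]
  · simp
  · intro a b ha hb
    rw [map_add, map_add, ha, hb]
    split_ifs <;> simp
  · intro c a ha
    rw [map_smul, map_smul, ha]
    split_ifs <;> simp

namespace IsFission

variable {i : ℕ+} {D : SymPrim O →ₗ[k] SymPrim O}

/-- Word length is what tells the different fission operators apart inside a sum. -/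
theorem symProj_gen (hD : IsFission O i D) (g : ConnGraph O) (j : ℕ) :
    symProj O j (D (g.1.gen g.2)) = if j = i then D (g.1.gen g.2) else 0 := by
  rw [hD.2, LGraph.fission, map_smul, symProj_symProj]
  split_ifs
  · rfl
  · rw [smul_zero]

theorem map_gen_mem (hD : IsFission O i D) (g : ConnGraph O) (n : ℕ) (h : g.1.nverts = n + 1) :
    D (g.1.gen g.2) ∈ symDeg O n := by
  rw [hD.2]
  exact g.1.fission_mem i h

/-- There are no tuples of `i` directed edges on fewer than `i` half-edges; this is the source of
local finiteness. -/
theorem map_gen_eq_zero (hD : IsFission O i D) (g : ConnGraph O) (h : Nat.card g.1.1.H < i) :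
    D (g.1.gen g.2) = 0 := by
  have : IsEmpty (g.1.1.EdgeTuple i) := ⟨fun d => by
    have := Nat.card_le_card_of_injective _ d.1.injective
    rw [Nat.card_fin] at this
    omega⟩
  rw [hD.2, LGraph.fission_of_isConnected g.2, LGraph.topSum, Finset.univ_eq_empty,
    Finset.sum_empty, map_zero, smul_zero]

theorem exists_gen_ne_zero (hD : IsFission O i D) (h : D ≠ 0) :
    ∃ g : ConnGraph O, D (g.1.gen g.2) ≠ 0 := by
  by_contra! h'
  exact h (hD.1.ext (fun n a b _ => by simp) h')

end IsFission

variable {θ : ℕ+ → (SymPrim O →ₗ[k] SymPrim O)}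

theorem finite_fission_ne_zero (hθ : ∀ i, IsFission O i (θ i)) (s : SymPrim O) :
    {i | θ i s ≠ 0}.Finite := by
  refine symPrim_induction (P := fun s => {i | θ i s ≠ 0}.Finite) ?_ ?_ ?_ ?_ s
  · intro l
    induction l with
    | nil =>
      convert Set.finite_empty
      ext i
      simp [(hθ i).1.map_one_eq_zero]
    | cons g l ih =>
      have h1 : {i : ℕ+ | θ i (g.1.gen g.2) ≠ 0}.Finite := by
        refine (Set.finite_le_nat (Nat.card g.1.1.H)).preimage PNat.coe_injective.injOn |>.subset
          fun i hi => ?_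
        by_contra h
        exact hi ((hθ i).map_gen_eq_zero g (not_le.1 h))
      refine (h1.union ih).subset fun i hi => ?_
      by_contra h
      simp only [Set.mem_union, Set.mem_ofPred_eq, not_or, not_not] at h
      exact hi (by rw [(hθ i).1.genProd_cons, h.1, h.2, zero_mul, mul_zero, smul_zero, add_zero])
  · simp
  · intro a b ha hb
    refine (ha.union hb).subset fun i hi => ?_
    by_contra h
    simp only [Set.mem_union, Set.mem_ofPred_eq, not_or, not_not] at h
    exact hi (by rw [map_add, h.1, h.2, add_zero])
  · intro c a ha
    exact ha.subset fun i hi h => hi (by rw [map_smul, h, smul_zero])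

section LocallyFinite

variable {ι M : Type*} [AddCommGroup M] [Module k M] {f : ι → M →ₗ[k] M}

theorem finsum_mem_apply_eq_sum (I : Set ι) {s : M} {T : Finset ι} (hT : ∀ i ∉ T, f i s = 0) :
    ∑ᶠ i ∈ I, f i s = ∑ i ∈ T, if i ∈ I then f i s else 0 := by
  rw [finsum_mem_def, finsum_eq_sum_of_support_subset]
  · exact Finset.sum_congr rfl fun i _ => Set.indicator_apply _ _ _
  · intro i hi
    by_contra h
    refine hi ?_
    rw [Set.indicator_apply, hT i h, ite_self]

theorem exists_finset (hf : ∀ s, {i | f i s ≠ 0}.Finite) (A : Finset M) :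
    ∃ T : Finset ι, ∀ s ∈ A, ∀ i ∉ T, f i s = 0 := by
  refine ⟨(A.finite_toSet.biUnion fun s _ => hf s).toFinset, fun s hs i hi => ?_⟩
  by_contra h
  exact hi ((Set.Finite.mem_toFinset _).2 (Set.mem_biUnion hs h))

/-- The sum of the members of a locally finite family of linear maps with index in `I`. -/
def locallyFiniteSum (f : ι → M →ₗ[k] M) (hf : ∀ s, {i | f i s ≠ 0}.Finite) (I : Set ι) :
    M →ₗ[k] M where
  toFun s := ∑ᶠ i ∈ I, f i s
  map_add' a b := by
    obtain ⟨T, hT⟩ := exists_finset hf {a, b, a + b}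
    rw [finsum_mem_apply_eq_sum I (hT a (by simp)), finsum_mem_apply_eq_sum I (hT b (by simp)),
      finsum_mem_apply_eq_sum I (hT (a + b) (by simp)), ← Finset.sum_add_distrib]
    refine Finset.sum_congr rfl fun i _ => ?_
    split_ifs <;> simp
  map_smul' c a := by
    obtain ⟨T, hT⟩ := exists_finset hf {a, c • a}
    rw [finsum_mem_apply_eq_sum I (hT a (by simp)),
      finsum_mem_apply_eq_sum I (hT (c • a) (by simp)), RingHom.id_apply, Finset.smul_sum]
    refine Finset.sum_congr rfl fun i _ => ?_
    split_ifs <;> simp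

variable (hf : ∀ s, {i | f i s ≠ 0}.Finite) (I : Set ι)

theorem locallyFiniteSum_apply {s : M} {T : Finset ι} (hT : ∀ i ∉ T, f i s = 0) :
    locallyFiniteSum f hf I s = ∑ i ∈ T, if i ∈ I then f i s else 0 :=
  finsum_mem_apply_eq_sum I hT

/-- Twice the square is a sum of anticommutators, once the double sum is added to its transpose. -/
theorem locallyFiniteSum_sq (h2 : (2 : k) ≠ 0) (hanti : ∀ i j s, f i (f j s) + f j (f i s) = 0) :
    locallyFiniteSum f hf I ∘ₗ locallyFiniteSum f hf I = 0 := by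
  refine LinearMap.ext fun s => ?_
  obtain ⟨T, hT⟩ := exists_finset hf {s}
  have hT := hT s (Finset.mem_singleton_self s)
  obtain ⟨T', hT'⟩ := exists_finset hf (T.image fun j => f j s)
  have e1 : locallyFiniteSum f hf I s = ∑ j ∈ T, if j ∈ I then f j s else 0 :=
    locallyFiniteSum_apply hf I hT
  -- `T` contains every index acting nontrivially on `s`, and `T'` every index acting nontrivially
  -- on some `f j s` with `j ∈ T`. Using one set for both sums allows the transposition.
  let U := T ∪ T'
  have hU (i) (hi : i ∉ U) (j) : f i (f j s) = 0 := by
    rw [Finset.mem_union, not_or] at hi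
    by_cases hj : j ∈ T
    · exact hT' _ (Finset.mem_image_of_mem _ hj) i hi.2
    · rw [hT j hj, map_zero]
  have e2 : locallyFiniteSum f hf I s = ∑ j ∈ U, if j ∈ I then f j s else 0 :=
    locallyFiniteSum_apply hf I fun i hi => hT i fun h => hi (Finset.mem_union_left _ h)
  have e3 : locallyFiniteSum f hf I (locallyFiniteSum f hf I s) =
      ∑ i ∈ U, ∑ j ∈ U, if i ∈ I ∧ j ∈ I then f i (f j s) else 0 := by
    rw [locallyFiniteSum_apply hf I (T := U)]
    · refine Finset.sum_congr rfl fun i _ => ?_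
      rw [e2, map_sum]
      by_cases hi : i ∈ I
      · rw [if_pos hi]
        refine Finset.sum_congr rfl fun j _ => ?_
        by_cases hj : j ∈ I <;> simp [hi, hj]
      · simp [hi]
    · intro i hi
      rw [e2, map_sum]
      refine Finset.sum_eq_zero fun j _ => ?_
      split_ifs
      · exact hU i hi j
      · exact map_zero _
  change locallyFiniteSum f hf I (locallyFiniteSum f hf I s) = 0
  have h : (2 : k) • locallyFiniteSum f hf I (locallyFiniteSum f hf I s) = 0 := by
    rw [two_smul, e3]
    nth_rewrite 2 [Finset.sum_comm]
    simp only [← Finset.sum_add_distrib]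
    refine Finset.sum_eq_zero fun i _ => Finset.sum_eq_zero fun j _ => ?_
    by_cases hi : i ∈ I <;> by_cases hj : j ∈ I <;> simp [hi, hj, hanti]
  exact (smul_eq_zero.1 h).resolve_left h2

theorem locallyFiniteSum_congr {J : Set ι} (h : ∀ i, f i ≠ 0 → (i ∈ I ↔ i ∈ J)) :
    locallyFiniteSum f hf I = locallyFiniteSum f hf J := by
  refine LinearMap.ext fun s => ?_
  obtain ⟨T, hT⟩ := exists_finset hf {s}
  have hT := hT s (Finset.mem_singleton_self s)
  rw [locallyFiniteSum_apply hf I hT, locallyFiniteSum_apply hf J hT]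
  refine Finset.sum_congr rfl fun i _ => ?_
  by_cases hi : f i = 0
  · simp [hi]
  · simp only [h i hi]

/-- The value `F I` amounts to `I ∩ S`, so the range is a copy of the power set of `S`: finite for
finite `S`, uncountable by Cantor's theorem otherwise. -/
theorem infinite_iff_not_countable_range {α : Type*} {S : Set ι} {F : Set ι → α}
    (h : ∀ I J, F I = F J ↔ ∀ i ∈ S, (i ∈ I ↔ i ∈ J)) :
    S.Infinite ↔ ¬ (Set.range F).Countable := by
  constructor
  · intro hS hc
    have : Infinite S := hS.to_subtype
    have : Countable (Set.range F) := hc.to_subtype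
    let φ (A : Set S) : Set.range F := ⟨F (Subtype.val '' A), _, rfl⟩
    have hφ : φ.Injective := fun A B e => by
      ext i
      have := (h _ _).1 (congrArg Subtype.val e) i.1 i.2
      simpa using this
    have : Countable (Set S) := hφ.countable
    obtain ⟨e, he⟩ := exists_injective_nat (Set S)
    exact Function.cantor_injective _ ((Infinite.natEmbedding S).injective.comp he)
  · intro hc hS
    refine hc (Set.Countable.mono ?_ (hS.finite_subsets.image F).countable)
    rintro _ ⟨I, rfl⟩
    exact ⟨I ∩ S, Set.inter_subset_right, (h _ _).2 fun i hi => by simp [hi]⟩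

end LocallyFinite

theorem isCoLieInfty_locallyFiniteSum (h2 : (2 : k) ≠ 0) (hθ : ∀ i, IsFission O i (θ i))
    (hf : ∀ s, {i | θ i s ≠ 0}.Finite) (I : Set ℕ+) :
    IsCoLieInfty O (locallyFiniteSum θ hf I) := by
  have hD : IsOddDerivation O (locallyFiniteSum θ hf I) := by
    intro n a b ha
    obtain ⟨T, hT⟩ := exists_finset hf {a, b, a * b}
    rw [locallyFiniteSum_apply hf I (hT a (by simp)), locallyFiniteSum_apply hf I (hT b (by simp)),
      locallyFiniteSum_apply hf I (hT (a * b) (by simp)), Finset.sum_mul, Finset.mul_sum,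
      Finset.smul_sum, ← Finset.sum_add_distrib]
    refine Finset.sum_congr rfl fun i _ => ?_
    split_ifs
    · exact (hθ i).1 n a b ha
    · simp
  refine ⟨hD, fun s => hD.map_symDeg_zero, fun n s => hD.map_mem_symDeg (fun g n h => ?_) n,
    fun x => ?_, locallyFiniteSum_sq hf I h2 fun i j s => (hθ i).anticomm h2 (hθ j) s⟩
  · obtain ⟨T, hT⟩ := exists_finset hf {g.1.gen g.2}
    rw [locallyFiniteSum_apply hf I (hT _ (Finset.mem_singleton_self _))]
    refine Submodule.sum_mem _ fun i _ => ?_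
    split_ifs
    · exact (hθ i).map_gen_mem g n h
    · exact zero_mem _
  · refine prim_induction
      (P := fun x => symProj O 0 (locallyFiniteSum θ hf I (incl O x)) = 0) (fun g => ?_) ?_ ?_ ?_ x
    · obtain ⟨T, hT⟩ := exists_finset hf {g.1.gen g.2}
      have h1 := locallyFiniteSum_apply hf I (hT _ (Finset.mem_singleton_self _))
      refine (congrArg _ h1).trans ?_
      rw [map_sum]
      refine Finset.sum_eq_zero fun i _ => ?_
      split_ifs
      · rw [(hθ i).symProj_gen, if_neg i.pos.ne]
      · exact map_zero _
    · simp
    · intro a b ha hb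
      rw [map_add, map_add, map_add, ha, hb, add_zero]
    · intro c a ha
      rw [map_smul, map_smul, map_smul, ha, smul_zero]

/-- On a connected graph that `θ i` does not kill, the part of word length `i` of the sum over `I`
is nonzero exactly when `i` belongs to `I`. -/
theorem locallyFiniteSum_eq_iff (hθ : ∀ i, IsFission O i (θ i))
    (hf : ∀ s, {i | θ i s ≠ 0}.Finite) (I J : Set ℕ+) :
    locallyFiniteSum θ hf I = locallyFiniteSum θ hf J ↔ ∀ i, θ i ≠ 0 → (i ∈ I ↔ i ∈ J) := by
  refine ⟨fun h i hi => ?_, locallyFiniteSum_congr hf I⟩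
  obtain ⟨g, hg⟩ := (hθ i).exists_gen_ne_zero hi
  have key (I : Set ℕ+) : symProj O i (locallyFiniteSum θ hf I (g.1.gen g.2)) =
      if i ∈ I then θ i (g.1.gen g.2) else 0 := by
    obtain ⟨T, hT⟩ := exists_finset hf {g.1.gen g.2}
    have hT := hT _ (Finset.mem_singleton_self _)
    have hiT : i ∈ T := by
      by_contra h
      exact hg (hT i h)
    rw [locallyFiniteSum_apply hf I hT, map_sum, Finset.sum_eq_single i]
    · split_ifs
      · rw [(hθ i).symProj_gen, if_pos rfl]
      · exact map_zero _
    · intro j _ hj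
      split_ifs
      · rw [(hθ j).symProj_gen, if_neg fun e => hj (PNat.coe_injective e).symm]
      · exact map_zero _
    · exact fun h => absurd hiT h
  have h1 := key I
  rw [h, key J] at h1
  by_cases hI : i ∈ I <;> by_cases hJ : i ∈ J <;> simp_all

end FissionOperad

end

/-! ### The main theorem -/

theorem mainTheorem4 {k : Type v} [Field k] (h2 : (2 : k) ≠ 0)
    (O : FissionOperad.CyclicOperad.{u} k) :
    (∀ i : ℕ+, ∃! D : FissionOperad.SymPrim O →ₗ[k] FissionOperad.SymPrim O,
      FissionOperad.IsFission O i D) ∧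
    ∀ θ : ℕ+ → (FissionOperad.SymPrim O →ₗ[k] FissionOperad.SymPrim O),
      (∀ i, FissionOperad.IsFission O i (θ i)) →
      (∀ s, {i | θ i s ≠ 0}.Finite) ∧
      ∃ Θ : Set ℕ+ → (FissionOperad.SymPrim O →ₗ[k] FissionOperad.SymPrim O),
        (∀ I s, Θ I s = ∑ᶠ i ∈ I, θ i s) ∧
        (∀ I, Θ I ∘ₗ Θ I = 0) ∧
        (∀ I, FissionOperad.IsCoLieInfty O (Θ I)) ∧
        (∀ I J, Θ I = Θ J ↔ ∀ i, θ i ≠ 0 → (i ∈ I ↔ i ∈ J)) ∧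
        ({i | θ i ≠ 0}.Infinite ↔ ¬ (Set.range Θ).Countable) := by
  refine ⟨fun i => FissionOperad.existsUnique_isFission i, fun θ hθ => ?_⟩
  have hf := FissionOperad.finite_fission_ne_zero hθ
  have hΘ := FissionOperad.isCoLieInfty_locallyFiniteSum h2 hθ hf
  have hI := FissionOperad.locallyFiniteSum_eq_iff hθ hf
  exact ⟨hf, FissionOperad.locallyFiniteSum θ hf, fun _ _ => rfl, fun I => (hΘ I).square_zero, hΘ, hI,
    FissionOperad.infinite_iff_not_countable_range hI⟩
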